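/- Let $\Bbbk$ be a field of characteristic $\neq 2$; all superspaces are finite-dimensional $\mathbb Z_2$-graded $\Bbbk$-spaces, and $\mathfrak S_d$ acts on $M^{\otimes d}$ by place permutations with the Koszul sign rule. Let $B=\Bbbk$ (type I) or $B=\mathcal C_1=\Bbbk[c]/(c^2-1)$ with $c$ odd (type II). Let $\Gamma^d_B$ be the category of finite-dimensional right $B$-supermodules with morphism superspaces $\Gamma^d\mathrm{Hom}_B(V,W)\cong\mathrm{Hom}_{B\wr\mathfrak S_d}(V^{\otimes d},W^{\otimes d})$, composed as maps. A polynomial superfunctor of degree $d$ is an even $\Bbbk$-linear functor from $\Gamma^d_B$ to superspaces. A bisuperfunctor of degree $d$ is an even $\Bbbk$-linear functor to superspaces from the category of pairs $(V,W)$ with morphisms $\bigoplus_{e+f=d}\Gamma^e\mathrm{Hom}_B(V,V')\otimes\Gamma^f\mathrm{Hom}_B(W,W')$, composed by the rule of signs. For superfunctors $S,T$ of degrees $e,f$, let $(S\boxtimes T)(V,W)=S(V)\otimes T(W)$ (zero on the summands of bidegree $\neq(e,f)$). For a superfunctor $T$ of degree $d$ let $T^{\mathsf{bi}}(V,W)=T(V\oplus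 W)$, on which $\varphi\otimes\psi$ acts as $T(\varphi\star\psi)$, where $\varphi\star\psi\in\Gamma^d\mathrm{Hom}_B(V\oplus W,V'\oplus W')$ is the sum of $\varphi\otimes\psi$ (extended by zero) over the cosets of $\mathfrak S_e\times\mathfrak S_f$ in $\mathfrak S_d$. Let $\mathrm{Res}$ denote composition with the functor that forgets the $\mathcal C_1$-action (in both variables, for bisuperfunctors). For partitions $\mu\subset\lambda$ with $|\lambda|-|\mu|=d$, let $\Gamma_\Pi^{\lambda'/\mu'}(M)\subset M^{\otimes d}$ be the space of tensors, with places indexed by the cells of $\lambda/\mu$ read column by column, that transform by the sign character under permutations within each column. Let $S^{\lambda/\mu}(M)$ be the space of coinvariants of $M^{\otimes d}$, with places indexed by the cells read row by row, under permutations within each row. Let $\hat\theta_{\lambda/\mu}(M):\Gamma_\Pi^{\lambda'/\mu'}(M)\hookrightarrow M^{\otimes d}\to M^{\otimes d}\twoheadrightarrow S^{\lambda/\mu}(M)$, where the middle map is the place permutation from the column reading to the row reading. The Schur superfunctor is $\widehat S_{\lambda/\mu}(M)=\operatorname{Im}\hat\theta_{\lambda/\mu}(M)$, a subquotient of $M\mapsto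 M^{\otimes d}$, and $\widehat S^{\mathsf{II}}_{\lambda/\mu}=\mathrm{Res}(\widehat S_{\lambda/\mu})$. Let $\preceq$ be the lexicographic order on partitions, as sequences of row lengths $(\lambda_1,\lambda_2,\dots)$. For $\mu\subset\xi\subset\lambda$ let $$K^\xi(M,N)=\sum_{\mu\subset\nu\subset\lambda,\ \nu\preceq\xi}\operatorname{Im}\bigl(\Gamma_\Pi^{\nu'/\mu'}(M)\otimes\Gamma_\Pi^{\lambda'/\nu'}(N)\to\Gamma_\Pi^{\lambda'/\mu'}(M\oplus N)\bigr),$$ where $x\otimes y$ is mapped to the tensor with the factors of $x$ at the cells of $\nu/\mu$ and the factors of $y$ at the cells of $\lambda/\nu$, summed with signs over the shuffles, within each column of $\lambda/\mu$, of its cells in $\nu/\mu$ with its cells in $\lambda/\nu$. Let $L_\xi(M,N)=\hat\theta_{\lambda/\mu}(K^\xi(M,N))\subset\widehat S_{\lambda/\mu}(M\oplus N)$. **Corollary.** The $L_\xi$ are subfunctors of $(\widehat S_{\lambda/\mu})^{\mathsf{bi}}$, and their restrictions $L^{\mathsf{II}}_\xi=\mathrm{Res}(L_\xi)$, $\mu\subset\xi\subset\lambda$,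 are subfunctors of $(\widehat S^{\mathsf{II}}_{\lambda/\mu})^{\mathsf{bi}}$ that form a filtration: $L^{\mathsf{II}}_\nu\subset L^{\mathsf{II}}_\xi$ for $\nu\preceq\xi$, and $L^{\mathsf{II}}_\lambda=(\widehat S^{\mathsf{II}}_{\lambda/\mu})^{\mathsf{bi}}$. For each $\xi$ there is an even natural isomorphism of bisuperfunctors of type II $$L^{\mathsf{II}}_\xi\Big/\sum_{\nu\prec\xi}L^{\mathsf{II}}_\nu\;\cong\;\widehat S^{\mathsf{II}}_{\xi/\mu}\boxtimes\widehat S^{\mathsf{II}}_{\lambda/\xi},$$ so that the associated graded object is isomorphic to $\displaystyle\bigoplus_{\mu\subset\xi\subset\lambda}\widehat S^{\mathsf{II}}_{\xi/\mu}\boxtimes\widehat S^{\mathsf{II}}_{\lambda/\xi}$. -/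

import Mathlib

open scoped TensorProduct

universe u

noncomputable section

namespace SuperSchur

/-- Finite dimensional vector superspaces over `k`.  Since `2` is invertible in `k`, a
`ℤ/2`-grading `V = V₀ ⊕ V₁` is the same thing as an involution `γ`: it acts as `1` on the even
part `V₀` and as `-1` on the odd part `V₁` (see `SVec.isCompl_part`). -/
structure SVec (k : Type u) [Field k] where
  carrier : Type u
  [grp : AddCommGroup carrier]
  [mod : Module k carrier]
  [fin : Module.Finite k carrier]
  γ : carrier →ₗ[k] carrier
  γ_sq : ∀ v, γ (γ v) = v

attribute [instance] SVec.grp SVec.mod SVec.fin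

variable {k : Type u} [Field k]

/-- The sign `(-1) ^ p`. -/
def sg (k : Type u) [Field k] (p : ZMod 2) : k := if p = 0 then 1 else -1

theorem sg_zero : sg k 0 = 1 := by simp [sg]

theorem sg_one : sg k 1 = -1 := by simp [sg]

theorem zmod2_cases (p : ZMod 2) : p = 0 ∨ p = 1 := by
  revert p; decide

theorem sg_add (p q : ZMod 2) : sg k (p + q) = sg k p * sg k q := by
  have h : (1 : ZMod 2) + 1 = 0 := by decide
  rcases zmod2_cases p with rfl | rfl <;> rcases zmod2_cases q with rfl | rfl <;>
    simp [sg_zero, sg_one, h]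

theorem sg_mul_self (p : ZMod 2) : sg k p * sg k p = 1 := by
  rcases zmod2_cases p with rfl | rfl <;> simp [sg_zero, sg_one]

/-- The even part (`p = 0`) and the odd part (`p = 1`) of a superspace. -/
def SVec.part (V : SVec k) (p : ZMod 2) : Submodule k V.carrier :=
  LinearMap.ker (V.γ - sg k p • LinearMap.id)

theorem SVec.mem_part (V : SVec k) (p : ZMod 2) (v : V.carrier) :
    v ∈ V.part p ↔ V.γ v = sg k p • v := by
  simp [SVec.part, sub_eq_zero]

/-- The projection of a superspace onto its homogeneous part of parity `p`. -/
def SVec.proj (V : SVec k) (p : ZMod 2) : V.carrier →ₗ[k] V.carrier :=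
  (2 : k)⁻¹ • (LinearMap.id + sg k p • V.γ)

theorem SVec.proj_mem (V : SVec k) (p : ZMod 2) (v : V.carrier) : V.proj p v ∈ V.part p := by
  rw [SVec.mem_part]
  simp only [SVec.proj, LinearMap.smul_apply, LinearMap.add_apply, LinearMap.id_apply, map_smul,
    map_add, V.γ_sq, smul_add, smul_smul]
  rw [mul_left_comm, sg_mul_self, mul_one, add_comm, mul_comm]

theorem SVec.sum_proj [NeZero (2 : k)] (V : SVec k) (v : V.carrier) :
    ∑ p, V.proj p v = v := by
  have h : (Finset.univ : Finset (ZMod 2)) = {0, 1} := by decide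
  have h2 : (2 : k) ≠ 0 := NeZero.ne _
  rw [h, Finset.sum_pair (by decide)]
  simp only [SVec.proj, LinearMap.smul_apply, LinearMap.add_apply, LinearMap.id_apply, sg_zero,
    sg_one]
  rw [← smul_add, one_smul, neg_one_smul, add_add_add_comm, add_neg_cancel, add_zero, ← two_smul k,
    smul_smul, inv_mul_cancel₀ h2, one_smul]

theorem SVec.proj_of_mem [NeZero (2 : k)] (V : SVec k) {p : ZMod 2} {v : V.carrier}
    (h : v ∈ V.part p) (q : ZMod 2) : V.proj q v = if q = p then v else 0 := by
  have h2 : (2 : k) ≠ 0 := NeZero.ne _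
  have h3 : (1 : k) + 1 = 2 := by norm_num
  rw [SVec.mem_part] at h
  simp only [SVec.proj, LinearMap.smul_apply, LinearMap.add_apply, LinearMap.id_apply, h]
  rcases zmod2_cases p with rfl | rfl <;> rcases zmod2_cases q with rfl | rfl <;>
    simp [sg_zero, sg_one, ← two_smul k v, smul_smul, h2]

theorem SVec.isCompl_part [NeZero (2 : k)] (V : SVec k) : IsCompl (V.part 0) (V.part 1) := by
  constructor
  · rw [Submodule.disjoint_def]
    intro v h0 h1
    have a := V.proj_of_mem h0 0
    have b := V.proj_of_mem h1 0
    simp at a b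
    rw [← a, b]
  · rw [codisjoint_iff, eq_top_iff]
    intro v _
    have h : (Finset.univ : Finset (ZMod 2)) = {0, 1} := by decide
    have := V.sum_proj v
    rw [h, Finset.sum_pair (by decide)] at this
    rw [← this]
    exact Submodule.add_mem_sup (V.proj_mem 0 v) (V.proj_mem 1 v)

/-- `HasParity p f`: the linear map `f` is homogeneous of degree `p`, i.e. it maps the part of
parity `q` to the part of parity `p + q`. -/
def HasParity {V W : SVec k} (p : ZMod 2) (f : V.carrier →ₗ[k] W.carrier) : Prop :=
  ∀ v, W.γ (f v) = sg k p • f (V.γ v)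

theorem HasParity.comp {U V W : SVec k} {p q : ZMod 2} {g : V.carrier →ₗ[k] W.carrier}
    {f : U.carrier →ₗ[k] V.carrier} (hg : HasParity p g) (hf : HasParity q f) :
    HasParity (p + q) (g ∘ₗ f) := by
  intro v
  simp only [LinearMap.comp_apply]
  rw [hg, hf, map_smul, smul_smul, sg_add]

theorem hasParity_iff_part [NeZero (2 : k)] {V W : SVec k} (p : ZMod 2)
    (f : V.carrier →ₗ[k] W.carrier) :
    HasParity p f ↔ ∀ q, ∀ v ∈ V.part q, f v ∈ W.part (p + q) := by
  constructor
  · intro h q v hv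
    rw [SVec.mem_part] at hv ⊢
    rw [h, hv, map_smul, smul_smul, sg_add]
  · intro h v
    rw [← V.sum_proj v]
    simp only [map_sum, Finset.smul_sum]
    refine Finset.sum_congr rfl fun q _ => ?_
    have h1 := h q _ (V.proj_mem q v)
    rw [SVec.mem_part] at h1
    have h2 := V.proj_mem q v
    rw [SVec.mem_part] at h2
    rw [h1, h2, map_smul, smul_smul, sg_add]

/-- The direct sum of superspaces. -/
def SVec.sum (V W : SVec k) : SVec k where
  carrier := V.carrier × W.carrier
  γ := V.γ.prodMap W.γ
  γ_sq v := by simp [V.γ_sq, W.γ_sq]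

/-- The tensor product of superspaces. -/
def SVec.tensor (V W : SVec k) : SVec k where
  carrier := V.carrier ⊗[k] W.carrier
  γ := TensorProduct.map V.γ W.γ
  γ_sq v := by
    have h : TensorProduct.map V.γ W.γ ∘ₗ TensorProduct.map V.γ W.γ = LinearMap.id := by
      ext v w; simp [V.γ_sq, W.γ_sq]
    exact LinearMap.congr_fun h v

/-- The tensor power `V ^ ⊗ d` of a superspace. -/
def SVec.pow (V : SVec k) (d : ℕ) : SVec k where
  carrier := PiTensorProduct k fun _ : Fin d => V.carrier
  γ := PiTensorProduct.map fun _ => V.γ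
  γ_sq v := by
    have h : (PiTensorProduct.map fun _ : Fin d => V.γ) ∘ₗ (PiTensorProduct.map fun _ => V.γ)
        = LinearMap.id := by
      ext v; simp [V.γ_sq]
    exact LinearMap.congr_fun h v

/-- The pure tensor `v₁ ⊗ ⋯ ⊗ v_d`. -/
def pure {d : ℕ} {V : SVec k} (v : Fin d → V.carrier) : (V.pow d).carrier :=
  PiTensorProduct.tprod k v

/-- The tensor product `f₁ ⊗ ⋯ ⊗ f_d` of linear maps, without signs. -/
def powMap {d : ℕ} {V W : SVec k} (f : Fin d → V.carrier →ₗ[k] W.carrier) :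
    (V.pow d).carrier →ₗ[k] (W.pow d).carrier :=
  PiTensorProduct.map f

theorem powMap_pure {d : ℕ} {V W : SVec k} (f : Fin d → V.carrier →ₗ[k] W.carrier)
    (v : Fin d → V.carrier) : powMap f (pure v) = pure fun i => f i (v i) :=
  PiTensorProduct.map_tprod f v

theorem pow_γ_pure {d : ℕ} {V : SVec k} (v : Fin d → V.carrier) :
    (V.pow d).γ (pure v) = pure fun i => V.γ (v i) :=
  PiTensorProduct.map_tprod _ v

theorem pow_ext {d : ℕ} {V : SVec k} {X : Type*} [AddCommGroup X] [Module k X]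
    {f g : (V.pow d).carrier →ₗ[k] X} (h : ∀ v : Fin d → V.carrier, f (pure v) = g (pure v)) :
    f = g :=
  PiTensorProduct.ext (MultilinearMap.ext h)

theorem pure_eq_sum [NeZero (2 : k)] {d : ℕ} {V : SVec k} (v : Fin d → V.carrier) :
    pure v = ∑ ε : Fin d → ZMod 2, pure fun i => V.proj (ε i) (v i) := by
  have h := (PiTensorProduct.tprod k (s := fun _ : Fin d => V.carrier)).map_sum
    (fun i (p : ZMod 2) => V.proj p (v i))
  simp only [SVec.sum_proj] at h
  exact h

theorem pure_smul {d : ℕ} {V : SVec k} (c : Fin d → k) (v : Fin d → V.carrier) :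
    (pure fun i => c i • v i) = (∏ i, c i) • pure v :=
  (PiTensorProduct.tprod k (s := fun _ : Fin d => V.carrier)).map_smul_univ c v

theorem pure_eq_zero {d : ℕ} {V : SVec k} (v : Fin d → V.carrier) (i : Fin d) (h : v i = 0) :
    pure v = 0 :=
  (PiTensorProduct.tprod k (s := fun _ : Fin d => V.carrier)).map_coord_zero i h

/-- Linear maps on `V ^ ⊗ d` agree if they agree on tensors of homogeneous vectors. -/
theorem pow_ext_hom [NeZero (2 : k)] {d : ℕ} {V : SVec k} {X : Type*} [AddCommGroup X] [Module k X]
    {f g : (V.pow d).carrier →ₗ[k] X}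
    (h : ∀ (ε : Fin d → ZMod 2) (v : Fin d → V.carrier), (∀ i, v i ∈ V.part (ε i)) →
      f (pure v) = g (pure v)) : f = g := by
  refine pow_ext fun v => ?_
  rw [pure_eq_sum, map_sum, map_sum]
  exact Finset.sum_congr rfl fun ε _ => h ε _ fun i => V.proj_mem _ _

/-- The Koszul sign of moving homogeneous factors of parities `ε` from the places `s` to the
places `σ s`: a factor `-1` for each pair of odd factors whose order is reversed. -/
def koszul (k : Type u) [Field k] {d : ℕ} (ε : Fin d → ZMod 2) (σ : Equiv.Perm (Fin d)) : k :=
  ∏ p : Fin d × Fin d, if p.1 < p.2 ∧ σ p.2 < σ p.1 then sg k (ε p.1 * ε p.2) else 1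

/-- The place permutation `⊗ᵢ vᵢ ↦ ⊗ᵢ v_{σ⁻¹ i}`, without signs. -/
def place {d : ℕ} (V : SVec k) (σ : Equiv.Perm (Fin d)) :
    (V.pow d).carrier →ₗ[k] (V.pow d).carrier :=
  (PiTensorProduct.reindex k (fun _ : Fin d => V.carrier) σ).toLinearMap

theorem place_pure {d : ℕ} {V : SVec k} (σ : Equiv.Perm (Fin d)) (v : Fin d → V.carrier) :
    place V σ (pure v) = pure fun i => v (σ⁻¹ i) :=
  PiTensorProduct.reindex_tprod σ v

/-- The action of `σ` on `V ^ ⊗ d`, moving the factor at place `s` to place `σ s`, with the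
Koszul sign.  The right action of `σ` in which `(v₁ ⊗ ⋯ ⊗ v_d).σ = ± v_{σ 1} ⊗ ⋯ ⊗ v_{σ d}`
is `permAct V σ⁻¹`. -/
def permAct {d : ℕ} (V : SVec k) (σ : Equiv.Perm (Fin d)) :
    (V.pow d).carrier →ₗ[k] (V.pow d).carrier :=
  ∑ ε : Fin d → ZMod 2, koszul k ε σ • (place V σ ∘ₗ powMap fun i => V.proj (ε i))

theorem permAct_pure [NeZero (2 : k)] {d : ℕ} {V : SVec k} (σ : Equiv.Perm (Fin d))
    {ε : Fin d → ZMod 2} {v : Fin d → V.carrier} (h : ∀ i, v i ∈ V.part (ε i)) :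
    permAct V σ (pure v) = koszul k ε σ • pure fun i => v (σ⁻¹ i) := by
  rw [permAct, LinearMap.sum_apply, Finset.sum_eq_single ε]
  · rw [LinearMap.smul_apply, LinearMap.comp_apply, powMap_pure]
    have : (fun i => V.proj (ε i) (v i)) = v := by
      funext i; rw [V.proj_of_mem (h i), if_pos rfl]
    rw [this, place_pure]
  · intro ε' _ hne
    obtain ⟨i, hi⟩ := Function.ne_iff.mp hne
    rw [LinearMap.smul_apply, LinearMap.comp_apply, powMap_pure, pure_eq_zero _ i, map_zero,
      smul_zero]
    rw [V.proj_of_mem (h i), if_neg hi]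
  · simp

theorem sum_pairs {d : ℕ} (F : Fin d → Fin d → ZMod 2) (h : ∀ s, F s s = 0) :
    ∑ p : Fin d × Fin d, F p.1 p.2
      = ∑ p : Fin d × Fin d, if p.1 < p.2 then F p.1 p.2 + F p.2 p.1 else 0 := by
  have e1 : ∑ p : Fin d × Fin d, F p.1 p.2
      = ∑ p : Fin d × Fin d, ((if p.1 < p.2 then F p.1 p.2 else 0) +
        (if p.2 < p.1 then F p.1 p.2 else 0)) := by
    refine Finset.sum_congr rfl fun p _ => ?_
    rcases lt_trichotomy p.1 p.2 with hp | hp | hp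
    · simp [hp, hp.not_gt]
    · simp [hp, h]
    · simp [hp, hp.not_gt]
  rw [e1, Finset.sum_add_distrib,
    ← (Equiv.prodComm (Fin d) (Fin d)).sum_comp fun p => if p.2 < p.1 then F p.1 p.2 else 0,
    ← Finset.sum_add_distrib]
  refine Finset.sum_congr rfl fun p _ => ?_
  by_cases hp : p.1 < p.2 <;> simp [hp]

theorem koszul_eq {d : ℕ} (ε : Fin d → ZMod 2) (σ : Equiv.Perm (Fin d)) :
    koszul k ε σ
      = sg k (∑ p : Fin d × Fin d, if p.1 < p.2 ∧ σ p.2 < σ p.1 then ε p.1 * ε p.2 else 0) := by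
  have key : ∀ (s : Finset (Fin d × Fin d)),
      (∏ p ∈ s, if p.1 < p.2 ∧ σ p.2 < σ p.1 then sg k (ε p.1 * ε p.2) else 1)
      = sg k (∑ p ∈ s, if p.1 < p.2 ∧ σ p.2 < σ p.1 then ε p.1 * ε p.2 else 0) := by
    classical
    intro s
    induction s using Finset.induction_on with
    | empty => simp [sg_zero]
    | insert a s ha ih =>
      rw [Finset.prod_insert ha, Finset.sum_insert ha, sg_add, ih]
      congr 1
      split_ifs <;> simp [sg_zero]
  exact key _

theorem koszul_mul {d : ℕ} (ε : Fin d → ZMod 2) (σ τ : Equiv.Perm (Fin d)) :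
    koszul k ε (σ * τ) = koszul k ε τ * koszul k (fun i => ε (τ⁻¹ i)) σ := by
  rw [koszul_eq, koszul_eq, koszul_eq, ← sg_add]
  congr 1
  rw [← (Equiv.prodCongr τ τ).sum_comp (fun p : Fin d × Fin d =>
    if p.1 < p.2 ∧ σ p.2 < σ p.1 then ε (τ⁻¹ p.1) * ε (τ⁻¹ p.2) else 0)]
  simp only [Equiv.prodCongr_apply, Prod.map_fst, Prod.map_snd, Equiv.Perm.inv_def, Equiv.symm_apply_apply]
  rw [sum_pairs (fun s t => if τ s < τ t ∧ σ (τ t) < σ (τ s) then ε s * ε t else 0) (by simp),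
    ← Finset.sum_add_distrib]
  refine Finset.sum_congr rfl fun p _ => ?_
  obtain ⟨s, t⟩ := p
  by_cases hst : s < t
  · have h1 : τ s ≠ τ t := fun h => hst.ne (τ.injective h)
    have h2 : σ (τ s) ≠ σ (τ t) := fun h => h1 (σ.injective h)
    have h3 : ε s * ε t + ε s * ε t = 0 := CharTwo.add_self_eq_zero _
    rcases lt_or_gt_of_ne h1 with a | a <;> rcases lt_or_gt_of_ne h2 with b | b <;>
      simp [hst, a, b, a.not_gt, b.not_gt, mul_comm (ε t) (ε s), h3]
  · simp [hst]

theorem koszul_one {d : ℕ} (ε : Fin d → ZMod 2) : koszul k ε 1 = 1 := by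
  refine Finset.prod_eq_one fun p _ => ?_
  rw [if_neg]
  rintro ⟨a, b⟩
  exact absurd a b.not_gt

theorem permAct_one [NeZero (2 : k)] {d : ℕ} (V : SVec k) :
    permAct V (1 : Equiv.Perm (Fin d)) = LinearMap.id := by
  refine pow_ext_hom fun ε v h => ?_
  rw [permAct_pure 1 h, koszul_one]
  simp

theorem permAct_mul [NeZero (2 : k)] {d : ℕ} (V : SVec k) (σ τ : Equiv.Perm (Fin d)) :
    permAct V (σ * τ) = permAct V σ ∘ₗ permAct V τ := by
  refine pow_ext_hom fun ε v h => ?_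
  rw [LinearMap.comp_apply, permAct_pure _ h, permAct_pure τ h, map_smul,
    permAct_pure (ε := fun i => ε (τ⁻¹ i)) σ (fun i => h _), smul_smul, koszul_mul]
  simp [mul_inv_rev]

theorem permAct_inv_comp [NeZero (2 : k)] {d : ℕ} (V : SVec k) (σ : Equiv.Perm (Fin d)) :
    permAct V σ⁻¹ ∘ₗ permAct V σ = LinearMap.id := by
  rw [← permAct_mul, inv_mul_cancel, permAct_one]

theorem permAct_comp_inv [NeZero (2 : k)] {d : ℕ} (V : SVec k) (σ : Equiv.Perm (Fin d)) :
    permAct V σ ∘ₗ permAct V σ⁻¹ = LinearMap.id := by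
  rw [← permAct_mul, mul_inv_cancel, permAct_one]

/-- Even maps commute with the action of permutations. -/
theorem permAct_powMap [NeZero (2 : k)] {d : ℕ} {V W : SVec k} (σ : Equiv.Perm (Fin d))
    (f : Fin d → V.carrier →ₗ[k] W.carrier) (hf : ∀ i, HasParity 0 (f i)) :
    permAct W σ ∘ₗ powMap f = (powMap fun i => f (σ⁻¹ i)) ∘ₗ permAct V σ := by
  refine pow_ext_hom fun ε v h => ?_
  rw [LinearMap.comp_apply, LinearMap.comp_apply, powMap_pure, permAct_pure σ h, map_smul,
    powMap_pure, permAct_pure (ε := ε) σ]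
  intro i
  have := (hasParity_iff_part 0 (f i)).mp (hf i) _ _ (h i)
  rwa [zero_add] at this

theorem permAct_even [NeZero (2 : k)] {d : ℕ} (V : SVec k) (σ : Equiv.Perm (Fin d)) :
    HasParity (V := V.pow d) (W := V.pow d) 0 (permAct V σ) := by
  intro v
  have h := permAct_powMap σ (fun _ : Fin d => V.γ) (fun i v => by simp [sg_zero])
  rw [sg_zero, one_smul]
  exact (LinearMap.congr_fun h v).symm

/-- Finite dimensional right supermodules over the Clifford superalgebra `C_n`, which has odd
generators `c_a` with `c_a ^ 2 = 1` and `c_a c_b = - c_b c_a`: superspaces with odd operators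
`act a : v ↦ v c_a` that satisfy these relations.  For `n = 0` these are the superspaces. -/
structure SMod (k : Type u) [Field k] (n : ℕ) extends SVec k where
  act : Fin n → carrier →ₗ[k] carrier
  act_odd : ∀ a v, γ (act a v) = - act a (γ v)
  act_sq : ∀ a v, act a (act a v) = v
  act_anti : ∀ a b, a ≠ b → ∀ v, act a (act b v) = - act b (act a v)

variable {n : ℕ}

/-- The direct sum of supermodules. -/
def SMod.sum (V W : SMod k n) : SMod k n where
  toSVec := V.toSVec.sum W.toSVec
  act a := (V.act a).prodMap (W.act a)
  act_odd a v := Prod.ext (V.act_odd a v.1) (W.act_odd a v.2)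
  act_sq a v := Prod.ext (V.act_sq a v.1) (W.act_sq a v.2)
  act_anti a b h v := Prod.ext (V.act_anti a b h v.1) (W.act_anti a b h v.2)

/-- The functor that forgets the Clifford action. -/
def SMod.forget (V : SMod k n) : SMod k 0 where
  toSVec := V.toSVec
  act := Fin.elim0
  act_odd a := a.elim0
  act_sq a := a.elim0
  act_anti a := a.elim0

/-- The operator `v₁ ⊗ ⋯ ⊗ v_d ↦ (-1) ^ (|v_{i+1}| + ⋯ + |v_d|) v₁ ⊗ ⋯ ⊗ c v_i ⊗ ⋯ ⊗ v_d`. -/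
def opAt {d : ℕ} {V : SVec k} (i : Fin d) (c : V.carrier →ₗ[k] V.carrier) :
    (V.pow d).carrier →ₗ[k] (V.pow d).carrier :=
  powMap fun j => if j < i then LinearMap.id else if j = i then c else V.γ

/-- The right action on `V ^ ⊗ d` of the generator `c_a` of the `i`-th factor of `C_n ^ ⊗ d`. -/
def SMod.powAct {d : ℕ} (V : SMod k n) (i : Fin d) (a : Fin n) :
    (V.pow d).carrier →ₗ[k] (V.pow d).carrier :=
  opAt i (V.act a)

/-- The morphism superspaces `Γ^d Hom(V, W)` of the category `Γ^d` of `C_n`-supermodules, as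
`Hom(V ^ ⊗ d, W ^ ⊗ d)` over the wreath product of `C_n` with the symmetric group.  Composition
is composition of maps. -/
def hom (d : ℕ) (V W : SMod k n) : Submodule k ((V.pow d).carrier →ₗ[k] (W.pow d).carrier) where
  carrier := {φ | (∀ σ, permAct W.toSVec σ ∘ₗ φ = φ ∘ₗ permAct V.toSVec σ) ∧
    ∀ i a, W.powAct i a ∘ₗ φ = φ ∘ₗ V.powAct i a}
  add_mem' := by
    rintro φ ψ ⟨h1, h2⟩ ⟨h3, h4⟩
    exact ⟨fun σ => by rw [LinearMap.comp_add, LinearMap.add_comp, h1, h3],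
      fun i a => by rw [LinearMap.comp_add, LinearMap.add_comp, h2, h4]⟩
  zero_mem' := ⟨fun σ => by simp, fun i a => by simp⟩
  smul_mem' := by
    rintro c φ ⟨h1, h2⟩
    exact ⟨fun σ => by rw [LinearMap.comp_smul, LinearMap.smul_comp, h1],
      fun i a => by rw [LinearMap.comp_smul, LinearMap.smul_comp, h2]⟩

/-- The identity morphism. -/
def homId (d : ℕ) (V : SMod k n) : hom d V V :=
  ⟨LinearMap.id, fun _ => rfl, fun _ _ => rfl⟩

/-- The composite `ψ ∘ φ`. -/
def homComp {d : ℕ} {U V W : SMod k n} (ψ : hom d V W) (φ : hom d U V) : hom d U W :=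
  ⟨ψ.1 ∘ₗ φ.1,
    fun σ => by rw [← LinearMap.comp_assoc, ψ.2.1, LinearMap.comp_assoc, φ.2.1,
      LinearMap.comp_assoc],
    fun i a => by rw [← LinearMap.comp_assoc, ψ.2.2, LinearMap.comp_assoc, φ.2.2,
      LinearMap.comp_assoc]⟩

/-- The parity of a morphism in `hom d V W`. -/
def HomParity {d : ℕ} {V W : SMod k n} (p : ZMod 2) (φ : hom d V W) : Prop :=
  HasParity (V := V.pow d) (W := W.pow d) p φ.1

/-- The action on morphisms of the functor that forgets the Clifford action. -/
def homForget {d : ℕ} {V W : SMod k n} : hom d V W →ₗ[k] hom d V.forget W.forget where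
  toFun φ := ⟨φ.1, φ.2.1, fun _ a => a.elim0⟩
  map_add' _ _ := rfl
  map_smul' _ _ := rfl

/-- Homogeneous strict polynomial superfunctors of degree `d`: even `k`-linear functors from
the category `Γ^d` of `C_n`-supermodules to finite dimensional superspaces.  Type I is `n = 0`
and type II is `n = 1`. -/
structure PolFunctor (k : Type u) [Field k] (n d : ℕ) where
  obj : SMod k n → SVec k
  map : ∀ {V W : SMod k n}, hom d V W →ₗ[k] ((obj V).carrier →ₗ[k] (obj W).carrier)
  map_parity : ∀ {V W : SMod k n} (p : ZMod 2) (φ : hom d V W),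
    HomParity p φ → HasParity p (map φ)
  map_id : ∀ V : SMod k n, map (homId d V) = LinearMap.id
  map_comp : ∀ {U V W : SMod k n} (ψ : hom d V W) (φ : hom d U V),
    map (homComp ψ φ) = map ψ ∘ₗ map φ

/-- Restriction of a superfunctor of type I along the functor that forgets the Clifford
action. -/
def PolFunctor.res {d : ℕ} (n : ℕ) (T : PolFunctor k 0 d) : PolFunctor k n d where
  obj V := T.obj V.forget
  map := T.map ∘ₗ homForget
  map_parity p φ h := T.map_parity p (homForget φ) h
  map_id V := T.map_id V.forget
  map_comp ψ φ := T.map_comp (homForget ψ) (homForget φ)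

/-- Homogeneous strict polynomial bisuperfunctors of degree `d`: even `k`-linear functors to
finite dimensional superspaces from the category of pairs of `C_n`-supermodules with morphisms
`⨁_{e + f = d} hom e V V' ⊗ hom f W W'` from `(V, W)` to `(V', W')`, composed by the rule of
signs `(φ' ⊗ ψ') ∘ (φ ⊗ ψ) = (-1) ^ (|ψ'| |φ|) (φ' ∘ φ) ⊗ (ψ' ∘ ψ)` within a summand, and by `0`
between different summands.  The linear action on this direct sum is given by a bilinear map
for each summand. -/
structure BiFunctor (k : Type u) [Field k] (n d : ℕ) where
  obj : SMod k n → SMod k n → SVec k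
  map : ∀ {e f : ℕ} (_ : e + f = d) {V V' W W' : SMod k n},
    hom e V V' →ₗ[k] hom f W W' →ₗ[k] ((obj V W).carrier →ₗ[k] (obj V' W').carrier)
  map_parity : ∀ {e f : ℕ} (h : e + f = d) {V V' W W' : SMod k n} (p q : ZMod 2)
    (φ : hom e V V') (ψ : hom f W W'), HomParity p φ → HomParity q ψ →
      HasParity (p + q) (map h φ ψ)
  map_id : ∀ V W : SMod k n,
    ∑ e : Fin (d + 1), map (Nat.add_sub_cancel' (Nat.lt_succ_iff.mp e.2)) (homId e.1 V)
      (homId (d - e.1) W) = LinearMap.id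
  map_comp : ∀ {e f : ℕ} (h : e + f = d) {U U' V V' W W' : SMod k n} (p q : ZMod 2)
    (φ' : hom e V W) (ψ' : hom f V' W') (φ : hom e U V) (ψ : hom f U' V'),
    HomParity q ψ' → HomParity p φ →
      map h φ' ψ' ∘ₗ map h φ ψ = sg k (q * p) • map h (homComp φ' φ) (homComp ψ' ψ)
  map_comp_zero : ∀ {e f e' f' : ℕ} (h : e + f = d) (h' : e' + f' = d) (_ : e ≠ e')
    {U U' V V' W W' : SMod k n}
    (φ' : hom e' V W) (ψ' : hom f' V' W') (φ : hom e U V) (ψ : hom f U' V'),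
      map h' φ' ψ' ∘ₗ map h φ ψ = 0

/-- The conjugate of a map by `γ ^ p`. -/
def twist {V W : SVec k} (p : ZMod 2) : (V.carrier →ₗ[k] W.carrier) →ₗ[k]
    (V.carrier →ₗ[k] W.carrier) where
  toFun g := if p = 0 then g else W.γ ∘ₗ g ∘ₗ V.γ
  map_add' g g' := by
    split_ifs
    · rfl
    · ext; simp
  map_smul' c g := by
    split_ifs
    · rfl
    · ext; simp

theorem twist_zero {V W : SVec k} (g : V.carrier →ₗ[k] W.carrier) : twist 0 g = g := rfl

theorem twist_one {V W : SVec k} (g : V.carrier →ₗ[k] W.carrier) :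
    twist 1 g = W.γ ∘ₗ g ∘ₗ V.γ := rfl

theorem twist_comp {U V W : SVec k} (p : ZMod 2) (g : V.carrier →ₗ[k] W.carrier)
    (f : U.carrier →ₗ[k] V.carrier) : twist p (g ∘ₗ f) = twist p g ∘ₗ twist p f := by
  rcases zmod2_cases p with rfl | rfl
  · rfl
  · ext v; simp [twist_one, V.γ_sq]

theorem twist_of_parity {V W : SVec k} {p q : ZMod 2} {g : V.carrier →ₗ[k] W.carrier}
    (h : HasParity q g) : twist p g = sg k (q * p) • g := by
  rcases zmod2_cases p with rfl | rfl
  · ext v; simp [twist_zero, sg_zero]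
  · ext v; simp [twist_one, h _, V.γ_sq]

theorem twist_add_γ {V W : SVec k} (p : ZMod 2) (g : V.carrier →ₗ[k] W.carrier) :
    twist (p + 1) g ∘ₗ V.γ = W.γ ∘ₗ twist p g := by
  have h : (1 : ZMod 2) + 1 = 0 := by decide
  rcases zmod2_cases p with rfl | rfl
  · ext v; simp [twist_one, twist_zero, V.γ_sq]
  · ext v; simp [twist_one, h, twist_zero, W.γ_sq]

/-- The tensor product of linear maps of superspaces by the rule of signs,
`(f ⊗ g) (x ⊗ y) = (-1) ^ (|g| |x|) f x ⊗ g y`. -/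
def superTensor {U U' W W' : SVec k} : (U.carrier →ₗ[k] U'.carrier) →ₗ[k]
    (W.carrier →ₗ[k] W'.carrier) →ₗ[k]
      ((U.tensor W).carrier →ₗ[k] (U'.tensor W').carrier) :=
  (LinearMap.mk₂ k (fun f g => ∑ p : ZMod 2, TensorProduct.map (f ∘ₗ U.proj p) (twist p g))
    (fun f f' g => by simp [LinearMap.add_comp, TensorProduct.map_add_left, Finset.sum_add_distrib])
    (fun c f g => by simp [LinearMap.smul_comp, TensorProduct.map_smul_left, Finset.smul_sum])
    (fun f g g' => by simp [TensorProduct.map_add_right, Finset.sum_add_distrib])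
    (fun c f g => by simp [TensorProduct.map_smul_right, Finset.smul_sum]) :
    (U.carrier →ₗ[k] U'.carrier) →ₗ[k] (W.carrier →ₗ[k] W'.carrier) →ₗ[k]
      (U.carrier ⊗[k] W.carrier →ₗ[k] U'.carrier ⊗[k] W'.carrier))

/-- A pure tensor in the tensor product of two superspaces. -/
def tmul {U W : SVec k} (x : U.carrier) (y : W.carrier) : (U.tensor W).carrier := x ⊗ₜ[k] y

theorem superTensor_tmul [NeZero (2 : k)] {U U' W W' : SVec k} (f : U.carrier →ₗ[k] U'.carrier)
    (g : W.carrier →ₗ[k] W'.carrier) {p : ZMod 2} {x : U.carrier} (hx : x ∈ U.part p)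
    (y : W.carrier) : superTensor f g (tmul x y) = tmul (f x) (twist p g y) := by
  have : superTensor f g (tmul x y)
      = ∑ q : ZMod 2, (f (U.proj q x)) ⊗ₜ[k] (twist q g y) := by
    change (∑ p : ZMod 2, TensorProduct.map (f ∘ₗ U.proj p) (twist p g)) (x ⊗ₜ[k] y) = _
    rw [LinearMap.sum_apply]
    rfl
  rw [this, Finset.sum_eq_single p]
  · rw [U.proj_of_mem hx, if_pos rfl]; rfl
  · intro q _ hq
    rw [U.proj_of_mem hx, if_neg hq]; simp
  · simp

theorem tensor_ext_hom [NeZero (2 : k)] {U W : SVec k} {X : Type*} [AddCommGroup X] [Module k X]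
    {f g : (U.tensor W).carrier →ₗ[k] X}
    (h : ∀ (p : ZMod 2) (x : U.carrier) (y : W.carrier), x ∈ U.part p →
      f (tmul x y) = g (tmul x y)) : f = g := by
  refine TensorProduct.ext' fun x y => ?_
  have : x ⊗ₜ[k] y = ∑ p, tmul (U.proj p x) y := by
    conv_lhs => rw [← U.sum_proj x]
    exact TensorProduct.sum_tmul _ _ _
  rw [this]
  erw [map_sum, map_sum]
  exact Finset.sum_congr rfl fun p _ => h p _ y (U.proj_mem p x)

theorem tensor_γ {U W : SVec k} (x : U.carrier) (y : W.carrier) :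
    (U.tensor W).γ (tmul x y) = tmul (U.γ x) (W.γ y) := rfl

theorem tmul_smul_left {U W : SVec k} (c : k) (x : U.carrier) (y : W.carrier) :
    tmul (c • x) y = c • tmul x y := rfl

theorem tmul_smul_right {U W : SVec k} (c : k) (x : U.carrier) (y : W.carrier) :
    tmul x (c • y) = c • tmul x y := TensorProduct.tmul_smul c x y

theorem superTensor_id [NeZero (2 : k)] (U W : SVec k) :
    superTensor (LinearMap.id : U.carrier →ₗ[k] U.carrier)
      (LinearMap.id : W.carrier →ₗ[k] W.carrier) = LinearMap.id := by
  refine tensor_ext_hom fun p x y hx => ?_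
  rw [superTensor_tmul _ _ hx,
    twist_of_parity (q := 0) (fun v => by simp [sg_zero])]
  simp [sg_zero]

theorem superTensor_comp [NeZero (2 : k)] {U V W U' V' W' : SVec k} {p q : ZMod 2}
    (f' : V.carrier →ₗ[k] W.carrier) (g' : V'.carrier →ₗ[k] W'.carrier)
    (f : U.carrier →ₗ[k] V.carrier) (g : U'.carrier →ₗ[k] V'.carrier)
    (hg' : HasParity q g') (hf : HasParity p f) :
    superTensor f' g' ∘ₗ superTensor f g = sg k (q * p) • superTensor (f' ∘ₗ f) (g' ∘ₗ g) := by
  refine tensor_ext_hom fun r x y hx => ?_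
  have hfx := (hasParity_iff_part p f).mp hf r x hx
  rw [LinearMap.comp_apply, LinearMap.smul_apply, superTensor_tmul _ _ hx,
    superTensor_tmul _ _ hfx, superTensor_tmul _ _ hx, twist_comp, twist_of_parity hg',
    twist_of_parity hg', LinearMap.comp_apply, LinearMap.smul_apply, LinearMap.comp_apply,
    LinearMap.smul_apply, tmul_smul_right, tmul_smul_right, smul_smul, mul_add, sg_add]

theorem superTensor_parity [NeZero (2 : k)] {U U' W W' : SVec k} {p q : ZMod 2}
    {f : U.carrier →ₗ[k] U'.carrier} {g : W.carrier →ₗ[k] W'.carrier}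
    (hf : HasParity p f) (hg : HasParity q g) : HasParity (p + q) (superTensor f g) := by
  have : (U'.tensor W').γ ∘ₗ superTensor f g
      = sg k (p + q) • (superTensor f g ∘ₗ (U.tensor W).γ) := by
    refine tensor_ext_hom fun r x y hx => ?_
    have hx' : U.γ x ∈ U.part r := by
      rw [SVec.mem_part] at hx ⊢
      rw [hx, map_smul, hx]
    rw [LinearMap.comp_apply, LinearMap.smul_apply, LinearMap.comp_apply, tensor_γ,
      superTensor_tmul _ _ hx, superTensor_tmul _ _ hx', tensor_γ, hf, twist_of_parity hg,
      LinearMap.smul_apply, LinearMap.smul_apply, map_smul, hg, tmul_smul_left, tmul_smul_right,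
      tmul_smul_right, tmul_smul_right, smul_smul, smul_smul, smul_smul, sg_add]
    congr 1
    ring
  exact fun v => LinearMap.congr_fun this v

/-- Transport of morphisms along an equality of degrees. -/
def homCast {e e' : ℕ} (h : e' = e) {V W : SMod k n} : hom e' V W →ₗ[k] hom e V W :=
  h ▸ LinearMap.id

/-- The external tensor product of superfunctors. -/
def PolFunctor.box [NeZero (2 : k)] {e f d : ℕ} (h : e + f = d) (S : PolFunctor k n e)
    (T : PolFunctor k n f) : BiFunctor k n d where
  obj V W := (S.obj V).tensor (T.obj W)
  map {e' f'} h' {V V' W W'} :=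
    if he : e' = e then
      superTensor.compl₁₂ (S.map ∘ₗ homCast he)
        (T.map ∘ₗ homCast (show f' = f by omega))
    else 0
  map_parity := by
    intro e' f' h' V V' W W' p q φ ψ hφ hψ
    by_cases he : e' = e
    · subst he
      obtain rfl : f' = f := by omega
      simp only [dite_true]
      exact superTensor_parity (S.map_parity p φ hφ) (T.map_parity q ψ hψ)
    · simp only [dif_neg he, LinearMap.zero_apply]
      intro v; simp
  map_id V W := by
    rw [Finset.sum_eq_single ⟨e, by omega⟩]
    · obtain rfl : f = d - e := by omega
      simp only [dite_true]
      change superTensor (S.map (homId e V)) (T.map (homId (d - e) W)) = _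
      rw [S.map_id, T.map_id, superTensor_id]
    · intro b _ hb
      have : (b : ℕ) ≠ e := fun h => hb (Fin.ext h)
      simp only [dif_neg this, LinearMap.zero_apply]
    · simp
  map_comp := by
    intro e' f' h' U U' V V' W W' p q φ' ψ' φ ψ hψ' hφ
    by_cases he : e' = e
    · subst he
      obtain rfl : f' = f := by omega
      simp only [dite_true]
      change superTensor (S.map φ') (T.map ψ') ∘ₗ superTensor (S.map φ) (T.map ψ)
        = sg k (q * p) • superTensor (S.map (homComp φ' φ)) (T.map (homComp ψ' ψ))
      rw [superTensor_comp _ _ _ _ (T.map_parity q ψ' hψ') (S.map_parity p φ hφ), S.map_comp,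
        T.map_comp]
    · simp only [dif_neg he, LinearMap.zero_apply]
      simp
  map_comp_zero := by
    intro e₁ f₁ e₂ f₂ h₁ h₂ hne U U' V V' W W' φ' ψ' φ ψ
    by_cases he : e₁ = e
    · have : e₂ ≠ e := fun h => hne (he.trans h.symm)
      simp only [dif_neg this, LinearMap.zero_apply, LinearMap.zero_comp]
    · simp only [dif_neg he, LinearMap.zero_apply, LinearMap.comp_zero]

/-- The Young subgroup of the permutations that preserve a colouring of the places. -/
def young {d : ℕ} {κ : Type*} (c : Fin d → κ) : Subgroup (Equiv.Perm (Fin d)) where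
  carrier := {σ | ∀ i, c (σ i) = c i}
  one_mem' _ := rfl
  mul_mem' {σ τ} h1 h2 i := (h1 (τ i)).trans (h2 i)
  inv_mem' {σ} h i := by
    have := h (σ⁻¹ i)
    rw [← this]
    simp

instance instFintypeCosets {d : ℕ} (H : Subgroup (Equiv.Perm (Fin d))) :
    Fintype (Equiv.Perm (Fin d) ⧸ H) := Fintype.ofFinite _

theorem mem_young {d : ℕ} {κ : Type*} {c : Fin d → κ} {σ : Equiv.Perm (Fin d)} :
    σ ∈ young c ↔ ∀ i, c (σ i) = c i := Iff.rfl

/-- The places `1, …, d` as `e` places followed by `f` places. -/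
def places {e f d : ℕ} (h : e + f = d) : Fin e ⊕ Fin f ≃ Fin d :=
  finSumFinEquiv.trans (finCongr h)

theorem places_inl {e f d : ℕ} (h : e + f = d) (i : Fin e) : (places h (.inl i)).val = i.val := by
  simp [places]

theorem places_inr {e f d : ℕ} (h : e + f = d) (i : Fin f) :
    (places h (.inr i)).val = e + i.val := by
  simp [places]

theorem places_lt {e f d : ℕ} (h : e + f = d) (x y : Fin e ⊕ Fin f) :
    places h x < places h y ↔ toLex x < toLex y := by
  rw [← Fin.val_fin_lt]
  rcases x with x | x <;> rcases y with y | y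
  · rw [places_inl, places_inl, Sum.Lex.inl_lt_inl_iff, Fin.val_fin_lt]
  · rw [places_inl, places_inr]
    exact ⟨fun _ => Sum.Lex.inl_lt_inr _ _, fun _ => by omega⟩
  · rw [places_inr, places_inl]
    exact ⟨fun _ => by omega, fun h => absurd h Sum.Lex.not_inr_lt_inl⟩
  · rw [places_inr, places_inr, Sum.Lex.inr_lt_inr_iff, Nat.add_lt_add_iff_left, Fin.val_fin_lt]

/-- The identification `V ^ ⊗ e ⊗ V ^ ⊗ f = V ^ ⊗ d` for `e + f = d`. -/
def join {e f d : ℕ} (h : e + f = d) (V : SVec k) :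
    ((V.pow e).tensor (V.pow f)).carrier ≃ₗ[k] (V.pow d).carrier :=
  (PiTensorProduct.tmulEquiv k V.carrier).trans
    (PiTensorProduct.reindex k (fun _ => V.carrier) (places h))

theorem join_pure {e f d : ℕ} (h : e + f = d) {V : SVec k} (x : Fin e → V.carrier)
    (y : Fin f → V.carrier) :
    join h V (tmul (pure x) (pure y)) = pure fun i => Sum.elim x y ((places h).symm i) := by
  change PiTensorProduct.reindex k (fun _ => V.carrier) (places h)
    (PiTensorProduct.tmulEquiv k V.carrier
      ((PiTensorProduct.tprod k x) ⊗ₜ[k] (PiTensorProduct.tprod k y))) = _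
  rw [PiTensorProduct.tmulEquiv_apply]
  exact PiTensorProduct.reindex_tprod _ _

theorem join_symm_pure {e f d : ℕ} (h : e + f = d) {V : SVec k} (v : Fin d → V.carrier) :
    (join h V).symm (pure v) = tmul (pure fun i => v (places h (.inl i)))
      (pure fun i => v (places h (.inr i))) := by
  rw [LinearEquiv.symm_apply_eq, join_pure]
  congr 1
  funext i
  obtain ⟨j, rfl⟩ := (places h).surjective i
  rw [Equiv.symm_apply_apply]
  rcases j with j | j <;> rfl

/-- The inclusions and projections of a direct sum. -/
def inl (V W : SVec k) : V.carrier →ₗ[k] (V.sum W).carrier := LinearMap.inl k V.carrier W.carrier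

def inr (V W : SVec k) : W.carrier →ₗ[k] (V.sum W).carrier := LinearMap.inr k V.carrier W.carrier

def fst (V W : SVec k) : (V.sum W).carrier →ₗ[k] V.carrier := LinearMap.fst k V.carrier W.carrier

def snd (V W : SVec k) : (V.sum W).carrier →ₗ[k] W.carrier := LinearMap.snd k V.carrier W.carrier

/-- The extension by zero of a map `V ^ ⊗ e → V' ^ ⊗ e` to `(V ⊕ W) ^ ⊗ e → (V' ⊕ W') ^ ⊗ e`. -/
def extL {e : ℕ} {V V' : SVec k} (W W' : SVec k) :
    ((V.pow e).carrier →ₗ[k] (V'.pow e).carrier) →ₗ[k]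
      (((V.sum W).pow e).carrier →ₗ[k] ((V'.sum W').pow e).carrier) where
  toFun φ := (powMap fun _ => inl V' W') ∘ₗ φ ∘ₗ (powMap fun _ => fst V W)
  map_add' φ ψ := by rw [LinearMap.add_comp, LinearMap.comp_add]
  map_smul' c φ := by rw [LinearMap.smul_comp, LinearMap.comp_smul]; rfl

/-- The extension by zero of a map `W ^ ⊗ f → W' ^ ⊗ f` to `(V ⊕ W) ^ ⊗ f → (V' ⊕ W') ^ ⊗ f`. -/
def extR {f : ℕ} (V V' : SVec k) {W W' : SVec k} :
    ((W.pow f).carrier →ₗ[k] (W'.pow f).carrier) →ₗ[k]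
      (((V.sum W).pow f).carrier →ₗ[k] ((V'.sum W').pow f).carrier) where
  toFun φ := (powMap fun _ => inr V' W') ∘ₗ φ ∘ₗ (powMap fun _ => snd V W)
  map_add' φ ψ := by rw [LinearMap.add_comp, LinearMap.comp_add]
  map_smul' c φ := by rw [LinearMap.smul_comp, LinearMap.comp_smul]; rfl

/-- The map `φ ⊗ ψ` on `(V ⊕ W) ^ ⊗ d`, where `φ : V ^ ⊗ e → V' ^ ⊗ e` acts on the first `e`
places, `ψ : W ^ ⊗ f → W' ^ ⊗ f` on the last `f` places, and both are extended by zero. -/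
def core {e f d : ℕ} (h : e + f = d) {V V' W W' : SVec k} :
    ((V.pow e).carrier →ₗ[k] (V'.pow e).carrier) →ₗ[k]
    ((W.pow f).carrier →ₗ[k] (W'.pow f).carrier) →ₗ[k]
      (((V.sum W).pow d).carrier →ₗ[k] ((V'.sum W').pow d).carrier) :=
  LinearMap.compr₂ (superTensor.compl₁₂ (extL W W') (extR V V'))
    ((join h (V.sum W)).arrowCongr (join h (V'.sum W'))).toLinearMap

theorem core_apply {e f d : ℕ} (h : e + f = d) {V V' W W' : SVec k}
    (φ : (V.pow e).carrier →ₗ[k] (V'.pow e).carrier)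
    (ψ : (W.pow f).carrier →ₗ[k] (W'.pow f).carrier) :
    core h φ ψ = (join h (V'.sum W')).toLinearMap ∘ₗ superTensor (extL W W' φ) (extR V V' ψ) ∘ₗ
      (join h (V.sum W)).symm.toLinearMap := rfl

/-- The first `e` of `d` places. -/
def isFirst (e d : ℕ) (i : Fin d) : Bool := decide (i.val < e)

/-- The product `φ ⋆ ψ = ∑ σ, (φ ⊗ ψ).σ` over the cosets of `𝔖_e × 𝔖_f` in `𝔖_d`, where `𝔖_d`
acts by conjugation. -/
def star {e f d : ℕ} (h : e + f = d) {V V' W W' : SVec k} :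
    ((V.pow e).carrier →ₗ[k] (V'.pow e).carrier) →ₗ[k]
    ((W.pow f).carrier →ₗ[k] (W'.pow f).carrier) →ₗ[k]
      (((V.sum W).pow d).carrier →ₗ[k] ((V'.sum W').pow d).carrier) :=
  LinearMap.compr₂ (core h) (∑ q : Equiv.Perm (Fin d) ⧸ young (isFirst e d),
    (LinearMap.lcomp k _ (permAct (V.sum W) q.out⁻¹)) ∘ₗ
      (LinearMap.llcomp k _ _ _ (permAct (V'.sum W') q.out)))

theorem star_apply {e f d : ℕ} (h : e + f = d) {V V' W W' : SVec k}
    (φ : (V.pow e).carrier →ₗ[k] (V'.pow e).carrier)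
    (ψ : (W.pow f).carrier →ₗ[k] (W'.pow f).carrier) :
    star h φ ψ = ∑ q : Equiv.Perm (Fin d) ⧸ young (isFirst e d),
      permAct (V'.sum W') q.out ∘ₗ core h φ ψ ∘ₗ permAct (V.sum W) q.out⁻¹ := by
  rw [star, LinearMap.compr₂_apply, LinearMap.sum_apply]
  rfl

theorem part_pow {d : ℕ} {V : SVec k} {ε : Fin d → ZMod 2} {v : Fin d → V.carrier}
    (h : ∀ i, v i ∈ V.part (ε i)) : pure v ∈ (V.pow d).part (∑ i, ε i) := by
  have key : ∀ s : Finset (Fin d), ∏ i ∈ s, sg k (ε i) = sg k (∑ i ∈ s, ε i) := by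
    classical
    intro s
    induction s using Finset.induction_on with
    | empty => simp [sg_zero]
    | insert a s ha ih => rw [Finset.prod_insert ha, Finset.sum_insert ha, sg_add, ih]
  rw [SVec.mem_part, pow_γ_pure, ← key, ← pure_smul]
  congr 1
  funext i
  exact (V.mem_part _ _).mp (h i)

theorem tensor_pow_ext [NeZero (2 : k)] {e f : ℕ} {V W : SVec k} {X : Type*} [AddCommGroup X]
    [Module k X] {F G : ((V.pow e).tensor (W.pow f)).carrier →ₗ[k] X}
    (h : ∀ (ε : Fin e → ZMod 2) (δ : Fin f → ZMod 2) (x : Fin e → V.carrier)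
      (y : Fin f → W.carrier), (∀ i, x i ∈ V.part (ε i)) → (∀ i, y i ∈ W.part (δ i)) →
      F (tmul (pure x) (pure y)) = G (tmul (pure x) (pure y))) : F = G := by
  refine TensorProduct.ext (pow_ext_hom fun ε x hx => pow_ext_hom fun δ y hy => ?_)
  exact h ε δ x y hx hy

theorem koszul_sum {e f d : ℕ} (h : e + f = d) (ε : Fin e → ZMod 2) (δ : Fin f → ZMod 2)
    (σ : Equiv.Perm (Fin e)) (τ : Equiv.Perm (Fin f)) :
    koszul k (fun i => Sum.elim ε δ ((places h).symm i))
      ((places h).permCongr (Equiv.Perm.sumCongr σ τ)) = koszul k ε σ * koszul k δ τ := by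
  rw [koszul, ← (Equiv.prodCongr (places h) (places h)).prod_comp]
  simp only [Equiv.prodCongr_apply, Prod.map_fst, Prod.map_snd, Equiv.permCongr_apply,
    Equiv.symm_apply_apply, places_lt]
  rw [Fintype.prod_prod_type]
  simp only [Fintype.prod_sum_type, Equiv.Perm.sumCongr_apply, Sum.map_inl, Sum.map_inr,
    Sum.elim_inl, Sum.elim_inr, Sum.Lex.inl_lt_inl_iff, Sum.Lex.inr_lt_inr_iff,
    Sum.Lex.inl_lt_inr, Sum.Lex.not_inr_lt_inl, false_and, and_false, if_false,
    Finset.prod_const_one, mul_one, one_mul]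
  rw [koszul, koszul, Fintype.prod_prod_type, Fintype.prod_prod_type]

theorem permAct_mem [NeZero (2 : k)] {d : ℕ} {V : SVec k} (σ : Equiv.Perm (Fin d)) (p : ZMod 2)
    {v : (V.pow d).carrier} (h : v ∈ (V.pow d).part p) : permAct V σ v ∈ (V.pow d).part p := by
  have := (hasParity_iff_part 0 _).mp (permAct_even V σ) p v h
  rwa [zero_add] at this

theorem join_permAct [NeZero (2 : k)] {e f d : ℕ} (h : e + f = d) (V : SVec k)
    (σ : Equiv.Perm (Fin e)) (τ : Equiv.Perm (Fin f)) :
    (join h V).toLinearMap ∘ₗ superTensor (permAct V σ) (permAct V τ)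
      = permAct V ((places h).permCongr (Equiv.Perm.sumCongr σ τ)) ∘ₗ
        (join h V).toLinearMap := by
  refine tensor_pow_ext fun ε δ x y hx hy => ?_
  rw [LinearMap.comp_apply, LinearMap.comp_apply, superTensor_tmul _ _ (part_pow hx),
    twist_of_parity (permAct_even V τ), zero_mul, sg_zero, one_smul, LinearEquiv.coe_coe,
    permAct_pure σ hx, permAct_pure τ hy, tmul_smul_left, tmul_smul_right, map_smul, map_smul,
    join_pure, join_pure,
    permAct_pure (ε := fun i => Sum.elim ε δ ((places h).symm i)), koszul_sum, smul_smul]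
  · congr 2
    funext i
    obtain ⟨j, rfl⟩ := (places h).surjective i
    have : ((places h).permCongr (Equiv.Perm.sumCongr σ τ))⁻¹ (places h j)
        = places h ((Equiv.Perm.sumCongr σ τ)⁻¹ j) := by
      rw [Equiv.Perm.inv_eq_iff_eq, Equiv.permCongr_apply, Equiv.symm_apply_apply,
        Equiv.Perm.inv_def, Equiv.apply_symm_apply]
    rw [this, Equiv.symm_apply_apply, Equiv.symm_apply_apply]
    rcases j with j | j <;> rfl
  · intro i
    obtain ⟨j, rfl⟩ := (places h).surjective i
    rw [Equiv.symm_apply_apply]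
    rcases j with j | j
    · exact hx j
    · exact hy j

/-- A permutation that preserves the first `e` places is a pair of permutations. -/
theorem exists_of_mem_young {e f d : ℕ} (h : e + f = d) {σ : Equiv.Perm (Fin d)}
    (hσ : σ ∈ young (isFirst e d)) : ∃ (α : Equiv.Perm (Fin e)) (β : Equiv.Perm (Fin f)),
      σ = (places h).permCongr (Equiv.Perm.sumCongr α β) := by
  have h1 : (places h).symm.permCongr σ ∈ (Equiv.Perm.sumCongrHom (Fin e) (Fin f)).range := by
    refine Equiv.Perm.mem_sumCongrHom_range_of_perm_mapsTo_inl ?_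
    rintro _ ⟨i, rfl⟩
    have h2 := hσ (places h (.inl i))
    rw [Equiv.permCongr_apply, Equiv.symm_symm]
    obtain ⟨j, hj⟩ := (places h).surjective (σ (places h (.inl i)))
    rw [← hj] at h2 ⊢
    rw [Equiv.symm_apply_apply]
    rcases j with j | j
    · exact ⟨j, rfl⟩
    · have := i.2
      have := j.2
      simp [isFirst, places_inl, places_inr] at h2
  obtain ⟨⟨α, β⟩, hαβ⟩ := h1
  refine ⟨α, β, ?_⟩
  have h3 : Equiv.Perm.sumCongr α β = (places h).symm.permCongr σ := hαβ
  rw [h3]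
  ext i
  simp [Equiv.permCongr_apply]

theorem extL_permAct [NeZero (2 : k)] {e : ℕ} {V V' : SVec k} (W W' : SVec k)
    {φ : (V.pow e).carrier →ₗ[k] (V'.pow e).carrier}
    (hφ : ∀ σ, permAct V' σ ∘ₗ φ = φ ∘ₗ permAct V σ) (σ : Equiv.Perm (Fin e)) :
    permAct (V'.sum W') σ ∘ₗ extL W W' φ = extL W W' φ ∘ₗ permAct (V.sum W) σ := by
  have h1 : permAct (V'.sum W') σ ∘ₗ (powMap fun _ => inl V' W')
      = (powMap fun _ => inl V' W') ∘ₗ permAct V' σ :=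
    permAct_powMap σ _ fun i v => by
      rw [sg_zero, one_smul]; exact Prod.ext rfl (map_zero W'.γ)
  have h2 : permAct V σ ∘ₗ (powMap fun _ => fst V W)
      = (powMap fun _ => fst V W) ∘ₗ permAct (V.sum W) σ :=
    permAct_powMap σ _ fun i v => by rw [sg_zero, one_smul]; rfl
  change permAct (V'.sum W') σ ∘ₗ ((powMap fun _ => inl V' W') ∘ₗ φ ∘ₗ (powMap fun _ => fst V W))
    = ((powMap fun _ => inl V' W') ∘ₗ φ ∘ₗ (powMap fun _ => fst V W)) ∘ₗ permAct (V.sum W) σ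
  rw [LinearMap.comp_assoc, LinearMap.comp_assoc, ← h2, ← LinearMap.comp_assoc, h1,
    LinearMap.comp_assoc, ← LinearMap.comp_assoc _ φ, hφ, LinearMap.comp_assoc]

theorem extR_permAct [NeZero (2 : k)] {f : ℕ} (V V' : SVec k) {W W' : SVec k}
    {φ : (W.pow f).carrier →ₗ[k] (W'.pow f).carrier}
    (hφ : ∀ σ, permAct W' σ ∘ₗ φ = φ ∘ₗ permAct W σ) (σ : Equiv.Perm (Fin f)) :
    permAct (V'.sum W') σ ∘ₗ extR V V' φ = extR V V' φ ∘ₗ permAct (V.sum W) σ := by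
  have h1 : permAct (V'.sum W') σ ∘ₗ (powMap fun _ => inr V' W')
      = (powMap fun _ => inr V' W') ∘ₗ permAct W' σ :=
    permAct_powMap σ _ fun i v => by
      rw [sg_zero, one_smul]; exact Prod.ext (map_zero V'.γ) rfl
  have h2 : permAct W σ ∘ₗ (powMap fun _ => snd V W)
      = (powMap fun _ => snd V W) ∘ₗ permAct (V.sum W) σ :=
    permAct_powMap σ _ fun i v => by rw [sg_zero, one_smul]; rfl
  change permAct (V'.sum W') σ ∘ₗ ((powMap fun _ => inr V' W') ∘ₗ φ ∘ₗ (powMap fun _ => snd V W))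
    = ((powMap fun _ => inr V' W') ∘ₗ φ ∘ₗ (powMap fun _ => snd V W)) ∘ₗ permAct (V.sum W) σ
  rw [LinearMap.comp_assoc, LinearMap.comp_assoc, ← h2, ← LinearMap.comp_assoc, h1,
    LinearMap.comp_assoc, ← LinearMap.comp_assoc _ φ, hφ, LinearMap.comp_assoc]

/-- `superTensor` is compatible with even maps on both sides. -/
theorem superTensor_comm [NeZero (2 : k)] {U U' W W' : SVec k}
    {F : U.carrier →ₗ[k] U'.carrier} {G : W.carrier →ₗ[k] W'.carrier}
    {a : U.carrier →ₗ[k] U.carrier} {a' : U'.carrier →ₗ[k] U'.carrier}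
    {b : W.carrier →ₗ[k] W.carrier} {b' : W'.carrier →ₗ[k] W'.carrier}
    (ha : HasParity 0 a) (hb : HasParity 0 b) (hb' : HasParity 0 b')
    (h1 : a' ∘ₗ F = F ∘ₗ a) (h2 : b' ∘ₗ G = G ∘ₗ b) :
    superTensor a' b' ∘ₗ superTensor F G = superTensor F G ∘ₗ superTensor a b := by
  have tw : ∀ {X Y : SVec k} (p : ZMod 2) {c : X.carrier →ₗ[k] Y.carrier}, HasParity 0 c →
      twist p c = c := fun p c hc => by
    rw [twist_of_parity hc, zero_mul, sg_zero, one_smul]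
  refine tensor_ext_hom fun p x y hx => ?_
  have hax := (hasParity_iff_part 0 a).mp ha p x hx
  rw [zero_add] at hax
  have key : ∀ (u : U'.carrier) (w : W'.carrier),
      superTensor a' b' (tmul u w) = tmul (a' u) (b' w) := by
    intro u w
    have : superTensor a' b' = TensorProduct.map a' b' := by
      refine tensor_ext_hom fun p x y hx => ?_
      rw [superTensor_tmul _ _ hx, tw p hb']
      rfl
    rw [this]
    rfl
  rw [LinearMap.comp_apply, LinearMap.comp_apply, superTensor_tmul _ _ hx, key,
    superTensor_tmul _ _ hx, superTensor_tmul _ _ hax, tw p hb]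
  have e1 : b' (twist p G y) = twist p G (b y) := by
    have : twist p (b' ∘ₗ G) = twist p (G ∘ₗ b) := by rw [h2]
    rw [twist_comp, twist_comp, tw p hb, tw p hb'] at this
    exact LinearMap.congr_fun this y
  rw [e1]
  exact congrArg (fun t => tmul t _) (LinearMap.congr_fun h1 x)

/-- `φ ⊗ ψ` commutes with `𝔖_e × 𝔖_f`. -/
theorem core_permAct [NeZero (2 : k)] {e f d : ℕ} (h : e + f = d) {V V' W W' : SVec k}
    {φ : (V.pow e).carrier →ₗ[k] (V'.pow e).carrier}
    {ψ : (W.pow f).carrier →ₗ[k] (W'.pow f).carrier}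
    (hφ : ∀ σ, permAct V' σ ∘ₗ φ = φ ∘ₗ permAct V σ)
    (hψ : ∀ σ, permAct W' σ ∘ₗ ψ = ψ ∘ₗ permAct W σ)
    {σ : Equiv.Perm (Fin d)} (hσ : σ ∈ young (isFirst e d)) :
    permAct (V'.sum W') σ ∘ₗ core h φ ψ = core h φ ψ ∘ₗ permAct (V.sum W) σ := by
  obtain ⟨α, β, rfl⟩ := exists_of_mem_young h hσ
  have h1 := join_permAct h (V'.sum W') α β
  have h2 := join_permAct h (V.sum W) α β
  have h3 := superTensor_comm (permAct_even (V.sum W) α) (permAct_even _ β) (permAct_even _ β)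
    (extL_permAct W W' hφ α) (extR_permAct V V' hψ β)
  rw [core_apply, ← LinearMap.comp_assoc, ← h1, LinearMap.comp_assoc, ← LinearMap.comp_assoc _ _
    (superTensor _ _), h3]
  ext x
  obtain ⟨y, rfl⟩ := (join h (V.sum W)).surjective x
  have h4 := LinearMap.congr_fun h2 y
  simp only [LinearMap.comp_apply, LinearEquiv.coe_coe, LinearEquiv.symm_apply_apply] at h4 ⊢
  rw [← h4, LinearEquiv.symm_apply_apply]

theorem comp_finsum {ι : Type*} {X Y Z : Type*} [AddCommGroup X] [AddCommGroup Y] [AddCommGroup Z]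
    [Module k X] [Module k Y] [Module k Z] (s : Finset ι) (g : Y →ₗ[k] Z) (F : ι → X →ₗ[k] Y) :
    g ∘ₗ (∑ i ∈ s, F i) = ∑ i ∈ s, g ∘ₗ F i := by
  ext x; simp [LinearMap.sum_apply]

theorem finsum_comp {ι : Type*} {X Y Z : Type*} [AddCommGroup X] [AddCommGroup Y] [AddCommGroup Z]
    [Module k X] [Module k Y] [Module k Z] (s : Finset ι) (F : ι → Y →ₗ[k] Z) (g : X →ₗ[k] Y) :
    (∑ i ∈ s, F i) ∘ₗ g = ∑ i ∈ s, F i ∘ₗ g := by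
  ext x; simp [LinearMap.sum_apply]

theorem star_permAct [NeZero (2 : k)] {e f d : ℕ} (h : e + f = d) {V V' W W' : SVec k}
    {φ : (V.pow e).carrier →ₗ[k] (V'.pow e).carrier}
    {ψ : (W.pow f).carrier →ₗ[k] (W'.pow f).carrier}
    (hφ : ∀ σ, permAct V' σ ∘ₗ φ = φ ∘ₗ permAct V σ)
    (hψ : ∀ σ, permAct W' σ ∘ₗ ψ = ψ ∘ₗ permAct W σ) (σ : Equiv.Perm (Fin d)) :
    permAct (V'.sum W') σ ∘ₗ star h φ ψ = star h φ ψ ∘ₗ permAct (V.sum W) σ := by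
  -- the summand of a coset does not depend on the representative
  have key : ∀ τ : Equiv.Perm (Fin d),
      permAct (V'.sum W') (QuotientGroup.mk (s := young (isFirst e d)) τ).out ∘ₗ core h φ ψ ∘ₗ
        permAct (V.sum W) (QuotientGroup.mk (s := young (isFirst e d)) τ).out⁻¹
      = permAct (V'.sum W') τ ∘ₗ core h φ ψ ∘ₗ permAct (V.sum W) τ⁻¹ := by
    intro τ
    obtain ⟨η, hη⟩ := QuotientGroup.mk_out_eq_mul (young (isFirst e d)) τ
    rw [hη, mul_inv_rev, permAct_mul, permAct_mul, LinearMap.comp_assoc,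
      ← LinearMap.comp_assoc _ (core h φ ψ), core_permAct h hφ hψ η.2, LinearMap.comp_assoc,
      ← LinearMap.comp_assoc _ _ (permAct (V.sum W) _), permAct_comp_inv, LinearMap.id_comp]
  rw [star_apply, comp_finsum, finsum_comp]
  refine Fintype.sum_equiv (MulAction.toPerm σ) _ _ fun q => ?_
  have hq : σ • q = QuotientGroup.mk (s := young (isFirst e d)) (σ * q.out) := by
    conv_lhs => rw [← QuotientGroup.out_eq' q]
    rfl
  rw [MulAction.toPerm_apply, hq, key, mul_inv_rev, permAct_mul, permAct_mul,
    LinearMap.comp_assoc, LinearMap.comp_assoc, LinearMap.comp_assoc, LinearMap.comp_assoc,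
    permAct_inv_comp, LinearMap.comp_id]

/-- The direct sum of two linear maps. -/
def sumMap {V V' W W' : SVec k} (f : V.carrier →ₗ[k] V'.carrier) (g : W.carrier →ₗ[k] W'.carrier) :
    (V.sum W).carrier →ₗ[k] (V'.sum W').carrier :=
  f.prodMap g

/-- The tensor product of two linear maps, without signs. -/
def tensorMap {V V' W W' : SVec k} (f : V.carrier →ₗ[k] V'.carrier)
    (g : W.carrier →ₗ[k] W'.carrier) : (V.tensor W).carrier →ₗ[k] (V'.tensor W').carrier :=
  TensorProduct.map f g

theorem opAt_pure {d : ℕ} {V : SVec k} (i : Fin d) (c : V.carrier →ₗ[k] V.carrier)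
    {ε : Fin d → ZMod 2} {v : Fin d → V.carrier} (h : ∀ j, v j ∈ V.part (ε j)) :
    opAt i c (pure v) = sg k (∑ j, if i < j then ε j else 0) •
      pure (Function.update v i (c (v i))) := by
  have key : ∀ s : Finset (Fin d), ∏ j ∈ s, (if i < j then sg k (ε j) else 1)
      = sg k (∑ j ∈ s, if i < j then ε j else 0) := by
    classical
    intro s
    induction s using Finset.induction_on with
    | empty => simp [sg_zero]
    | insert b s hb ih =>
      rw [Finset.prod_insert hb, Finset.sum_insert hb, sg_add, ih]
      congr 1
      split_ifs <;> simp [sg_zero]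
  rw [opAt, powMap_pure, ← key, ← pure_smul]
  congr 1
  funext j
  rcases lt_trichotomy j i with hj | hj | hj
  · rw [if_pos hj, if_neg hj.not_gt, Function.update_of_ne hj.ne, one_smul]; rfl
  · subst hj
    simp
  · rw [if_neg hj.not_gt, if_neg hj.ne', if_pos hj, Function.update_of_ne hj.ne']
    exact (V.mem_part _ _).mp (h j)

theorem odd_mem {V : SVec k} {c : V.carrier →ₗ[k] V.carrier} (hc : HasParity 1 c) {p : ZMod 2}
    {v : V.carrier} (h : v ∈ V.part p) : c v ∈ V.part (p + 1) := by
  rw [SVec.mem_part] at h ⊢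
  rw [hc, h, map_smul, sg_add, smul_smul, mul_comm]

theorem koszul_update {d : ℕ} (ε : Fin d → ZMod 2) (i : Fin d) (σ : Equiv.Perm (Fin d)) :
    sg k (∑ j, if i < j then ε j else 0) * koszul k (Function.update ε i (ε i + 1)) σ
      = koszul k ε σ * sg k (∑ j, if σ i < σ j then ε j else 0) := by
  have two : ∀ x : ZMod 2, x + x = 0 := CharTwo.add_self_eq_zero
  have e1 : (∑ p : Fin d × Fin d, if p.1 < p.2 ∧ σ p.2 < σ p.1 then
      Function.update ε i (ε i + 1) p.1 * Function.update ε i (ε i + 1) p.2 else 0)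
      = (∑ p : Fin d × Fin d, if p.1 < p.2 ∧ σ p.2 < σ p.1 then ε p.1 * ε p.2 else 0)
        + ((∑ p : Fin d × Fin d, if p.1 = i then
            (if i < p.2 ∧ σ p.2 < σ i then ε p.2 else 0) else 0)
        + ∑ p : Fin d × Fin d, if p.2 = i then
            (if p.1 < i ∧ σ i < σ p.1 then ε p.1 else 0) else 0) := by
    rw [← Finset.sum_add_distrib, ← Finset.sum_add_distrib]
    refine Finset.sum_congr rfl fun p _ => ?_
    obtain ⟨s, t⟩ := p
    by_cases hs : s = i
    · subst hs
      by_cases ht : t = s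
      · subst ht; simp
      · simp only [Function.update_self, Function.update_of_ne ht, ht, if_true, if_false, add_zero]
        split_ifs <;> ring
    · by_cases ht : t = i
      · subst ht
        simp only [Function.update_self, Function.update_of_ne hs, hs, if_true, if_false, zero_add]
        split_ifs <;> ring
      · simp [hs, ht]
  rw [koszul_eq, koszul_eq, ← sg_add, ← sg_add, e1]
  congr 1
  rw [add_left_comm]
  congr 1
  rw [Fintype.sum_prod_type, Fintype.sum_prod_type_right]
  simp only [Finset.sum_ite_irrel, Finset.sum_const_zero, Finset.sum_ite_eq', Finset.mem_univ,
    if_true]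
  rw [← Finset.sum_add_distrib, ← Finset.sum_add_distrib]
  refine Finset.sum_congr rfl fun j _ => ?_
  by_cases hj : j = i
  · subst hj; simp
  have hσ : σ j ≠ σ i := fun h => hj (σ.injective h)
  rcases lt_or_gt_of_ne hj with a | a <;> rcases lt_or_gt_of_ne hσ with b | b <;>
    simp [a, b, a.not_gt, b.not_gt, two]

theorem permAct_opAt [NeZero (2 : k)] {d : ℕ} {V : SVec k} (σ : Equiv.Perm (Fin d))
    (i : Fin d) {c : V.carrier →ₗ[k] V.carrier} (hc : HasParity 1 c) :
    permAct V σ ∘ₗ opAt i c = opAt (σ i) c ∘ₗ permAct V σ := by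
  refine pow_ext_hom fun ε v h => ?_
  have h' : ∀ j, Function.update v i (c (v i)) j ∈ V.part (Function.update ε i (ε i + 1) j) := by
    intro j
    by_cases hj : j = i
    · subst hj; simpa using odd_mem hc (h j)
    · simpa [Function.update_of_ne hj] using h j
  rw [LinearMap.comp_apply, LinearMap.comp_apply, opAt_pure i c h, map_smul, permAct_pure σ h',
    permAct_pure σ h, map_smul, opAt_pure (ε := fun j => ε (σ⁻¹ j)) _ _ fun j => h _, smul_smul,
    smul_smul, koszul_update]
  congr 1
  · congr 2
    refine Eq.trans ?_ (Equiv.sum_comp σ _)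
    simp
  · congr 1
    funext j
    by_cases hj : j = σ i
    · subst hj; simp
    · have : σ⁻¹ j ≠ i := fun h => hj (by rw [← h]; simp)
      rw [Function.update_of_ne hj, Function.update_of_ne this]

theorem join_opAt_inl {e f d : ℕ} (h : e + f = d) {V : SVec k} (i : Fin e)
    (c : V.carrier →ₗ[k] V.carrier) :
    opAt (places h (.inl i)) c ∘ₗ (join h V).toLinearMap
      = (join h V).toLinearMap ∘ₗ tensorMap (opAt i c) (V.pow f).γ := by
  refine TensorProduct.ext (pow_ext fun x => pow_ext fun y => ?_)
  change opAt (places h (.inl i)) c (join h V (tmul (pure x) (pure y)))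
    = join h V (tmul (opAt i c (pure x)) ((V.pow f).γ (pure y)))
  rw [join_pure, opAt, powMap_pure, opAt, powMap_pure, pow_γ_pure, join_pure]
  congr 1
  funext j
  obtain ⟨j, rfl⟩ := (places h).surjective j
  simp only [Equiv.symm_apply_apply, places_lt, (places h).injective.eq_iff]
  rcases j with j | j
  · simp only [Sum.elim_inl, Sum.Lex.inl_lt_inl_iff, Sum.inl.injEq]
  · have : ¬ (toLex (Sum.inr j : Fin e ⊕ Fin f) < toLex (Sum.inl i)) := Sum.Lex.not_inr_lt_inl
    simp

theorem join_opAt_inr {e f d : ℕ} (h : e + f = d) {V : SVec k} (i : Fin f)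
    (c : V.carrier →ₗ[k] V.carrier) :
    opAt (places h (.inr i)) c ∘ₗ (join h V).toLinearMap
      = (join h V).toLinearMap ∘ₗ tensorMap LinearMap.id (opAt i c) := by
  refine TensorProduct.ext (pow_ext fun x => pow_ext fun y => ?_)
  change opAt (places h (.inr i)) c (join h V (tmul (pure x) (pure y)))
    = join h V (tmul (pure x) (opAt i c (pure y)))
  rw [join_pure, opAt, powMap_pure, opAt, powMap_pure, join_pure]
  congr 1
  funext j
  obtain ⟨j, rfl⟩ := (places h).surjective j
  simp only [Equiv.symm_apply_apply, places_lt, (places h).injective.eq_iff]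
  rcases j with j | j
  · have : (toLex (Sum.inl j : Fin e ⊕ Fin f) < toLex (Sum.inr i)) := Sum.Lex.inl_lt_inr _ _
    simp
  · simp only [Sum.elim_inr, Sum.Lex.inr_lt_inr_iff, Sum.inr.injEq]

theorem powMap_comp {d : ℕ} {U V W : SVec k} (g : Fin d → V.carrier →ₗ[k] W.carrier)
    (f : Fin d → U.carrier →ₗ[k] V.carrier) :
    powMap g ∘ₗ powMap f = powMap fun i => g i ∘ₗ f i :=
  pow_ext fun v => by rw [LinearMap.comp_apply, powMap_pure, powMap_pure, powMap_pure]; rfl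

theorem extL_opAt {e : ℕ} {V V' W W' : SVec k}
    {φ : (V.pow e).carrier →ₗ[k] (V'.pow e).carrier} (i : Fin e)
    (c : V.carrier →ₗ[k] V.carrier) (c' : V'.carrier →ₗ[k] V'.carrier)
    (b : W.carrier →ₗ[k] W.carrier) (b' : W'.carrier →ₗ[k] W'.carrier)
    (hφ : opAt i c' ∘ₗ φ = φ ∘ₗ opAt i c) :
    opAt i (sumMap c' b') ∘ₗ extL W W' φ
      = extL W W' φ ∘ₗ opAt i (sumMap c b) := by
  have h1 : opAt i (sumMap c' b') ∘ₗ (powMap fun _ => inl V' W')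
      = (powMap fun _ => inl V' W') ∘ₗ opAt i c' := by
    refine (powMap_comp _ _).trans (Eq.trans ?_ (powMap_comp _ _).symm)
    congr 1
    funext j
    split_ifs
    · rfl
    · exact LinearMap.ext fun v => Prod.ext rfl (map_zero b')
    · exact LinearMap.ext fun v => Prod.ext rfl (map_zero W'.γ)
  have h2 : opAt i c ∘ₗ (powMap fun _ => fst V W)
      = (powMap fun _ => fst V W) ∘ₗ opAt i (sumMap c b) := by
    refine (powMap_comp _ _).trans (Eq.trans ?_ (powMap_comp _ _).symm)
    congr 1
    funext j
    split_ifs <;> rfl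
  change opAt i (sumMap c' b') ∘ₗ ((powMap fun _ => inl V' W') ∘ₗ φ ∘ₗ
      (powMap fun _ => fst V W))
    = ((powMap fun _ => inl V' W') ∘ₗ φ ∘ₗ (powMap fun _ => fst V W)) ∘ₗ
      opAt i (sumMap c b)
  rw [LinearMap.comp_assoc, LinearMap.comp_assoc, ← h2, ← LinearMap.comp_assoc, h1,
    LinearMap.comp_assoc, ← LinearMap.comp_assoc _ φ, hφ, LinearMap.comp_assoc]

theorem extR_opAt {f : ℕ} {V V' W W' : SVec k}
    {φ : (W.pow f).carrier →ₗ[k] (W'.pow f).carrier} (i : Fin f)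
    (c : V.carrier →ₗ[k] V.carrier) (c' : V'.carrier →ₗ[k] V'.carrier)
    (b : W.carrier →ₗ[k] W.carrier) (b' : W'.carrier →ₗ[k] W'.carrier)
    (hφ : opAt i b' ∘ₗ φ = φ ∘ₗ opAt i b) :
    opAt i (sumMap c' b') ∘ₗ extR V V' φ
      = extR V V' φ ∘ₗ opAt i (sumMap c b) := by
  have h1 : opAt i (sumMap c' b') ∘ₗ (powMap fun _ => inr V' W')
      = (powMap fun _ => inr V' W') ∘ₗ opAt i b' := by
    refine (powMap_comp _ _).trans (Eq.trans ?_ (powMap_comp _ _).symm)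
    congr 1
    funext j
    split_ifs
    · rfl
    · exact LinearMap.ext fun v => Prod.ext (map_zero c') rfl
    · exact LinearMap.ext fun v => Prod.ext (map_zero V'.γ) rfl
  have h2 : opAt i b ∘ₗ (powMap fun _ => snd V W)
      = (powMap fun _ => snd V W) ∘ₗ opAt i (sumMap c b) := by
    refine (powMap_comp _ _).trans (Eq.trans ?_ (powMap_comp _ _).symm)
    congr 1
    funext j
    split_ifs <;> rfl
  change opAt i (sumMap c' b') ∘ₗ ((powMap fun _ => inr V' W') ∘ₗ φ ∘ₗ
      (powMap fun _ => snd V W))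
    = ((powMap fun _ => inr V' W') ∘ₗ φ ∘ₗ (powMap fun _ => snd V W)) ∘ₗ
      opAt i (sumMap c b)
  rw [LinearMap.comp_assoc, LinearMap.comp_assoc, ← h2, ← LinearMap.comp_assoc, h1,
    LinearMap.comp_assoc, ← LinearMap.comp_assoc _ φ, hφ, LinearMap.comp_assoc]

theorem opAt_parity {d : ℕ} {V : SVec k} (i : Fin d) {c : V.carrier →ₗ[k] V.carrier}
    (hc : HasParity 1 c) : HasParity (V := V.pow d) (W := V.pow d) 1 (opAt i c) := by
  have : (V.pow d).γ ∘ₗ opAt i c = sg k 1 • (opAt i c ∘ₗ (V.pow d).γ) := by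
    refine pow_ext fun v => ?_
    rw [LinearMap.comp_apply, LinearMap.smul_apply, LinearMap.comp_apply, pow_γ_pure, opAt,
      powMap_pure, powMap_pure, pow_γ_pure]
    have h : sg k 1 = ∏ j : Fin d, if j = i then sg k 1 else 1 := by simp
    rw [h, ← pure_smul]
    congr 1
    funext j
    rcases lt_trichotomy j i with hj | hj | hj
    · simp [hj, hj.ne]
    · subst hj
      simpa using hc _
    · simp [hj.not_gt, hj.ne']
  exact fun v => LinearMap.congr_fun this v

/-- An odd operator that commutes with `G` commutes with `1 ⊗ G` and `F ⊗ G` on the right. -/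
theorem superTensor_right [NeZero (2 : k)] {U U' W W' : SVec k}
    (F : U.carrier →ₗ[k] U'.carrier) {G : W.carrier →ₗ[k] W'.carrier}
    {b : W.carrier →ₗ[k] W.carrier} {b' : W'.carrier →ₗ[k] W'.carrier}
    (hb : HasParity 1 b) (hb' : HasParity 1 b') (h : b' ∘ₗ G = G ∘ₗ b)
    (z : (U.tensor W).carrier) :
    tensorMap LinearMap.id b' (superTensor F G z)
      = superTensor F G (tensorMap LinearMap.id b z) := by
  have : tensorMap LinearMap.id b' ∘ₗ superTensor F G
      = superTensor F G ∘ₗ tensorMap LinearMap.id b := by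
    refine tensor_ext_hom fun p x y hx => ?_
    change tensorMap LinearMap.id b' (superTensor F G (tmul x y))
      = superTensor F G (tmul x (b y))
    rw [superTensor_tmul _ _ hx, superTensor_tmul _ _ hx]
    change tmul (F x) (b' (twist p G y)) = _
    have e : twist p (b' ∘ₗ G) = twist p (G ∘ₗ b) := by rw [h]
    rw [twist_comp, twist_comp, twist_of_parity hb, twist_of_parity hb', LinearMap.smul_comp,
      LinearMap.comp_smul] at e
    have e2 := congrArg (fun g => sg k (1 * p) • g) e
    simp only [smul_smul, sg_mul_self, one_smul] at e2
    exact congrArg (tmul (F x)) (LinearMap.congr_fun e2 y)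
  exact LinearMap.congr_fun this z

theorem superTensor_left [NeZero (2 : k)] {U U' W W' : SVec k}
    {F : U.carrier →ₗ[k] U'.carrier} (G : W.carrier →ₗ[k] W'.carrier)
    {a : U.carrier →ₗ[k] U.carrier} {a' : U'.carrier →ₗ[k] U'.carrier}
    (ha : HasParity 1 a) (h : a' ∘ₗ F = F ∘ₗ a) (z : (U.tensor W).carrier) :
    tensorMap a' W'.γ (superTensor F G z)
      = superTensor F G (tensorMap a W.γ z) := by
  have : tensorMap a' W'.γ ∘ₗ superTensor F G
      = superTensor F G ∘ₗ tensorMap a W.γ := by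
    refine tensor_ext_hom fun p x y hx => ?_
    change tensorMap a' W'.γ (superTensor F G (tmul x y))
      = superTensor F G (tmul (a x) (W.γ y))
    rw [superTensor_tmul _ _ hx, superTensor_tmul _ _ (odd_mem ha hx)]
    change tmul (a' (F x)) (W'.γ (twist p G y)) = _
    have e1 := LinearMap.congr_fun h x
    have e2 := LinearMap.congr_fun (twist_add_γ p G) y
    simp only [LinearMap.comp_apply] at e1 e2
    rw [e1, ← e2]
  exact LinearMap.congr_fun this z

theorem core_opAt [NeZero (2 : k)] {e f d : ℕ} (h : e + f = d) {V V' W W' : SVec k}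
    {φ : (V.pow e).carrier →ₗ[k] (V'.pow e).carrier}
    {ψ : (W.pow f).carrier →ₗ[k] (W'.pow f).carrier}
    {c : V.carrier →ₗ[k] V.carrier} {c' : V'.carrier →ₗ[k] V'.carrier}
    {b : W.carrier →ₗ[k] W.carrier} {b' : W'.carrier →ₗ[k] W'.carrier}
    (hc : HasParity 1 (sumMap c b))
    (hc' : HasParity 1 (sumMap c' b'))
    (hφ : ∀ i, opAt i c' ∘ₗ φ = φ ∘ₗ opAt i c) (hψ : ∀ i, opAt i b' ∘ₗ ψ = ψ ∘ₗ opAt i b)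
    (i : Fin d) :
    opAt i (sumMap c' b') ∘ₗ core h φ ψ
      = core h φ ψ ∘ₗ opAt i (sumMap c b) := by
  have main : ∀ z : (((V.sum W).pow e).tensor ((V.sum W).pow f)).carrier,
      opAt i (sumMap c' b') (join h (V'.sum W')
        (superTensor (extL W W' φ) (extR V V' ψ) z))
      = join h (V'.sum W') (superTensor (extL W W' φ)
        (extR V V' ψ) ((join h (V.sum W)).symm
          (opAt i (sumMap c b) (join h (V.sum W) z)))) := by
    intro z
    obtain ⟨i, rfl⟩ := (places h).surjective i
    rcases i with i | i
    · have h1 := LinearMap.congr_fun (join_opAt_inl h (V := V.sum W) i (sumMap c b)) z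
      have h2 := LinearMap.congr_fun (join_opAt_inl h (V := V'.sum W') i (sumMap c' b'))
        (superTensor (extL W W' φ) (extR V V' ψ) z)
      simp only [LinearMap.comp_apply, LinearEquiv.coe_coe] at h1 h2
      rw [h1, h2, LinearEquiv.symm_apply_apply]
      exact congrArg _ (superTensor_left _ (opAt_parity i hc)
        (extL_opAt i c c' b b' (hφ i)) z)
    · have h1 := LinearMap.congr_fun (join_opAt_inr h (V := V.sum W) i (sumMap c b)) z
      have h2 := LinearMap.congr_fun (join_opAt_inr h (V := V'.sum W') i (sumMap c' b'))
        (superTensor (extL W W' φ) (extR V V' ψ) z)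
      simp only [LinearMap.comp_apply, LinearEquiv.coe_coe] at h1 h2
      rw [h1, h2, LinearEquiv.symm_apply_apply]
      exact congrArg _ (superTensor_right _ (opAt_parity i hc) (opAt_parity i hc')
        (extR_opAt i c c' b b' (hψ i)) z)
  refine LinearMap.ext fun x => ?_
  obtain ⟨y, rfl⟩ := (join h (V.sum W)).surjective x
  have := main y
  rw [core_apply]
  simp only [LinearMap.comp_apply, LinearEquiv.coe_coe, LinearEquiv.symm_apply_apply]
  exact this

theorem star_opAt [NeZero (2 : k)] {e f d : ℕ} (h : e + f = d) {V V' W W' : SVec k}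
    {φ : (V.pow e).carrier →ₗ[k] (V'.pow e).carrier}
    {ψ : (W.pow f).carrier →ₗ[k] (W'.pow f).carrier}
    {c : V.carrier →ₗ[k] V.carrier} {c' : V'.carrier →ₗ[k] V'.carrier}
    {b : W.carrier →ₗ[k] W.carrier} {b' : W'.carrier →ₗ[k] W'.carrier}
    (hc : HasParity 1 (sumMap c b))
    (hc' : HasParity 1 (sumMap c' b'))
    (hφ : ∀ i, opAt i c' ∘ₗ φ = φ ∘ₗ opAt i c) (hψ : ∀ i, opAt i b' ∘ₗ ψ = ψ ∘ₗ opAt i b)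
    (i : Fin d) :
    opAt i (sumMap c' b') ∘ₗ star h φ ψ
      = star h φ ψ ∘ₗ opAt i (sumMap c b) := by
  rw [star_apply, comp_finsum, finsum_comp]
  refine Finset.sum_congr rfl fun q _ => ?_
  have h1 := permAct_opAt q.out (q.out⁻¹ i) hc'
  have h2 := permAct_opAt q.out⁻¹ i hc
  rw [← Equiv.Perm.mul_apply, mul_inv_cancel, Equiv.Perm.one_apply] at h1
  rw [← LinearMap.comp_assoc, ← h1, LinearMap.comp_assoc, LinearMap.comp_assoc, LinearMap.comp_assoc,
    h2, ← LinearMap.comp_assoc _ (core h φ ψ), core_opAt h hc hc' hφ hψ, LinearMap.comp_assoc]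

/-- The morphism `φ ⋆ ψ` of direct sums. -/
def homStar [NeZero (2 : k)] {e f d : ℕ} (h : e + f = d) {V V' W W' : SMod k n} (φ : hom e V V')
    (ψ : hom f W W') : hom d (V.sum W) (V'.sum W') :=
  ⟨star h φ.1 ψ.1, star_permAct h φ.2.1 ψ.2.1, fun i a =>
    star_opAt h (fun v => by rw [sg_one, neg_one_smul]; exact (V.sum W).act_odd a v)
      (fun v => by rw [sg_one, neg_one_smul]; exact (V'.sum W').act_odd a v)
      (fun i => φ.2.2 i a) (fun i => ψ.2.2 i a) i⟩

theorem parity_zero_iff {V W : SVec k} {f : V.carrier →ₗ[k] W.carrier} :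
    HasParity 0 f ↔ ∀ v, W.γ (f v) = f (V.γ v) := by
  simp [HasParity, sg_zero]

theorem inl_even (V W : SVec k) : HasParity 0 (inl V W) :=
  parity_zero_iff.mpr fun _ => Prod.ext rfl (map_zero W.γ)

theorem inr_even (V W : SVec k) : HasParity 0 (inr V W) :=
  parity_zero_iff.mpr fun _ => Prod.ext (map_zero V.γ) rfl

theorem fst_even (V W : SVec k) : HasParity 0 (fst V W) := parity_zero_iff.mpr fun _ => rfl

theorem snd_even (V W : SVec k) : HasParity 0 (snd V W) := parity_zero_iff.mpr fun _ => rfl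

theorem powMap_even {d : ℕ} {V W : SVec k} {f : Fin d → V.carrier →ₗ[k] W.carrier}
    (hf : ∀ i, HasParity 0 (f i)) : HasParity (V := V.pow d) (W := W.pow d) 0 (powMap f) := by
  have : (W.pow d).γ ∘ₗ powMap f = powMap f ∘ₗ (V.pow d).γ := by
    refine pow_ext fun v => ?_
    rw [LinearMap.comp_apply, LinearMap.comp_apply, powMap_pure, pow_γ_pure, pow_γ_pure,
      powMap_pure]
    congr 1
    funext i
    exact parity_zero_iff.mp (hf i) _
  exact parity_zero_iff.mpr fun v => LinearMap.congr_fun this v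

theorem extL_parity {e : ℕ} {V V' : SVec k} (W W' : SVec k) {p : ZMod 2}
    {φ : (V.pow e).carrier →ₗ[k] (V'.pow e).carrier}
    (h : HasParity (V := V.pow e) (W := V'.pow e) p φ) :
    HasParity (V := (V.sum W).pow e) (W := (V'.sum W').pow e) p (extL W W' φ) := by
  have h1 := HasParity.comp (powMap_even fun _ : Fin e => inl_even V' W')
    (HasParity.comp h (powMap_even fun _ : Fin e => fst_even V W))
  rwa [add_zero, zero_add] at h1

theorem extR_parity {f : ℕ} (V V' : SVec k) {W W' : SVec k} {p : ZMod 2}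
    {φ : (W.pow f).carrier →ₗ[k] (W'.pow f).carrier}
    (h : HasParity (V := W.pow f) (W := W'.pow f) p φ) :
    HasParity (V := (V.sum W).pow f) (W := (V'.sum W').pow f) p (extR V V' φ) := by
  have h1 := HasParity.comp (powMap_even fun _ : Fin f => inr_even V' W')
    (HasParity.comp h (powMap_even fun _ : Fin f => snd_even V W))
  rwa [add_zero, zero_add] at h1

theorem join_γ {e f d : ℕ} (h : e + f = d) (V : SVec k) (z : ((V.pow e).tensor (V.pow f)).carrier) :
    (V.pow d).γ (join h V z) = join h V (((V.pow e).tensor (V.pow f)).γ z) := by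
  have : (V.pow d).γ ∘ₗ (join h V).toLinearMap
      = (join h V).toLinearMap ∘ₗ ((V.pow e).tensor (V.pow f)).γ := by
    refine TensorProduct.ext (pow_ext fun x => pow_ext fun y => ?_)
    change (V.pow d).γ (join h V (tmul (pure x) (pure y)))
      = join h V (tmul ((V.pow e).γ (pure x)) ((V.pow f).γ (pure y)))
    rw [join_pure, pow_γ_pure, pow_γ_pure, pow_γ_pure, join_pure]
    congr 1
    funext i
    obtain ⟨j, rfl⟩ := (places h).surjective i
    rw [Equiv.symm_apply_apply]
    rcases j with j | j <;> rfl
  exact LinearMap.congr_fun this z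

theorem core_parity [NeZero (2 : k)] {e f d : ℕ} (h : e + f = d) {V V' W W' : SVec k}
    {p q : ZMod 2} {φ : (V.pow e).carrier →ₗ[k] (V'.pow e).carrier}
    {ψ : (W.pow f).carrier →ₗ[k] (W'.pow f).carrier}
    (hφ : HasParity (V := V.pow e) (W := V'.pow e) p φ)
    (hψ : HasParity (V := W.pow f) (W := W'.pow f) q ψ) :
    HasParity (V := (V.sum W).pow d) (W := (V'.sum W').pow d) (p + q) (core h φ ψ) := by
  intro x
  obtain ⟨y, rfl⟩ := (join h (V.sum W)).surjective x
  rw [core_apply]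
  simp only [LinearMap.comp_apply, LinearEquiv.coe_coe, LinearEquiv.symm_apply_apply, join_γ]
  rw [superTensor_parity (extL_parity W W' hφ) (extR_parity V V' hψ), map_smul]

theorem star_parity [NeZero (2 : k)] {e f d : ℕ} (h : e + f = d) {V V' W W' : SVec k}
    {p q : ZMod 2} {φ : (V.pow e).carrier →ₗ[k] (V'.pow e).carrier}
    {ψ : (W.pow f).carrier →ₗ[k] (W'.pow f).carrier}
    (hφ : HasParity (V := V.pow e) (W := V'.pow e) p φ)
    (hψ : HasParity (V := W.pow f) (W := W'.pow f) q ψ) :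
    HasParity (V := (V.sum W).pow d) (W := (V'.sum W').pow d) (p + q) (star h φ ψ) := by
  intro x
  rw [star_apply, LinearMap.sum_apply, LinearMap.sum_apply, map_sum, Finset.smul_sum]
  refine Finset.sum_congr rfl fun r _ => ?_
  have h1 := HasParity.comp (permAct_even (V'.sum W') r.out)
    (HasParity.comp (core_parity h hφ hψ) (permAct_even (V.sum W) r.out⁻¹))
  rw [add_zero, zero_add] at h1
  exact h1 x

/-- The projection of `(V ⊕ W) ^ ⊗ d` onto the summand that has `V` at the places `i` with
`A i = true` and `W` at the other places. -/
def mask {d : ℕ} (V W : SVec k) (A : Fin d → Bool) :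
    ((V.sum W).pow d).carrier →ₗ[k] ((V.sum W).pow d).carrier :=
  powMap fun i => if A i then inl V W ∘ₗ fst V W else inr V W ∘ₗ snd V W

theorem mask_comp_self {d : ℕ} (V W : SVec k) (A : Fin d → Bool) :
    mask V W A ∘ₗ mask V W A = mask V W A := by
  rw [mask, powMap_comp]
  congr 1
  funext i
  split_ifs <;> rfl

theorem mask_comp_ne {d : ℕ} (V W : SVec k) {A B : Fin d → Bool} (h : A ≠ B) :
    mask V W A ∘ₗ mask V W B = 0 := by
  obtain ⟨i, hi⟩ := Function.ne_iff.mp h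
  rw [mask, mask, powMap_comp]
  refine pow_ext fun v => ?_
  rw [powMap_pure, pure_eq_zero _ i, LinearMap.zero_apply]
  cases hA : A i <;> cases hB : B i
  · exact absurd (hA.trans hB.symm) hi
  · rfl
  · rfl
  · exact absurd (hA.trans hB.symm) hi

theorem permAct_mask [NeZero (2 : k)] {d : ℕ} (V W : SVec k) (A : Fin d → Bool)
    (σ : Equiv.Perm (Fin d)) : permAct (V.sum W) σ ∘ₗ mask V W A
      = mask V W (A ∘ ⇑σ⁻¹) ∘ₗ permAct (V.sum W) σ := by
  refine permAct_powMap σ _ fun i => ?_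
  split_ifs
  · simpa using (inl_even V W).comp (fst_even V W)
  · simpa using (inr_even V W).comp (snd_even V W)

theorem sum_mask {d : ℕ} (V W : SVec k) : ∑ A : Fin d → Bool, mask V W A = LinearMap.id := by
  refine pow_ext fun v => ?_
  have h := (PiTensorProduct.tprod k (s := fun _ : Fin d => (V.sum W).carrier)).map_sum
    (fun i (b : Bool) => (if b then inl V W ∘ₗ fst V W else inr V W ∘ₗ snd V W) (v i))
  have h2 : (fun i => ∑ b : Bool,
      (if b then inl V W ∘ₗ fst V W else inr V W ∘ₗ snd V W) (v i)) = v := by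
    funext i
    rw [Fintype.sum_bool]
    exact Prod.ext (add_zero _) (zero_add _)
  rw [h2] at h
  rw [LinearMap.sum_apply, LinearMap.id_apply]
  refine Eq.trans ?_ h.symm
  refine Finset.sum_congr rfl fun A _ => ?_
  rw [mask, powMap_pure]
  rfl

theorem twist_even {X Y : SVec k} (p : ZMod 2) {c : X.carrier →ₗ[k] Y.carrier}
    (hc : HasParity 0 c) : twist p c = c := by
  rw [twist_of_parity hc, zero_mul, sg_zero, one_smul]

theorem superTensor_tensorMap [NeZero (2 : k)] {T T' U U' W W' : SVec k}
    (F : U.carrier →ₗ[k] U'.carrier) (G : W.carrier →ₗ[k] W'.carrier)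
    {a : T.carrier →ₗ[k] U.carrier} {b : T'.carrier →ₗ[k] W.carrier}
    (ha : HasParity 0 a) (hb : HasParity 0 b) :
    superTensor F G ∘ₗ tensorMap a b = superTensor (F ∘ₗ a) (G ∘ₗ b) := by
  refine tensor_ext_hom fun p x y hx => ?_
  have hax := (hasParity_iff_part 0 a).mp ha p x hx
  rw [zero_add] at hax
  change superTensor F G (tmul (a x) (b y)) = _
  rw [superTensor_tmul _ _ hax, superTensor_tmul _ _ hx, twist_comp, twist_even p hb]
  rfl

theorem tensorMap_superTensor [NeZero (2 : k)] {T T' U U' W W' : SVec k}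
    (F : U.carrier →ₗ[k] U'.carrier) (G : W.carrier →ₗ[k] W'.carrier)
    (a : U'.carrier →ₗ[k] T.carrier) {b : W'.carrier →ₗ[k] T'.carrier} (hb : HasParity 0 b) :
    tensorMap a b ∘ₗ superTensor F G = superTensor (a ∘ₗ F) (b ∘ₗ G) := by
  refine tensor_ext_hom fun p x y hx => ?_
  rw [LinearMap.comp_apply, superTensor_tmul _ _ hx, superTensor_tmul _ _ hx, twist_comp,
    twist_even p hb]
  rfl

theorem join_tensorMap {e f d : ℕ} (h : e + f = d) (V W : SVec k) :
    (join h (V.sum W)).toLinearMap ∘ₗ tensorMap (powMap fun _ => inl V W ∘ₗ fst V W)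
      (powMap fun _ => inr V W ∘ₗ snd V W)
      = mask V W (isFirst e d) ∘ₗ (join h (V.sum W)).toLinearMap := by
  refine TensorProduct.ext (pow_ext fun x => pow_ext fun y => ?_)
  change join h (V.sum W) (tmul (powMap _ (pure x)) (powMap _ (pure y)))
    = mask V W (isFirst e d) (join h (V.sum W) (tmul (pure x) (pure y)))
  rw [powMap_pure, powMap_pure, join_pure, join_pure, mask, powMap_pure]
  congr 1
  funext i
  obtain ⟨j, rfl⟩ := (places h).surjective i
  rw [Equiv.symm_apply_apply]
  rcases j with j | j
  · have : isFirst e d (places h (.inl j)) = true := by simp [isFirst, places_inl]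
    rw [if_pos this]; rfl
  · have : ¬ isFirst e d (places h (.inr j)) = true := by simp [isFirst, places_inr]
    rw [if_neg this]; rfl

theorem extL_mask {e : ℕ} {V V' : SVec k} (W W' : SVec k)
    (φ : (V.pow e).carrier →ₗ[k] (V'.pow e).carrier) :
    extL W W' φ ∘ₗ (powMap fun _ => inl V W ∘ₗ fst V W) = extL W W' φ := by
  have : (powMap fun _ : Fin e => fst V W) ∘ₗ (powMap fun _ => inl V W ∘ₗ fst V W)
      = powMap fun _ => fst V W := powMap_comp _ _
  change ((powMap fun _ => inl V' W') ∘ₗ φ ∘ₗ (powMap fun _ => fst V W)) ∘ₗ _ = _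
  rw [LinearMap.comp_assoc, LinearMap.comp_assoc, this]
  rfl

theorem extR_mask {f : ℕ} (V V' : SVec k) {W W' : SVec k}
    (φ : (W.pow f).carrier →ₗ[k] (W'.pow f).carrier) :
    extR V V' φ ∘ₗ (powMap fun _ => inr V W ∘ₗ snd V W) = extR V V' φ := by
  have : (powMap fun _ : Fin f => snd V W) ∘ₗ (powMap fun _ => inr V W ∘ₗ snd V W)
      = powMap fun _ => snd V W := powMap_comp _ _
  change ((powMap fun _ => inr V' W') ∘ₗ φ ∘ₗ (powMap fun _ => snd V W)) ∘ₗ _ = _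
  rw [LinearMap.comp_assoc, LinearMap.comp_assoc, this]
  rfl

theorem mask_extL {e : ℕ} {V V' : SVec k} (W W' : SVec k)
    (φ : (V.pow e).carrier →ₗ[k] (V'.pow e).carrier) :
    (powMap fun _ => inl V' W' ∘ₗ fst V' W') ∘ₗ extL W W' φ = extL W W' φ := by
  have : (powMap fun _ : Fin e => inl V' W' ∘ₗ fst V' W') ∘ₗ (powMap fun _ => inl V' W')
      = powMap fun _ => inl V' W' := powMap_comp _ _
  change _ ∘ₗ ((powMap fun _ => inl V' W') ∘ₗ φ ∘ₗ (powMap fun _ => fst V W)) = _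
  rw [← LinearMap.comp_assoc, this]
  rfl

theorem mask_extR {f : ℕ} (V V' : SVec k) {W W' : SVec k}
    (φ : (W.pow f).carrier →ₗ[k] (W'.pow f).carrier) :
    (powMap fun _ => inr V' W' ∘ₗ snd V' W') ∘ₗ extR V V' φ = extR V V' φ := by
  have : (powMap fun _ : Fin f => inr V' W' ∘ₗ snd V' W') ∘ₗ (powMap fun _ => inr V' W')
      = powMap fun _ => inr V' W' := powMap_comp _ _
  change _ ∘ₗ ((powMap fun _ => inr V' W') ∘ₗ φ ∘ₗ (powMap fun _ => snd V W)) = _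
  rw [← LinearMap.comp_assoc, this]
  rfl

theorem inl_fst_even {d : ℕ} (V W : SVec k) : HasParity (V := (V.sum W).pow d)
    (W := (V.sum W).pow d) 0 (powMap fun _ => inl V W ∘ₗ fst V W) :=
  powMap_even fun _ => by simpa using (inl_even V W).comp (fst_even V W)

theorem inr_snd_even {d : ℕ} (V W : SVec k) : HasParity (V := (V.sum W).pow d)
    (W := (V.sum W).pow d) 0 (powMap fun _ => inr V W ∘ₗ snd V W) :=
  powMap_even fun _ => by simpa using (inr_even V W).comp (snd_even V W)

theorem core_mask [NeZero (2 : k)] {e f d : ℕ} (h : e + f = d) {V V' W W' : SVec k}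
    (φ : (V.pow e).carrier →ₗ[k] (V'.pow e).carrier)
    (ψ : (W.pow f).carrier →ₗ[k] (W'.pow f).carrier) :
    core h φ ψ ∘ₗ mask V W (isFirst e d) = core h φ ψ := by
  refine LinearMap.ext fun x => ?_
  obtain ⟨y, rfl⟩ := (join h (V.sum W)).surjective x
  have h1 := LinearMap.congr_fun (join_tensorMap h V W) y
  simp only [LinearMap.comp_apply, LinearEquiv.coe_coe] at h1
  rw [LinearMap.comp_apply, ← h1, core_apply]
  simp only [LinearMap.comp_apply, LinearEquiv.coe_coe, LinearEquiv.symm_apply_apply]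
  rw [← LinearMap.comp_apply (superTensor _ _), superTensor_tensorMap _ _ (inl_fst_even V W)
    (inr_snd_even V W), extL_mask, extR_mask]

theorem mask_core [NeZero (2 : k)] {e f d : ℕ} (h : e + f = d) {V V' W W' : SVec k}
    (φ : (V.pow e).carrier →ₗ[k] (V'.pow e).carrier)
    (ψ : (W.pow f).carrier →ₗ[k] (W'.pow f).carrier) :
    mask V' W' (isFirst e d) ∘ₗ core h φ ψ = core h φ ψ := by
  rw [core_apply, ← LinearMap.comp_assoc, ← join_tensorMap, LinearMap.comp_assoc,
    ← LinearMap.comp_assoc _ _ (tensorMap _ _), tensorMap_superTensor _ _ _ (inr_snd_even V' W'),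
    mask_extL, mask_extR]

theorem extL_comp {e : ℕ} {V V' V'' : SVec k} (W W' W'' : SVec k)
    (φ' : (V'.pow e).carrier →ₗ[k] (V''.pow e).carrier)
    (φ : (V.pow e).carrier →ₗ[k] (V'.pow e).carrier) :
    extL W' W'' φ' ∘ₗ extL W W' φ = extL W W'' (φ' ∘ₗ φ) := by
  have : (powMap fun _ : Fin e => fst V' W') ∘ₗ (powMap fun _ => inl V' W') = LinearMap.id :=
    (powMap_comp _ _).trans (pow_ext fun v => powMap_pure _ v)
  change ((powMap fun _ => inl V'' W'') ∘ₗ φ' ∘ₗ (powMap fun _ => fst V' W')) ∘ₗ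
    ((powMap fun _ => inl V' W') ∘ₗ φ ∘ₗ (powMap fun _ => fst V W)) = _
  rw [LinearMap.comp_assoc, LinearMap.comp_assoc, ← LinearMap.comp_assoc (φ ∘ₗ _), this,
    LinearMap.id_comp]
  rfl

theorem extR_comp {f : ℕ} (V V' V'' : SVec k) {W W' W'' : SVec k}
    (φ' : (W'.pow f).carrier →ₗ[k] (W''.pow f).carrier)
    (φ : (W.pow f).carrier →ₗ[k] (W'.pow f).carrier) :
    extR V' V'' φ' ∘ₗ extR V V' φ = extR V V'' (φ' ∘ₗ φ) := by
  have : (powMap fun _ : Fin f => snd V' W') ∘ₗ (powMap fun _ => inr V' W') = LinearMap.id :=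
    (powMap_comp _ _).trans (pow_ext fun v => powMap_pure _ v)
  change ((powMap fun _ => inr V'' W'') ∘ₗ φ' ∘ₗ (powMap fun _ => snd V' W')) ∘ₗ
    ((powMap fun _ => inr V' W') ∘ₗ φ ∘ₗ (powMap fun _ => snd V W)) = _
  rw [LinearMap.comp_assoc, LinearMap.comp_assoc, ← LinearMap.comp_assoc (φ ∘ₗ _), this,
    LinearMap.id_comp]
  rfl

theorem core_comp [NeZero (2 : k)] {e f d : ℕ} (h : e + f = d) {V V' V'' W W' W'' : SVec k}
    {p q : ZMod 2} (φ' : (V'.pow e).carrier →ₗ[k] (V''.pow e).carrier)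
    (ψ' : (W'.pow f).carrier →ₗ[k] (W''.pow f).carrier)
    (φ : (V.pow e).carrier →ₗ[k] (V'.pow e).carrier)
    (ψ : (W.pow f).carrier →ₗ[k] (W'.pow f).carrier)
    (hψ' : HasParity (V := W'.pow f) (W := W''.pow f) q ψ')
    (hφ : HasParity (V := V.pow e) (W := V'.pow e) p φ) :
    core h φ' ψ' ∘ₗ core h φ ψ = sg k (q * p) • core h (φ' ∘ₗ φ) (ψ' ∘ₗ ψ) := by
  refine LinearMap.ext fun x => ?_
  obtain ⟨y, rfl⟩ := (join h (V.sum W)).surjective x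
  have h1 := superTensor_comp (extL W' W'' φ') (extR V' V'' ψ') (extL W W' φ) (extR V V' ψ)
    (extR_parity V' V'' hψ') (extL_parity W W' hφ)
  rw [extL_comp, extR_comp] at h1
  have h2 := congrArg (join h (V''.sum W'')) (LinearMap.congr_fun h1 y)
  rw [core_apply, core_apply, core_apply]
  simp only [LinearMap.comp_apply, LinearEquiv.coe_coe, LinearEquiv.symm_apply_apply,
    LinearMap.smul_apply, map_smul] at h2 ⊢
  exact h2

theorem core_cross [NeZero (2 : k)] {e f e' f' d : ℕ} (h : e + f = d) (h' : e' + f' = d)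
    {V V' V'' W W' W'' : SVec k} (φ' : (V'.pow e').carrier →ₗ[k] (V''.pow e').carrier)
    (ψ' : (W'.pow f').carrier →ₗ[k] (W''.pow f').carrier)
    (φ : (V.pow e).carrier →ₗ[k] (V'.pow e).carrier)
    (ψ : (W.pow f).carrier →ₗ[k] (W'.pow f).carrier) (τ : Equiv.Perm (Fin d))
    (hτ : isFirst e' d ≠ isFirst e d ∘ ⇑τ⁻¹) :
    core h' φ' ψ' ∘ₗ permAct (V'.sum W') τ ∘ₗ core h φ ψ = 0 := by
  rw [← core_mask h', ← mask_core h φ ψ, ← LinearMap.comp_assoc (core h φ ψ), permAct_mask,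
    LinearMap.comp_assoc, LinearMap.comp_assoc, ← LinearMap.comp_assoc _ _ (mask V' W' _),
    mask_comp_ne V' W' hτ, LinearMap.zero_comp, LinearMap.comp_zero]

theorem card_isFirst {e f d : ℕ} (h : e + f = d) :
    Fintype.card {i : Fin d // isFirst e d i = true} = e := by
  have : ∀ i : Fin d, isFirst e d i = true ↔ i.val < e := fun i => by simp [isFirst]
  rw [Fintype.card_congr (Equiv.subtypeEquivRight this), Fintype.card_subtype]
  rw [Fin.card_filter_val_lt]
  omega

theorem isFirst_ne {e f e' f' d : ℕ} (h : e + f = d) (h' : e' + f' = d) (hne : e ≠ e')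
    (τ : Equiv.Perm (Fin d)) : isFirst e' d ≠ isFirst e d ∘ ⇑τ := by
  intro heq
  apply hne
  rw [← card_isFirst h, ← card_isFirst h']
  refine Fintype.card_congr (τ.symm.subtypeEquiv fun i => ?_)
  rw [heq]
  simp

theorem isFirst_inj {e d : ℕ} {σ τ : Equiv.Perm (Fin d)}
    (h : isFirst e d ∘ ⇑σ⁻¹ = isFirst e d ∘ ⇑τ⁻¹) :
    (QuotientGroup.mk σ : Equiv.Perm (Fin d) ⧸ young (isFirst e d)) = QuotientGroup.mk τ := by
  rw [QuotientGroup.eq]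
  intro i
  have := congrFun h (τ i)
  simpa using this

theorem star_comp_zero [NeZero (2 : k)] {e f e' f' d : ℕ} (h : e + f = d) (h' : e' + f' = d)
    (hne : e ≠ e') {V V' V'' W W' W'' : SVec k}
    (φ' : (V'.pow e').carrier →ₗ[k] (V''.pow e').carrier)
    (ψ' : (W'.pow f').carrier →ₗ[k] (W''.pow f').carrier)
    (φ : (V.pow e).carrier →ₗ[k] (V'.pow e).carrier)
    (ψ : (W.pow f).carrier →ₗ[k] (W'.pow f).carrier) :
    star h' φ' ψ' ∘ₗ star h φ ψ = 0 := by
  rw [star_apply, star_apply, finsum_comp]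
  refine Finset.sum_eq_zero fun q' _ => ?_
  rw [comp_finsum]
  refine Finset.sum_eq_zero fun q _ => ?_
  have := core_cross h h' φ' ψ' φ ψ (q'.out⁻¹ * q.out) (isFirst_ne h h' hne _)
  rw [permAct_mul] at this
  refine LinearMap.ext fun x => ?_
  have := LinearMap.congr_fun this (permAct (V.sum W) q.out⁻¹ x)
  simp only [LinearMap.comp_apply, LinearMap.zero_apply] at this ⊢
  rw [this, map_zero]

theorem star_comp [NeZero (2 : k)] {e f d : ℕ} (h : e + f = d) {V V' V'' W W' W'' : SVec k}
    {p q : ZMod 2} (φ' : (V'.pow e).carrier →ₗ[k] (V''.pow e).carrier)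
    (ψ' : (W'.pow f).carrier →ₗ[k] (W''.pow f).carrier)
    (φ : (V.pow e).carrier →ₗ[k] (V'.pow e).carrier)
    (ψ : (W.pow f).carrier →ₗ[k] (W'.pow f).carrier)
    (hψ' : HasParity (V := W'.pow f) (W := W''.pow f) q ψ')
    (hφ : HasParity (V := V.pow e) (W := V'.pow e) p φ) :
    star h φ' ψ' ∘ₗ star h φ ψ = sg k (q * p) • star h (φ' ∘ₗ φ) (ψ' ∘ₗ ψ) := by
  rw [star_apply, star_apply, star_apply, finsum_comp, Finset.smul_sum]
  refine Finset.sum_congr rfl fun r' _ => ?_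
  rw [comp_finsum, Finset.sum_eq_single r']
  · refine LinearMap.ext fun x => ?_
    have h1 := LinearMap.congr_fun (core_comp h φ' ψ' φ ψ hψ' hφ)
      (permAct (V.sum W) r'.out⁻¹ x)
    have h2 := LinearMap.congr_fun (permAct_inv_comp (V'.sum W') r'.out)
      (core h φ ψ (permAct (V.sum W) r'.out⁻¹ x))
    simp only [LinearMap.comp_apply, LinearMap.smul_apply, LinearMap.id_apply] at h1 h2 ⊢
    rw [h2, h1, map_smul]
  · intro r _ hr
    have := core_cross h h φ' ψ' φ ψ (r'.out⁻¹ * r.out) fun heq => hr (by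
      have h1 : isFirst e d ∘ ⇑r'.out⁻¹ = isFirst e d ∘ ⇑r.out⁻¹ := by
        funext i
        have := congrFun heq (r'.out⁻¹ i)
        simpa [mul_inv_rev] using this
      have h2 := isFirst_inj h1
      rwa [QuotientGroup.out_eq', QuotientGroup.out_eq', eq_comm] at h2)
    rw [permAct_mul] at this
    refine LinearMap.ext fun x => ?_
    have := LinearMap.congr_fun this (permAct (V.sum W) r.out⁻¹ x)
    simp only [LinearMap.comp_apply, LinearMap.zero_apply] at this ⊢
    rw [this, map_zero]
  · simp

theorem star_id [NeZero (2 : k)] {e f d : ℕ} (h : e + f = d) (V W : SVec k) :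
    star h (LinearMap.id : (V.pow e).carrier →ₗ[k] _) (LinearMap.id : (W.pow f).carrier →ₗ[k] _)
      = ∑ q : Equiv.Perm (Fin d) ⧸ young (isFirst e d), mask V W (isFirst e d ∘ ⇑q.out⁻¹) := by
  have h1 : extL W W (LinearMap.id : (V.pow e).carrier →ₗ[k] (V.pow e).carrier)
      = powMap fun _ => inl V W ∘ₗ fst V W := powMap_comp _ _
  have h2 : extR V V (LinearMap.id : (W.pow f).carrier →ₗ[k] (W.pow f).carrier)
      = powMap fun _ => inr V W ∘ₗ snd V W := powMap_comp _ _
  have h3 : core h (LinearMap.id : (V.pow e).carrier →ₗ[k] _)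
      (LinearMap.id : (W.pow f).carrier →ₗ[k] _) = mask V W (isFirst e d) := by
    refine LinearMap.ext fun x => ?_
    obtain ⟨y, rfl⟩ := (join h (V.sum W)).surjective x
    have h4 := LinearMap.congr_fun (join_tensorMap h V W) y
    have h5 := LinearMap.congr_fun (superTensor_tensorMap LinearMap.id LinearMap.id
      (inl_fst_even (d := e) V W) (inr_snd_even (d := f) V W)) y
    rw [superTensor_id] at h5
    rw [core_apply, h1, h2]
    simp only [LinearMap.comp_apply, LinearEquiv.coe_coe, LinearEquiv.symm_apply_apply,
      LinearMap.id_comp] at h4 h5 ⊢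
    rw [← h4, h5]
  rw [star_apply]
  refine Finset.sum_congr rfl fun q _ => ?_
  rw [h3, ← LinearMap.comp_assoc, permAct_mask, LinearMap.comp_assoc, permAct_comp_inv,
    LinearMap.comp_id]

theorem sum_star_id [NeZero (2 : k)] {d : ℕ} (V W : SVec k) :
    ∑ e : Fin (d + 1), star (Nat.add_sub_cancel' (Nat.lt_succ_iff.mp e.2))
      (LinearMap.id : (V.pow e.1).carrier →ₗ[k] _)
      (LinearMap.id : (W.pow (d - e.1)).carrier →ₗ[k] _) = LinearMap.id := by
  rw [← sum_mask, Finset.sum_congr rfl fun e _ => star_id _ V W, Finset.sum_sigma']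
  refine Fintype.sum_bijective (fun x : Σ e : Fin (d + 1), Equiv.Perm (Fin d) ⧸
    young (isFirst e.1 d) => isFirst x.1.1 d ∘ ⇑x.2.out⁻¹) ⟨?_, ?_⟩ _ _ fun _ => rfl
  · rintro ⟨e, q⟩ ⟨e', q'⟩ heq
    simp only at heq
    have he : e = e' := by
      by_contra hne
      refine isFirst_ne (Nat.add_sub_cancel' (Nat.lt_succ_iff.mp e.2))
        (Nat.add_sub_cancel' (Nat.lt_succ_iff.mp e'.2)) (fun h => hne (Fin.ext h))
        (q.out⁻¹ * q'.out) ?_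
      rw [Equiv.Perm.coe_mul, ← Function.comp_assoc, heq, Function.comp_assoc,
        ← Equiv.Perm.coe_mul, inv_mul_cancel]
      rfl
    subst he
    have h2 := isFirst_inj heq
    rw [QuotientGroup.out_eq', QuotientGroup.out_eq'] at h2
    rw [h2]
  · intro A
    have hle : Fintype.card {i // A i = true} ≤ d :=
      (Fintype.card_subtype_le _).trans (Fintype.card_fin d).le
    obtain ⟨e, he⟩ : ∃ e, e = Fintype.card {i // A i = true} := ⟨_, rfl⟩
    rw [← he] at hle
    have hc : Fintype.card {i : Fin d // isFirst e d i = true} = Fintype.card {i // A i = true} := by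
      rw [card_isFirst (Nat.add_sub_cancel' hle), he]
    let σ : Equiv.Perm (Fin d) := (Fintype.equivOfCardEq hc).extendSubtype
    have hσ : ∀ i, A (σ i) = isFirst e d i := by
      intro i
      by_cases hi : isFirst e d i = true
      · rw [hi]; exact Equiv.extendSubtype_mem (Fintype.equivOfCardEq hc) i hi
      · have := Equiv.extendSubtype_not_mem (Fintype.equivOfCardEq hc) i hi
        rw [Bool.not_eq_true] at hi this
        rw [hi]; exact this
    refine ⟨⟨⟨e, Nat.lt_succ_of_le hle⟩, QuotientGroup.mk σ⟩, ?_⟩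
    obtain ⟨η, hη⟩ := QuotientGroup.mk_out_eq_mul (young (isFirst e d)) σ
    change isFirst e d ∘ ⇑(Quotient.out (QuotientGroup.mk (s := young (isFirst e d)) σ))⁻¹ = A
    rw [hη]
    funext i
    obtain ⟨j, rfl⟩ := (σ * η.1).surjective i
    rw [Function.comp_apply, Equiv.Perm.inv_def, Equiv.symm_apply_apply, Equiv.Perm.mul_apply, hσ]
    exact (η.2 j).symm

/-- The morphism `φ ⋆ ψ` is bilinear in `φ` and `ψ`. -/
def homStarₗ [NeZero (2 : k)] {e f d : ℕ} (h : e + f = d) {V V' W W' : SMod k n} :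
    hom e V V' →ₗ[k] hom f W W' →ₗ[k] hom d (V.sum W) (V'.sum W') :=
  LinearMap.mk₂ k (homStar h)
    (fun φ φ' ψ => Subtype.ext (LinearMap.map_add₂ (star h) φ.1 φ'.1 ψ.1))
    (fun c φ ψ => Subtype.ext (LinearMap.map_smul₂ (star h) c φ.1 ψ.1))
    (fun φ ψ ψ' => Subtype.ext (map_add (star h φ.1) ψ.1 ψ'.1))
    (fun c φ ψ => Subtype.ext (map_smul (star h φ.1) c ψ.1))

/-- The bisuperfunctor `T^bi`, `(V, W) ↦ T (V ⊕ W)`, on which `φ ⊗ ψ` acts by `T (φ ⋆ ψ)`. -/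
def PolFunctor.bi [NeZero (2 : k)] {d : ℕ} (T : PolFunctor k n d) : BiFunctor k n d where
  obj V W := T.obj (V.sum W)
  map h := (homStarₗ h).compr₂ T.map
  map_parity h _ _ _ _ p q φ ψ hφ hψ := T.map_parity _ (homStar h φ ψ) (star_parity h hφ hψ)
  map_id V W := by
    change ∑ e : Fin (d + 1), T.map (homStar _ (homId e.1 V) (homId (d - e.1) W)) = _
    rw [← map_sum, ← T.map_id]
    congr 1
    refine Subtype.ext ?_
    rw [AddSubmonoidClass.coe_finsetSum]
    exact sum_star_id V.toSVec W.toSVec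
  map_comp h _ _ _ _ _ _ p q φ' ψ' φ ψ hψ' hφ := by
    change T.map (homStar h φ' ψ') ∘ₗ T.map (homStar h φ ψ)
      = sg k (q * p) • T.map (homStar h (homComp φ' φ) (homComp ψ' ψ))
    rw [← T.map_comp, ← map_smul]
    congr 1
    exact Subtype.ext (star_comp h φ'.1 ψ'.1 φ.1 ψ.1 hψ' hφ)
  map_comp_zero h h' hne _ _ _ _ _ _ φ' ψ' φ ψ := by
    change T.map (homStar h' φ' ψ') ∘ₗ T.map (homStar h φ ψ) = 0
    rw [← T.map_comp, ← map_zero T.map]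
    congr 1
    exact Subtype.ext (star_comp_zero h h' hne φ'.1 ψ'.1 φ.1 ψ.1)

/-- The superspace structure on a subspace that is stable under `γ`. -/
def SVec.sub (U : SVec k) (p : Submodule k U.carrier) (hp : ∀ v ∈ p, U.γ v ∈ p) : SVec k where
  carrier := p
  γ := U.γ.restrict hp
  γ_sq v := Subtype.ext (U.γ_sq v.1)

/-- The superspace structure on the quotient by a subspace that is stable under `γ`. -/
def SVec.quot (U : SVec k) (p : Submodule k U.carrier) (hp : ∀ v ∈ p, U.γ v ∈ p) : SVec k where
  carrier := U.carrier ⧸ p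
  γ := p.mapQ p U.γ hp
  γ_sq v := by
    obtain ⟨v, rfl⟩ := p.mkQ_surjective v
    exact congrArg p.mkQ (U.γ_sq v)

/-- The cells of the skew diagram `λ / μ`.  The cell `(i, j)` lies in row `i` and column `j`. -/
def skew (lam mu : YoungDiagram) : Finset (ℕ × ℕ) := lam.cells \ mu.cells

/-- The number of cells of `λ / μ`. -/
def size (lam mu : YoungDiagram) : ℕ := (skew lam mu).card

/-- The enumeration of a finite set of cells in the order given by a key. -/
def enum (s : Finset (ℕ × ℕ)) (f : ℕ × ℕ ≃ ℕ ×ₗ ℕ) : Fin s.card ≃ {c // c ∈ s} :=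
  ((s.map f.toEmbedding).orderIsoOfFin (s.card_map _)).toEquiv.trans
    (f.subtypeEquiv fun c => by simp).symm

/-- The cells of `λ / μ` row by row, and in each row from left to right. -/
def rowCell (lam mu : YoungDiagram) : Fin (size lam mu) ≃ {c // c ∈ skew lam mu} :=
  enum (skew lam mu) toLex

/-- The cells of `λ / μ` column by column, and in each column from top to bottom. -/
def colCell (lam mu : YoungDiagram) : Fin (size lam mu) ≃ {c // c ∈ skew lam mu} :=
  enum (skew lam mu) ((Equiv.prodComm ℕ ℕ).trans toLex)

/-- The permutation that takes the place of a cell in the reading by columns to its place in the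
reading by rows. -/
def colToRow (lam mu : YoungDiagram) : Equiv.Perm (Fin (size lam mu)) :=
  (colCell lam mu).trans (rowCell lam mu).symm

/-- The product of the symmetric groups of the rows, for the reading by rows. -/
def rowGroup (lam mu : YoungDiagram) : Subgroup (Equiv.Perm (Fin (size lam mu))) :=
  young fun i => (rowCell lam mu i).1.1

/-- The product of the symmetric groups of the columns, for the reading by columns. -/
def colGroup (lam mu : YoungDiagram) : Subgroup (Equiv.Perm (Fin (size lam mu))) :=
  young fun i => (colCell lam mu i).1.2

/-- The sign of a permutation in `k`. -/
def signIn (k : Type u) [Field k] {d : ℕ} (σ : Equiv.Perm (Fin d)) : k :=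
  ((Equiv.Perm.sign σ : ℤ) : k)

/-- The subspace `Γ_Π^{λ' / μ'} (M)` of `M ^ ⊗ d`, the tensor product over the columns of `λ / μ`
of the spaces `Γ_Π^e (M)` of tensors in `M ^ ⊗ e` on which `𝔖_e` acts by the sign. -/
def gammaPi (lam mu : YoungDiagram) (M : SVec k) : Submodule k (M.pow (size lam mu)).carrier where
  carrier := {t | ∀ σ ∈ colGroup lam mu, permAct M σ t = signIn k σ • t}
  add_mem' h1 h2 σ hσ := by rw [map_add, h1 σ hσ, h2 σ hσ, smul_add]
  zero_mem' σ _ := by rw [map_zero, smul_zero]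
  smul_mem' c t h σ hσ := by rw [map_smul, h σ hσ, smul_comm]

/-- The kernel of the projection of `M ^ ⊗ d` onto its coinvariants under the row group. -/
def symKer (lam mu : YoungDiagram) (M : SVec k) : Submodule k (M.pow (size lam mu)).carrier :=
  Submodule.span k {x | ∃ σ ∈ rowGroup lam mu, ∃ t, x = permAct M σ t - t}

theorem symKer_γ [NeZero (2 : k)] (lam mu : YoungDiagram) (M : SVec k) :
    ∀ v ∈ symKer lam mu M, (M.pow _).γ v ∈ symKer lam mu M := by
  intro v hv
  refine Submodule.span_induction ?_ ?_ ?_ ?_ hv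
  · rintro _ ⟨σ, hσ, t, rfl⟩
    refine Submodule.subset_span ⟨σ, hσ, (M.pow _).γ t, ?_⟩
    rw [map_sub, parity_zero_iff.mp (permAct_even M σ)]
  · rw [map_zero]; exact Submodule.zero_mem _
  · intro x y _ _ hx hy
    rw [map_add]; exact Submodule.add_mem _ hx hy
  · intro c x _ hx
    rw [map_smul]; exact Submodule.smul_mem _ c hx

theorem gammaPi_γ [NeZero (2 : k)] (lam mu : YoungDiagram) (M : SVec k) :
    ∀ v ∈ gammaPi lam mu M, (M.pow _).γ v ∈ gammaPi lam mu M := by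
  intro v hv σ hσ
  rw [← parity_zero_iff.mp (permAct_even M σ), hv σ hσ, map_smul]

/-- `S^{λ / μ} (M)`, the tensor product over the rows of `λ / μ` of the symmetric powers
`S^e (M)`, which are the coinvariants of `𝔖_e` on `M ^ ⊗ e`. -/
def symPow [NeZero (2 : k)] (lam mu : YoungDiagram) (M : SVec k) : SVec k :=
  (M.pow (size lam mu)).quot (symKer lam mu M) (symKer_γ lam mu M)

/-- The composite `M ^ ⊗ d → M ^ ⊗ d → S^{λ / μ} (M)` of the change from the reading by columns to
the reading by rows and the projection.  Its restriction to `Γ_Π^{λ' / μ'} (M)` is the map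
`θ_{λ / μ} : Γ_Π^{λ' / μ'} (M) → S^{λ / μ} (M)`. -/
def theta [NeZero (2 : k)] (lam mu : YoungDiagram) (M : SVec k) :
    (M.pow (size lam mu)).carrier →ₗ[k] (symPow lam mu M).carrier :=
  (symKer lam mu M).mkQ ∘ₗ permAct M (colToRow lam mu)

theorem theta_γ [NeZero (2 : k)] (lam mu : YoungDiagram) (M : SVec k)
    (t : (M.pow (size lam mu)).carrier) :
    (symPow lam mu M).γ (theta lam mu M t) = theta lam mu M ((M.pow _).γ t) := by
  change (symKer lam mu M).mkQ ((M.pow _).γ (permAct M (colToRow lam mu) t)) = _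
  rw [parity_zero_iff.mp (permAct_even M _)]
  rfl

/-- The image of `θ_{λ / μ}`. -/
def schurSub [NeZero (2 : k)] (lam mu : YoungDiagram) (M : SVec k) :
    Submodule k (symPow lam mu M).carrier :=
  (gammaPi lam mu M).map (theta lam mu M)

theorem schurSub_γ [NeZero (2 : k)] (lam mu : YoungDiagram) (M : SVec k) :
    ∀ v ∈ schurSub lam mu M, (symPow lam mu M).γ v ∈ schurSub lam mu M := by
  rintro _ ⟨t, ht, rfl⟩
  exact ⟨_, gammaPi_γ lam mu M t ht, (theta_γ lam mu M t).symm⟩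

/-- The value `Ŝ_{λ / μ} (M)` of the Schur superfunctor, the image of `θ_{λ / μ}`. -/
def schurSpace [NeZero (2 : k)] (lam mu : YoungDiagram) (M : SVec k) : SVec k :=
  (symPow lam mu M).sub (schurSub lam mu M) (schurSub_γ lam mu M)

/-- The action of a morphism on `S^{λ / μ}`. -/
def symMap [NeZero (2 : k)] (lam mu : YoungDiagram) {V W : SMod k 0}
    (φ : hom (size lam mu) V W) :
    (symPow lam mu V.toSVec).carrier →ₗ[k] (symPow lam mu W.toSVec).carrier :=
  (symKer lam mu V.toSVec).mapQ (symKer lam mu W.toSVec) φ.1 <| by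
    refine Submodule.span_le.mpr ?_
    rintro _ ⟨σ, hσ, t, rfl⟩
    refine Submodule.subset_span ⟨σ, hσ, φ.1 t, ?_⟩
    rw [map_sub]
    exact congrArg (fun x => x - φ.1 t) (LinearMap.congr_fun (φ.2.1 σ) t).symm

theorem symMap_theta [NeZero (2 : k)] (lam mu : YoungDiagram) {V W : SMod k 0}
    (φ : hom (size lam mu) V W) (t : (V.pow (size lam mu)).carrier) :
    symMap lam mu φ (theta lam mu V.toSVec t) = theta lam mu W.toSVec (φ.1 t) := by
  change (symKer lam mu W.toSVec).mkQ (φ.1 (permAct V.toSVec (colToRow lam mu) t)) = _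
  exact congrArg (symKer lam mu W.toSVec).mkQ (LinearMap.congr_fun (φ.2.1 _) t).symm

theorem symMap_mem [NeZero (2 : k)] (lam mu : YoungDiagram) {V W : SMod k 0}
    (φ : hom (size lam mu) V W) :
    ∀ x ∈ schurSub lam mu V.toSVec, symMap lam mu φ x ∈ schurSub lam mu W.toSVec := by
  rintro _ ⟨t, ht, rfl⟩
  refine ⟨φ.1 t, fun σ hσ => ?_, (symMap_theta lam mu φ t).symm⟩
  refine (LinearMap.congr_fun (φ.2.1 σ) t).trans ?_
  rw [LinearMap.comp_apply, ht σ hσ, map_smul]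

/-- The Schur superfunctor `Ŝ_{λ / μ}` of type I.  The one of type II is `(schur lam mu).res 1`. -/
def schur [NeZero (2 : k)] (lam mu : YoungDiagram) : PolFunctor k 0 (size lam mu) where
  obj V := schurSpace lam mu V.toSVec
  map :=
    { toFun := fun φ => (symMap lam mu φ).restrict (symMap_mem lam mu φ)
      map_add' := fun φ ψ => by
        ext ⟨x, hx⟩
        obtain ⟨x, rfl⟩ := Submodule.mkQ_surjective _ x
        rfl
      map_smul' := fun c φ => by
        ext ⟨x, hx⟩
        obtain ⟨x, rfl⟩ := Submodule.mkQ_surjective _ x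
        rfl }
  map_parity {V W} p φ h := by
    rintro ⟨_, t, ht, rfl⟩
    refine Subtype.ext ?_
    change (symPow lam mu W.toSVec).γ (symMap lam mu φ (theta lam mu V.toSVec t))
      = sg k p • symMap lam mu φ ((symPow lam mu V.toSVec).γ (theta lam mu V.toSVec t))
    rw [theta_γ, symMap_theta, symMap_theta, theta_γ, ← map_smul]
    exact congrArg _ (h t)
  map_id V := by
    ext ⟨x, hx⟩
    obtain ⟨x, rfl⟩ := Submodule.mkQ_surjective _ x
    rfl
  map_comp ψ φ := by
    ext ⟨x, hx⟩
    obtain ⟨x, rfl⟩ := Submodule.mkQ_surjective _ x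
    rfl

theorem skew_union {lam nu mu : YoungDiagram} (h : mu ≤ nu) (h' : nu ≤ lam) (c : ℕ × ℕ) :
    c ∈ skew lam mu ↔ c ∈ skew nu mu ∨ c ∈ skew lam nu := by
  have h1 := @h c
  have h2 := @h' c
  simp only [skew, Finset.mem_sdiff, YoungDiagram.mem_cells]
  tauto

theorem skew_disjoint (lam nu mu : YoungDiagram) : Disjoint (skew nu mu) (skew lam nu) := by
  rw [Finset.disjoint_left]
  intro c h1 h2
  simp only [skew, Finset.mem_sdiff] at h1 h2
  exact h2.2 h1.1

theorem size_add {lam nu mu : YoungDiagram} (h : mu ≤ nu) (h' : nu ≤ lam) :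
    size nu mu + size lam nu = size lam mu := by
  rw [size, size, size, ← Finset.card_union_of_disjoint (skew_disjoint lam nu mu)]
  congr 1
  ext c
  rw [Finset.mem_union, skew_union h h']

/-- The permutation that takes the places of the reading by columns of `ν / μ`, followed by those
of the reading by columns of `λ / ν`, to the places of the same cells in the reading by columns of
`λ / μ`. -/
def shuffle {lam nu mu : YoungDiagram} (h : mu ≤ nu) (h' : nu ≤ lam) :
    Equiv.Perm (Fin (size lam mu)) :=
  (places (size_add h h')).symm.trans
    ((Equiv.sumCongr (colCell nu mu) (colCell lam nu)).trans
      (((Equiv.Finset.union (skew nu mu) (skew lam nu) (skew_disjoint lam nu mu)).trans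
        (Equiv.subtypeEquivRight fun c => by
          rw [Finset.mem_union, skew_union h h'])).trans (colCell lam mu).symm))
/-- The subgroup of the column group of `λ / μ` of the permutations that preserve the cells of
`ν / μ`, and hence those of `λ / ν`. -/
def splitGroup (lam nu mu : YoungDiagram) : Subgroup (colGroup lam mu) :=
  (young fun i => decide ((colCell lam mu i).1 ∈ nu)).subgroupOf (colGroup lam mu)

instance instFintypeSplit (lam nu mu : YoungDiagram) :
    Fintype (colGroup lam mu ⧸ splitGroup lam nu mu) := Fintype.ofFinite _

/-- The product `x ∗ y` in `Γ_Π^{λ' / μ'} (M ⊕ N)` of `x` in `Γ_Π^{ν' / μ'} (M)` and `y` in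
`Γ_Π^{λ' / ν'} (N)`.  The tensor with the factors of `x` at the cells of `ν / μ` and those of `y`
at the cells of `λ / ν` is summed, with the signs of `𝔖_d`, over the cosets in each column, i.e.
over the shuffles of its cells in `ν / μ` with its cells in `λ / ν`. -/
def ast {lam nu mu : YoungDiagram} (h : mu ≤ nu) (h' : nu ≤ lam) {M N : SVec k}
    (x : (M.pow (size nu mu)).carrier) (y : (N.pow (size lam nu)).carrier) :
    ((M.sum N).pow (size lam mu)).carrier :=
  ∑ q : colGroup lam mu ⧸ splitGroup lam nu mu, signIn k q.out.1 • permAct (M.sum N) q.out.1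
    (permAct (M.sum N) (shuffle h h') (join (size_add h h') (M.sum N)
      (tmul (powMap (fun _ => inl M N) x) (powMap (fun _ => inr M N) y))))

/-- The image of `Γ_Π^{ν' / μ'} (M) ⊗ Γ_Π^{λ' / ν'} (N) → Γ_Π^{λ' / μ'} (M ⊕ N)`. -/
def Kimage {lam nu mu : YoungDiagram} (h : mu ≤ nu) (h' : nu ≤ lam) (M N : SVec k) :
    Submodule k ((M.sum N).pow (size lam mu)).carrier :=
  Submodule.span k {t | ∃ x ∈ gammaPi nu mu M, ∃ y ∈ gammaPi lam nu N, t = ast h h' x y}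

/-- The strict lexicographic order on partitions, as sequences of row lengths. -/
def LexLT (nu xi : YoungDiagram) : Prop :=
  ∃ i, (∀ j < i, nu.rowLen j = xi.rowLen j) ∧ nu.rowLen i < xi.rowLen i

/-- The lexicographic order on partitions. -/
def LexLE (nu xi : YoungDiagram) : Prop := nu = xi ∨ LexLT nu xi

/-- The subspace `K^ξ (M, N)` of `Γ_Π^{λ' / μ'} (M ⊕ N)`. -/
def Kspace (lam mu xi : YoungDiagram) (M N : SVec k) :
    Submodule k ((M.sum N).pow (size lam mu)).carrier :=
  ⨆ (nu : YoungDiagram) (h : mu ≤ nu) (h' : nu ≤ lam) (_ : LexLE nu xi), Kimage h h' M N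

/-- The subspace `L_ξ (M, N) = θ_{λ / μ} (K^ξ (M, N))` of `S^{λ / μ} (M ⊕ N)`. -/
def Lspace [NeZero (2 : k)] (lam mu xi : YoungDiagram) (M N : SVec k) :
    Submodule k (symPow lam mu (M.sum N)).carrier :=
  (Kspace lam mu xi M N).map (theta lam mu (M.sum N))

/-- The inclusion of `Ŝ_{λ / μ} (M)` in `S^{λ / μ} (M)`. -/
def schurIncl [NeZero (2 : k)] (lam mu : YoungDiagram) (M : SVec k) :
    (schurSpace lam mu M).carrier →ₗ[k] (symPow lam mu M).carrier :=
  (schurSub lam mu M).subtype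

/-- A subfunctor of a bisuperfunctor. -/
@[ext] structure SubBi {d : ℕ} (T : BiFunctor k n d) where
  carrier : ∀ V W, Submodule k (T.obj V W).carrier
  γ_mem : ∀ V W, ∀ x ∈ carrier V W, (T.obj V W).γ x ∈ carrier V W
  map_mem : ∀ {e f : ℕ} (h : e + f = d) {V V' W W' : SMod k n} (φ : hom e V V') (ψ : hom f W W'),
    ∀ x ∈ carrier V W, T.map h φ ψ x ∈ carrier V' W'

/-- A subfunctor as a bisuperfunctor. -/
def SubBi.toBi {d : ℕ} {T : BiFunctor k n d} (A : SubBi T) : BiFunctor k n d where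
  obj V W := (T.obj V W).sub (A.carrier V W) (A.γ_mem V W)
  map {e f} h {V V' W W'} := LinearMap.mk₂ k
    (fun φ ψ => ((T.map h φ ψ).restrict (A.map_mem h φ ψ) :
      A.carrier V W →ₗ[k] A.carrier V' W'))
    (fun φ φ' ψ => LinearMap.ext fun x => Subtype.ext <| by
      change T.map h (φ + φ') ψ x.1 = T.map h φ ψ x.1 + T.map h φ' ψ x.1
      rw [LinearMap.map_add₂]; rfl)
    (fun c φ ψ => LinearMap.ext fun x => Subtype.ext <| by
      change T.map h (c • φ) ψ x.1 = c • T.map h φ ψ x.1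
      rw [LinearMap.map_smul₂]; rfl)
    (fun φ ψ ψ' => LinearMap.ext fun x => Subtype.ext <| by
      change T.map h φ (ψ + ψ') x.1 = T.map h φ ψ x.1 + T.map h φ ψ' x.1
      rw [map_add]; rfl)
    (fun c φ ψ => LinearMap.ext fun x => Subtype.ext <| by
      change T.map h φ (c • ψ) x.1 = c • T.map h φ ψ x.1
      rw [map_smul]; rfl)
  map_parity h _ _ _ _ p q φ ψ hφ hψ x := Subtype.ext (T.map_parity h p q φ ψ hφ hψ x.1)
  map_id V W := by
    refine LinearMap.ext fun x => Subtype.ext ?_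
    have := LinearMap.congr_fun (T.map_id V W) x.1
    rw [LinearMap.sum_apply] at this ⊢
    refine Eq.trans ?_ this
    exact AddSubmonoidClass.coe_finsetSum _ _
  map_comp h _ _ _ _ _ _ p q φ' ψ' φ ψ hψ' hφ := LinearMap.ext fun x => Subtype.ext
    (LinearMap.congr_fun (T.map_comp h p q φ' ψ' φ ψ hψ' hφ) x.1)
  map_comp_zero h h' hne _ _ _ _ _ _ φ' ψ' φ ψ := LinearMap.ext fun x => Subtype.ext
    (LinearMap.congr_fun (T.map_comp_zero h h' hne φ' ψ' φ ψ) x.1)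

/-- The quotient of a bisuperfunctor by a subfunctor. -/
def BiFunctor.quot {d : ℕ} (T : BiFunctor k n d) (A : SubBi T) : BiFunctor k n d where
  obj V W := (T.obj V W).quot (A.carrier V W) (A.γ_mem V W)
  map {e f} h {V V' W W'} := LinearMap.mk₂ k
    (fun φ ψ => ((A.carrier V W).mapQ (A.carrier V' W') (T.map h φ ψ) (A.map_mem h φ ψ) :
      (T.obj V W).carrier ⧸ A.carrier V W →ₗ[k] (T.obj V' W').carrier ⧸ A.carrier V' W'))
    (fun φ φ' ψ => (A.carrier V W).linearMap_qext <| LinearMap.ext fun x =>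
      congrArg (A.carrier V' W').mkQ (LinearMap.congr_fun (LinearMap.map_add₂ (T.map h) φ φ' ψ) x))
    (fun c φ ψ => (A.carrier V W).linearMap_qext <| LinearMap.ext fun x =>
      congrArg (A.carrier V' W').mkQ (LinearMap.congr_fun (LinearMap.map_smul₂ (T.map h) c φ ψ) x))
    (fun φ ψ ψ' => (A.carrier V W).linearMap_qext <| LinearMap.ext fun x =>
      congrArg (A.carrier V' W').mkQ (LinearMap.congr_fun (map_add (T.map h φ) ψ ψ') x))
    (fun c φ ψ => (A.carrier V W).linearMap_qext <| LinearMap.ext fun x =>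
      congrArg (A.carrier V' W').mkQ (LinearMap.congr_fun (map_smul (T.map h φ) c ψ) x))
  map_parity h _ _ V' W' p q φ ψ hφ hψ x := by
    obtain ⟨x, rfl⟩ := Submodule.mkQ_surjective _ x
    exact congrArg (A.carrier _ _).mkQ (T.map_parity h p q φ ψ hφ hψ x)
  map_id V W := by
    refine LinearMap.ext fun x => ?_
    rw [LinearMap.sum_apply]
    obtain ⟨x, rfl⟩ := Submodule.mkQ_surjective _ x
    have := congrArg (A.carrier V W).mkQ (LinearMap.congr_fun (T.map_id V W) x)
    rw [LinearMap.sum_apply, map_sum] at this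
    exact this
  map_comp h _ _ _ _ _ _ p q φ' ψ' φ ψ hψ' hφ :=
    Submodule.linearMap_qext _ <| LinearMap.ext fun x =>
      congrArg (A.carrier _ _).mkQ (LinearMap.congr_fun (T.map_comp h p q φ' ψ' φ ψ hψ' hφ) x)
  map_comp_zero h h' hne _ _ _ _ _ _ φ' ψ' φ ψ :=
    Submodule.linearMap_qext _ <| LinearMap.ext fun x =>
      congrArg (A.carrier _ _).mkQ (LinearMap.congr_fun (T.map_comp_zero h h' hne φ' ψ' φ ψ) x)

/-- The sum of a family of subfunctors. -/
def SubBi.iSup {d : ℕ} {T : BiFunctor k n d} {ι : Type*} (A : ι → SubBi T) : SubBi T where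
  carrier V W := ⨆ i, (A i).carrier V W
  γ_mem V W := by
    intro x hx
    refine Submodule.iSup_induction (fun i => (A i).carrier V W)
      (motive := fun x => (T.obj V W).γ x ∈ ⨆ i, (A i).carrier V W) hx
      (fun i x hx => Submodule.mem_iSup_of_mem i ((A i).γ_mem V W x hx)) ?_ fun x y hx hy => ?_
    · rw [map_zero]; exact Submodule.zero_mem _
    · rw [map_add]; exact Submodule.add_mem _ hx hy
  map_mem {e f} h {V V' W W'} φ ψ := by
    intro x hx
    refine Submodule.iSup_induction (fun i => (A i).carrier V W)
      (motive := fun x => T.map h φ ψ x ∈ ⨆ i, (A i).carrier V' W') hx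
      (fun i x hx => Submodule.mem_iSup_of_mem i ((A i).map_mem h φ ψ x hx)) ?_ fun x y hx hy => ?_
    · rw [map_zero]; exact Submodule.zero_mem _
    · rw [map_add]; exact Submodule.add_mem _ hx hy

/-- The intersection of `B` with `A`, as a subfunctor of `A`. -/
def SubBi.within {d : ℕ} {T : BiFunctor k n d} (B A : SubBi T) : SubBi A.toBi where
  carrier V W := (B.carrier V W).comap (A.carrier V W).subtype
  γ_mem V W x hx := B.γ_mem V W x.1 hx
  map_mem h _ _ _ _ φ ψ x hx := B.map_mem h φ ψ x.1 hx

/-- The partitions `ξ` with `μ ⊆ ξ ⊆ λ`. -/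
abbrev Between (lam mu : YoungDiagram) : Type := {xi : YoungDiagram // mu ≤ xi ∧ xi ≤ lam}

instance instFiniteBetween (lam mu : YoungDiagram) : Finite (Between lam mu) := by
  refine Finite.of_injective (β := lam.cells.powerset)
    (fun xi => ⟨xi.1.cells, Finset.mem_powerset.mpr xi.2.2⟩) fun xi nu h => ?_
  exact Subtype.ext (YoungDiagram.ext (congrArg Subtype.val h))

/-- The piece `L_ξ / ∑_{ν ≺ ξ} L_ν` of the associated graded object of a filtration that is
indexed by the partitions between `μ` and `λ` in lexicographic order. -/
def grPiece {lam mu : YoungDiagram} {d : ℕ} {T : BiFunctor k n d}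
    (L : Between lam mu → SubBi T) (xi : Between lam mu) : BiFunctor k n d :=
  (L xi).toBi.quot
    ((SubBi.iSup fun nu : {nu : Between lam mu // LexLT nu.1 xi.1} => L nu.1).within (L xi))

/-- The direct sum of a finite family of bisuperfunctors. -/
def directSum {d : ℕ} {ι : Type} [Finite ι] (T : ι → BiFunctor k n d) : BiFunctor k n d where
  obj V W :=
    { carrier := ∀ i, ((T i).obj V W).carrier
      γ := LinearMap.pi fun i => ((T i).obj V W).γ ∘ₗ LinearMap.proj i
      γ_sq := fun v => funext fun i => ((T i).obj V W).γ_sq (v i) }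
  map {e f} h {V V' W W'} := LinearMap.mk₂ k
    (fun φ ψ => (LinearMap.pi fun i => (T i).map h φ ψ ∘ₗ LinearMap.proj i :
      (∀ i, ((T i).obj V W).carrier) →ₗ[k] ∀ i, ((T i).obj V' W').carrier))
    (fun φ φ' ψ => LinearMap.ext fun x => funext fun i =>
      LinearMap.congr_fun (LinearMap.map_add₂ ((T i).map h) φ φ' ψ) (x i))
    (fun c φ ψ => LinearMap.ext fun x => funext fun i =>
      LinearMap.congr_fun (LinearMap.map_smul₂ ((T i).map h) c φ ψ) (x i))
    (fun φ ψ ψ' => LinearMap.ext fun x => funext fun i =>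
      LinearMap.congr_fun (map_add ((T i).map h φ) ψ ψ') (x i))
    (fun c φ ψ => LinearMap.ext fun x => funext fun i =>
      LinearMap.congr_fun (map_smul ((T i).map h φ) c ψ) (x i))
  map_parity h _ _ _ _ p q φ ψ hφ hψ x := funext fun i =>
    (T i).map_parity h p q φ ψ hφ hψ (x i)
  map_id V W := by
    refine LinearMap.ext fun x => funext fun i => ?_
    have := LinearMap.congr_fun ((T i).map_id V W) (x i)
    rw [LinearMap.sum_apply] at this ⊢
    refine Eq.trans ?_ this
    exact Finset.sum_apply i _ _
  map_comp h _ _ _ _ _ _ p q φ' ψ' φ ψ hψ' hφ := LinearMap.ext fun x => funext fun i =>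
    LinearMap.congr_fun ((T i).map_comp h p q φ' ψ' φ ψ hψ' hφ) (x i)
  map_comp_zero h h' hne _ _ _ _ _ _ φ' ψ' φ ψ := LinearMap.ext fun x => funext fun i =>
    LinearMap.congr_fun ((T i).map_comp_zero h h' hne φ' ψ' φ ψ) (x i)

/-- Even natural isomorphisms of bisuperfunctors. -/
structure BiIso {d : ℕ} (S T : BiFunctor k n d) where
  equiv : ∀ V W, (S.obj V W).carrier ≃ₗ[k] (T.obj V W).carrier
  even : ∀ V W x, (T.obj V W).γ (equiv V W x) = equiv V W ((S.obj V W).γ x)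
  natural : ∀ {e f : ℕ} (h : e + f = d) {V V' W W' : SMod k n} (φ : hom e V V') (ψ : hom f W W')
    (x : (S.obj V W).carrier), equiv V' W' (S.map h φ ψ x) = T.map h φ ψ (equiv V W x)

/-- The bisuperfunctor `Ŝ^II_{ξ / μ} ⊠ Ŝ^II_{λ / ξ}`. -/
def schurBox (k : Type u) [Field k] [NeZero (2 : k)] {lam mu : YoungDiagram}
    (xi : Between lam mu) : BiFunctor k 1 (size lam mu) :=
  ((schur xi.1 mu).res 1).box (size_add xi.2.1 xi.2.2) ((schur lam xi.1).res 1)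
end SuperSchur

end

open SuperSchur

/-! The proof compares two estimates, one from tableaux and one from leading terms, and lets
dimensions decide.

Choose homogeneous bases of `M` and `N` and let the letters of `M` precede those of `N`. A tableau
of shape `λ / μ` increases down the columns (strictly in even letters, weakly in odd ones) and along
the rows (weakly in even letters, strictly in odd ones). The images of the tableaux under `θ` form a
basis of the Schur space. They span by Garnir relations (`HomBasis.exists_garnir`,
`HomBasis.theta_colSum_mem`). They are independent because functionals built from row orbits are
triangular on them (`HomBasis.exists_dual_tab`). The letters of `M` in a tableau, together with `μ`,
fill a partition `ξ`, so the tableau is cut into one of shape `ξ / μ` in the letters of `M` and one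
of shape `λ / ξ` in the letters of `N`. Hence the dimension of `Ŝ_{λ/μ}(M ⊕ N)` is at most the sum
over `ξ` of the products of the dimensions of `Ŝ_{ξ/μ}(M)` and `Ŝ_{λ/ξ}(N)`
(`finrank_schurSub_sum_le`).

In the other direction, for each `ξ` there is a linear map on `S^{λ/μ}(M ⊕ N)`, the leading term at
`ξ`, that takes `θ(x ∗ y)` to `θ x ⊗ θ y` for products at `ξ` and kills all products at `ν ≺ ξ`
(`exists_leading`). It reads off the tensors with factors in `M` exactly at the cells of `ξ / μ`,
summed over a row orbit. It kills lower products for a combinatorial reason: a column permutation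
moves no cells of `ν` into the top rows on balance, a row permutation keeps the number of cells in
each row, and `ξ` has more cells than `ν` in the rows up to the first in which they differ.

So each graded piece of the filtration maps onto `Ŝ_{ξ/μ}(M) ⊗ Ŝ_{λ/ξ}(N)`. As the total dimension
leaves no room for more, these surjections are isomorphisms and the filtration is exhaustive
(`graded_of_finrank_le`).

Naturality holds because `φ ⋆ ψ` takes `x ∗ y` to the product of the images when the bidegrees match
and to zero otherwise. Throughout, the morphisms only need to commute with place permutations.
Therefore the Clifford action never enters, and type II is covered by the same argument.

The field may have positive odd characteristic, so averages over groups are not available. Their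
place is taken by sums over the distinct elements of an orbit, in which the term of interest has
coefficient `1`. That `2` is invertible is used for the grading and to conclude `t = 0` from `t =
-t`. -/

noncomputable section

namespace SuperSchur

section TensorActions

/-! ### Orbit sums under a finite group. -/

section OrbitSum

variable {k : Type*} [Field k] {G X Y : Type*} [Group G] [Finite G] [AddCommGroup X] [Module k X]
  [AddCommGroup Y] [Module k Y]

/-- The sum of the distinct elements of the orbit of `x` under the subgroup `H`. -/
def orbSum (ρ : G →* Module.End k X) (H : Subgroup G) (x : X) : X :=
  -- A sum over the elements of `H` would carry the order of the stabilizer of `x` as a factor,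
  -- which may be zero in `k`.
  ∑ y ∈ (Set.finite_range fun h : H => ρ h.1 x).toFinset, y

theorem orbSum_invariant (ρ : G →* Module.End k X) (H : Subgroup G) (x : X) {h : G} (hh : h ∈ H) :
    ρ h (orbSum ρ H x) = orbSum ρ H x := by
  have hinj : Function.Injective (ρ h) := by
    intro a b hab
    have := congrArg (ρ h⁻¹) hab
    simpa only [← Module.End.mul_apply, ← map_mul, inv_mul_cancel, map_one,
      Module.End.one_apply] using this
  rw [orbSum, map_sum]
  refine Finset.sum_bij (fun y _ => ρ h y) ?_ (fun a _ b _ hab => hinj hab) ?_ fun _ _ => rfl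
  · intro a ha
    simp only [Set.Finite.mem_toFinset, Set.mem_range] at ha ⊢
    obtain ⟨g, rfl⟩ := ha
    exact ⟨⟨h, hh⟩ * g, by simp⟩
  · intro b hb
    simp only [Set.Finite.mem_toFinset, Set.mem_range] at hb ⊢
    obtain ⟨g, rfl⟩ := hb
    refine ⟨ρ h⁻¹ (ρ g.1 x), ⟨⟨h, hh⟩⁻¹ * g, by simp⟩, ?_⟩
    rw [← Module.End.mul_apply, ← map_mul, mul_inv_cancel, map_one, Module.End.one_apply]

theorem orbSum_mem (ρ : G →* Module.End k X) (H : Subgroup G) (x : X) (S : Submodule k X)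
    (hS : ∀ h ∈ H, ρ h x ∈ S) : orbSum ρ H x ∈ S := by
  refine Submodule.sum_mem _ fun y hy => ?_
  simp only [Set.Finite.mem_toFinset, Set.mem_range] at hy
  obtain ⟨g, rfl⟩ := hy
  exact hS _ g.2

/-- A linear map sees only `x` in the orbit sum of `x` if it vanishes on the rest of the orbit. -/
theorem map_orbSum_eq (ρ : G →* Module.End k X) (H : Subgroup G) (x : X) (φ : X →ₗ[k] Y)
    (hφ : ∀ h ∈ H, φ (ρ h x) ≠ 0 → ρ h x = x) : φ (orbSum ρ H x) = φ x := by
  rw [orbSum, map_sum]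
  refine Finset.sum_eq_single x (fun y hy hne => ?_) fun hx => ?_
  · simp only [Set.Finite.mem_toFinset, Set.mem_range] at hy
    obtain ⟨g, rfl⟩ := hy
    by_contra h0
    exact hne (hφ _ g.2 h0)
  · refine absurd ?_ hx
    simp only [Set.Finite.mem_toFinset, Set.mem_range]
    exact ⟨1, by simp⟩

theorem map_orbSum_eq_zero (ρ : G →* Module.End k X) (H : Subgroup G) (x : X) (φ : X →ₗ[k] Y)
    (hφ : ∀ h ∈ H, φ (ρ h x) = 0) : φ (orbSum ρ H x) = 0 :=
  orbSum_mem ρ H x (LinearMap.ker φ) hφ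

end OrbitSum

variable {k : Type u} [Field k]

/-! ### Koszul signs of permutations of factors of one parity. -/

section Koszul

theorem signIn_mul_self {d : ℕ} (σ : Equiv.Perm (Fin d)) : signIn k σ * signIn k σ = 1 := by
  rw [signIn, ← Int.cast_mul, ← Units.val_mul, Int.units_mul_self, Units.val_one, Int.cast_one]

theorem signIn_one {d : ℕ} : signIn k (1 : Equiv.Perm (Fin d)) = 1 := by simp [signIn]

theorem signIn_mul {d : ℕ} (σ τ : Equiv.Perm (Fin d)) :
    signIn k (σ * τ) = signIn k σ * signIn k τ := by simp [signIn]

theorem signIn_swap {d : ℕ} {i j : Fin d} (h : i ≠ j) : signIn k (Equiv.swap i j) = -1 := by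
  simp [signIn, Equiv.Perm.sign_swap h]

/-- Permutations of even factors have trivial Koszul sign. -/
theorem koszul_eq_one {d : ℕ} {ε : Fin d → ZMod 2} {σ : Equiv.Perm (Fin d)}
    (h : ∀ i, σ i ≠ i → ε i = 0) : koszul k ε σ = 1 := by
  refine Finset.prod_eq_one fun p _ => ?_
  split_ifs with hp
  · by_cases h1 : σ p.1 = p.1
    · by_cases h2 : σ p.2 = p.2
      · rw [h1, h2] at hp
        exact absurd hp.1 hp.2.not_gt
      · rw [h _ h2, mul_zero, sg_zero]
    · rw [h _ h1, zero_mul, sg_zero]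
  · rfl

/-- When all factors are odd, every inversion of `σ` contributes `-1`, and the sign of `σ` is the
product of the same factors. -/
theorem koszul_all_odd {d : ℕ} (σ : Equiv.Perm (Fin d)) :
    koszul k (fun _ => 1) σ = signIn k σ := by
  rw [koszul, signIn, Equiv.Perm.sign_eq_prod_prod_Ioi, Units.coe_prod, Int.cast_prod,
    Fintype.prod_prod_type]
  refine Finset.prod_congr rfl fun i _ => ?_
  rw [Units.coe_prod, Int.cast_prod]
  have : Finset.Ioi i = Finset.univ.filter fun j => i < j := by ext; simp
  rw [this, Finset.prod_filter]
  refine Finset.prod_congr rfl fun j _ => ?_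
  by_cases hij : i < j
  · have hne : σ i ≠ σ j := fun h => hij.ne (σ.injective h)
    rcases lt_or_gt_of_ne hne with a | a
    · simp [hij, a, a.not_gt]
    · simp [hij, a, a.not_gt, sg_one]
  · simp [hij]

/-- The Koszul sign of a permutation of odd factors that are of the same kind is its sign. -/
theorem koszul_eq_sign {d : ℕ} {ε : Fin d → ZMod 2} {σ : Equiv.Perm (Fin d)}
    (h : ∀ i, σ i ≠ i → ε i = 1) : koszul k ε σ = signIn k σ := by
  classical
  -- The set `s` contains all even places. The induction makes these odd one at a time, until
  -- `koszul_all_odd` applies.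
  have key : ∀ (s : Finset (Fin d)) (ε : Fin d → ZMod 2), (∀ i, σ i ≠ i → ε i = 1) →
      (∀ i, ε i = 0 → i ∈ s) → koszul k ε σ = signIn k σ := by
    intro s
    induction s using Finset.induction_on with
    | empty =>
      intro ε _ h2
      have : ε = fun _ => 1 := by
        funext i
        rcases zmod2_cases (ε i) with h0 | h0
        · exact absurd (h2 i h0) (by simp)
        · exact h0
      rw [this, koszul_all_odd]
    | insert a s ha ih =>
      intro ε h1 h2
      by_cases hz : ε a = 0
      · have hfix : σ a = a := by
          by_contra hne
          rw [h1 a hne] at hz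
          exact one_ne_zero hz
        have hε : ∀ j, ε (σ j) = ε j := by
          intro j
          by_cases hj : σ j = j
          · rw [hj]
          · rw [h1 j hj, h1 (σ j) fun h' => hj (σ.injective h')]
        -- The even place `a` is fixed by `σ`, and `σ` preserves the parities. So the two outer
        -- signs in `koszul_update` agree and cancel: making `a` odd does not change the Koszul
        -- sign.
        have hu := koszul_update (k := k) ε a σ
        have hs : (∑ j, if σ a < σ j then ε j else 0) = ∑ j, if a < j then ε j else 0 := by
          rw [← Equiv.sum_comp σ fun j => if a < j then ε j else 0]
          simp only [hfix, hε]
        rw [hs, mul_comm] at hu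
        have hne : sg k (∑ j, if a < j then ε j else 0) ≠ 0 :=
          left_ne_zero_of_mul_eq_one (sg_mul_self _)
        rw [← mul_right_cancel₀ hne hu]
        refine ih _ (fun i hi => ?_) fun i hi => ?_
        · by_cases hia : i = a
          · exact absurd (hia ▸ hfix) (hia ▸ hi)
          · rw [Function.update_of_ne hia]; exact h1 i hi
        · by_cases hia : i = a
          · subst hia
            rw [Function.update_self, hz, zero_add] at hi
            exact absurd hi one_ne_zero
          · rw [Function.update_of_ne hia] at hi
            exact (Finset.mem_insert.mp (h2 i hi)).resolve_left hia
      · exact ih ε h1 fun i hi => (Finset.mem_insert.mp (h2 i hi)).resolve_left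
          fun hia => hz (hia ▸ hi)
  exact key Finset.univ ε h fun i _ => Finset.mem_univ i

end Koszul

/-! ### Place permutations in a homogeneous basis. -/

section Actions

variable {d : ℕ}

/-- A homogeneous basis of a superspace. -/
structure HomBasis (M : SVec k) (n : ℕ) where
  basis : Module.Basis (Fin n) k M.carrier
  parity : Fin n → ZMod 2
  mem : ∀ i, basis i ∈ M.part (parity i)

variable {M : SVec k} {n : ℕ} (e : HomBasis M n)

/-- The basis of `M ^ ⊗ d` that consists of the tensors of basis vectors. -/
def HomBasis.word (d : ℕ) : Module.Basis (Fin d → Fin n) k (M.pow d).carrier :=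
  Basis.piTensorProduct fun _ : Fin d => e.basis

theorem HomBasis.word_apply (f : Fin d → Fin n) : e.word d f = pure fun i => e.basis (f i) :=
  Basis.piTensorProduct_apply _ f

theorem HomBasis.coord_word (f g : Fin d → Fin n) :
    (e.word d).coord g (e.word d f) = if f = g then 1 else 0 := by
  rw [Module.Basis.coord_apply, Module.Basis.repr_self, Finsupp.single_apply]

variable [NeZero (2 : k)]

/-- The action of `𝔖_d` on `M ^ ⊗ d`, twisted by the sign. -/
def altHom (M : SVec k) (d : ℕ) : Equiv.Perm (Fin d) →* Module.End k (M.pow d).carrier where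
  toFun σ := signIn k σ • permAct M σ
  map_one' := by rw [signIn_one, one_smul, permAct_one]; rfl
  map_mul' σ τ := by
    rw [signIn_mul, permAct_mul]
    ext x
    simp [mul_smul, smul_comm (signIn k σ)]

theorem altHom_apply (M : SVec k) (σ : Equiv.Perm (Fin d)) (t : (M.pow d).carrier) :
    altHom M d σ t = signIn k σ • permAct M σ t := rfl

/-- The twist by the sign turns alternating tensors into invariants, so that orbit sums for `altHom`
produce elements of `Γ_Π`. -/
theorem mem_gammaPi_iff {lam mu : YoungDiagram} {M : SVec k} {t : (M.pow (size lam mu)).carrier} :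
    t ∈ gammaPi lam mu M ↔ ∀ σ ∈ colGroup lam mu, altHom M _ σ t = t := by
  refine forall₂_congr fun σ _ => ?_
  rw [altHom_apply]
  constructor
  · intro h
    rw [h, smul_smul, signIn_mul_self, one_smul]
  · intro h
    conv_rhs => rw [← h]
    rw [smul_smul, signIn_mul_self, one_smul]

/-- The action of `𝔖_d` on linear maps from `M ^ ⊗ d`. -/
def dualHom (M : SVec k) (d : ℕ) (Y : Type*) [AddCommGroup Y] [Module k Y] :
    Equiv.Perm (Fin d) →* Module.End k ((M.pow d).carrier →ₗ[k] Y) where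
  toFun σ := LinearMap.lcomp k Y (permAct M σ⁻¹)
  map_one' := by
    ext f x
    simp [permAct_one]
  map_mul' σ τ := by
    ext f x
    simp [permAct_mul]

theorem dualHom_apply (M : SVec k) {Y : Type*} [AddCommGroup Y] [Module k Y]
    (σ : Equiv.Perm (Fin d)) (f : (M.pow d).carrier →ₗ[k] Y) (t : (M.pow d).carrier) :
    dualHom M d Y σ f t = f (permAct M σ⁻¹ t) := rfl

theorem HomBasis.permAct_word (σ : Equiv.Perm (Fin d)) (f : Fin d → Fin n) :
    permAct M σ (e.word d f) = koszul k (e.parity ∘ f) σ • e.word d (f ∘ ⇑σ⁻¹) := by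
  rw [e.word_apply, permAct_pure (ε := e.parity ∘ f) σ fun i => e.mem _, e.word_apply]
  rfl

/-- The only word that `σ` takes to a multiple of the word `g` is `g ∘ σ`. -/
theorem HomBasis.coord_permAct (σ : Equiv.Perm (Fin d)) (g : Fin d → Fin n)
    (t : (M.pow d).carrier) : (e.word d).coord g (permAct M σ t)
      = koszul k (e.parity ∘ g ∘ ⇑σ) σ * (e.word d).coord (g ∘ ⇑σ) t := by
  have : (e.word d).coord g ∘ₗ permAct M σ
      = koszul k (e.parity ∘ g ∘ ⇑σ) σ • (e.word d).coord (g ∘ ⇑σ) := by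
    refine (e.word d).ext fun f => ?_
    rw [LinearMap.comp_apply, e.permAct_word, map_smul, LinearMap.smul_apply,
      Module.Basis.coord_apply, Module.Basis.coord_apply, Module.Basis.repr_self,
      Module.Basis.repr_self, Finsupp.single_apply, Finsupp.single_apply]
    have hiff : f ∘ ⇑σ⁻¹ = g ↔ f = g ∘ ⇑σ := by
      constructor
      · rintro rfl; funext i; simp
      · rintro rfl; funext i; simp
    by_cases h : f = g ∘ ⇑σ
    · rw [if_pos (hiff.mpr h), if_pos h, h]
    · rw [if_neg (mt hiff.mp h), if_neg h, smul_zero, smul_zero]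
  exact LinearMap.congr_fun this t

/-- Arguments about which words occur in a tensor need only this form, in which the signs have
disappeared. -/
theorem HomBasis.coord_altHom_ne_zero {σ : Equiv.Perm (Fin d)} {g : Fin d → Fin n}
    {t : (M.pow d).carrier} (h : (e.word d).coord g (altHom M d σ t) ≠ 0) :
    (e.word d).coord (g ∘ ⇑σ) t ≠ 0 := by
  rw [altHom_apply, map_smul, e.coord_permAct] at h
  exact right_ne_zero_of_mul (right_ne_zero_of_mul h)

/-- A permutation of equal odd factors acts on a word by its sign. -/
theorem HomBasis.altHom_word {σ : Equiv.Perm (Fin d)} {f : Fin d → Fin n}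
    (h : f ∘ ⇑σ = f) (hodd : ∀ i, σ i ≠ i → e.parity (f i) = 1) :
    altHom M d σ (e.word d f) = e.word d f := by
  have h' : f ∘ ⇑σ⁻¹ = f := by
    conv_lhs => rw [← h]
    funext i; simp
  rw [altHom_apply, e.permAct_word, h', koszul_eq_sign (ε := e.parity ∘ f) hodd,
    smul_smul, signIn_mul_self, one_smul]

/-- A permutation of equal even factors fixes the coordinate of a word. -/
theorem HomBasis.dualHom_coord {σ : Equiv.Perm (Fin d)} {f : Fin d → Fin n}
    (h : f ∘ ⇑σ⁻¹ = f) (heven : ∀ i, σ⁻¹ i ≠ i → e.parity (f i) = 0) :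
    dualHom M d k σ ((e.word d).coord f) = (e.word d).coord f := by
  ext t
  rw [dualHom_apply, e.coord_permAct, h, koszul_eq_one (ε := e.parity ∘ f) heven, one_mul]

/-- Since `2` is invertible, the even and the odd part are complementary, and bases of the two parts
combine. -/
theorem exists_homBasis (M : SVec k) : ∃ n, Nonempty (HomBasis M n) := by
  let b := ((Module.finBasis k (M.part 0)).prod (Module.finBasis k (M.part 1))).map
    (Submodule.prodEquivOfIsCompl _ _ M.isCompl_part)
  refine ⟨_, ⟨⟨b.reindex finSumFinEquiv,
    Sum.elim (fun _ => 0) (fun _ => 1) ∘ finSumFinEquiv.symm, fun i => ?_⟩⟩⟩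
  obtain ⟨i, rfl⟩ := finSumFinEquiv.surjective i
  rcases i with i | i <;> simp [b, -finSumFinEquiv_apply_left, -finSumFinEquiv_apply_right]

/-- The homogeneous basis of a direct sum. -/
def HomBasis.sum {N : SVec k} {m : ℕ} (e : HomBasis M n) (e' : HomBasis N m) :
    HomBasis (M.sum N) (n + m) where
  -- This puts all letters of `M` before those of `N`. The cutting of tableaux depends on this
  -- order.
  basis := (e.basis.prod e'.basis).reindex finSumFinEquiv
  parity := Sum.elim e.parity e'.parity ∘ finSumFinEquiv.symm
  mem i := by
    have key : ∀ j, (e.basis.prod e'.basis).reindex finSumFinEquiv (finSumFinEquiv j)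
        = Sum.elim (fun j => (e.basis j, 0)) (fun j => (0, e'.basis j)) j := by
      rintro (j | j) <;> rw [Module.Basis.reindex_apply, Equiv.symm_apply_apply] <;> simp
    obtain ⟨i, rfl⟩ := finSumFinEquiv.surjective i
    refine ((M.sum N).mem_part _ _).mpr ?_
    rw [Function.comp_apply, Equiv.symm_apply_apply]
    refine (congrArg _ (key i)).trans (Eq.trans ?_ (congrArg (fun x => _ • x) (key i)).symm)
    rcases i with i | i
    · exact Prod.ext ((M.mem_part _ _).mp (e.mem i)) ((map_zero N.γ).trans (smul_zero _).symm)
    · exact Prod.ext ((map_zero M.γ).trans (smul_zero _).symm) ((N.mem_part _ _).mp (e'.mem i))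

end Actions

end TensorActions

section SortedWords

/-! ### Sorted words and the rearrangement inequality. -/

section Weights

variable {d n : ℕ}

/-- The weight of a word with respect to integer weights of the places. -/
def wt (u : Fin d → ℤ) (f : Fin d → Fin n) : ℤ := ∑ i, (f i : ℤ) * u i

theorem wt_swap (u : Fin d → ℤ) (f : Fin d → Fin n) (a b : Fin d) :
    wt u (f ∘ ⇑(Equiv.swap a b)) = wt u f + ((f b : ℤ) - f a) * (u a - u b) := by
  by_cases hab : a = b
  · subst hab; simp
  rw [← sub_eq_iff_eq_add', wt, wt, ← Finset.sum_sub_distrib, Fintype.sum_eq_add a b hab]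
  · simp only [Function.comp_apply, Equiv.swap_apply_left, Equiv.swap_apply_right]; ring
  · rintro x ⟨h1, h2⟩
    simp [Equiv.swap_apply_of_ne_of_ne h1 h2]

theorem wt_comp_of_invariant {u : Fin d → ℤ} {σ : Equiv.Perm (Fin d)} (h : ∀ i, u (σ i) = u i)
    (f : Fin d → Fin n) : wt u (f ∘ ⇑σ) = wt u f := by
  rw [wt, wt, ← Equiv.sum_comp σ fun i => (f i : ℤ) * u i]
  exact Finset.sum_congr rfl fun i _ => by rw [h]; rfl

/-- The word `f` is weakly increasing along `u` within each colour. -/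
def SortedIn (c : Fin d → ℕ) (u : Fin d → ℤ) (f : Fin d → Fin n) : Prop :=
  ∀ i j, c i = c j → u i < u j → f i ≤ f j

variable {c : Fin d → ℕ} {u : Fin d → ℤ} {f : Fin d → Fin n}

/-- Suppose `g i < f i` and count the letters `≤ g i` in the colour of `i`. For the sorted word `g`
all places up to `i` qualify. For the sorted word `f` only places strictly before `i` can qualify.
So the two counts differ. -/
theorem SortedIn.le_of_card {g : Fin d → Fin n} (hu : ∀ i j, c i = c j → u i = u j → i = j)
    (hf : SortedIn c u f) (hg : SortedIn c u g)
    (h : ∀ a v, (Finset.univ.filter fun j => c j = a ∧ g j ≤ v).card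
      = (Finset.univ.filter fun j => c j = a ∧ f j ≤ v).card) (i : Fin d) : f i ≤ g i := by
  by_contra! hlt
  have h1 : (Finset.univ.filter fun j => c j = c i ∧ u j ≤ u i)
      ⊆ Finset.univ.filter fun j => c j = c i ∧ g j ≤ g i := by
    intro j hj
    simp only [Finset.mem_filter, Finset.mem_univ, true_and] at hj ⊢
    refine ⟨hj.1, ?_⟩
    rcases hj.2.lt_or_eq with h' | h'
    · exact hg j i hj.1 h'
    · rw [hu j i hj.1 h']
  have h2 : (Finset.univ.filter fun j => c j = c i ∧ f j ≤ g i)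
      ⊂ Finset.univ.filter fun j => c j = c i ∧ u j ≤ u i := by
    rw [Finset.ssubset_iff_of_subset]
    · exact ⟨i, by simp, by simp [hlt]⟩
    · intro j hj
      simp only [Finset.mem_filter, Finset.mem_univ, true_and] at hj ⊢
      refine ⟨hj.1, ?_⟩
      by_contra! hlt'
      exact absurd (hf i j hj.1.symm hlt') (hj.2.trans_lt hlt).not_ge
  exact absurd (h (c i) (g i)) ((Finset.card_lt_card h2).trans_le (Finset.card_le_card h1)).ne'

/-- A rearrangement within the colours preserves, for each colour and each `v`, the number of
letters `≤ v`, and a sorted word is determined by these numbers. -/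
theorem SortedIn.unique (hu : ∀ i j, c i = c j → u i = u j → i = j) {σ : Equiv.Perm (Fin d)}
    (hσ : σ ∈ young c) (hf : SortedIn c u f) (hg : SortedIn c u (f ∘ ⇑σ)) : f ∘ ⇑σ = f := by
  have h : ∀ a v, (Finset.univ.filter fun j => c j = a ∧ (f ∘ ⇑σ) j ≤ v).card
      = (Finset.univ.filter fun j => c j = a ∧ f j ≤ v).card := by
    intro a v
    refine Finset.card_equiv σ fun i => ?_
    simp only [Finset.mem_filter, Finset.mem_univ, true_and, Function.comp_apply, hσ i]
  funext i
  exact le_antisymm (hg.le_of_card hu hf (fun a v => (h a v).symm) i) (hf.le_of_card hu hg h i)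

theorem swap_mem_young {κ : Type*} {c : Fin d → κ} {i j : Fin d} (h : c i = c j) :
    Equiv.swap i j ∈ young c := by
  intro m
  by_cases h1 : m = i
  · subst h1; rw [Equiv.swap_apply_left, h]
  · by_cases h2 : m = j
    · subst h2; rw [Equiv.swap_apply_right, h]
    · rw [Equiv.swap_apply_of_ne_of_ne h1 h2]

/-- Exchanging two letters of one colour that are in the wrong order would raise the weight. -/
theorem sortedIn_of_max (f : Fin d → Fin n) {σ : Equiv.Perm (Fin d)} (hσ : σ ∈ young c)
    (h : ∀ τ ∈ young c, wt u (f ∘ ⇑τ) ≤ wt u (f ∘ ⇑σ)) : SortedIn c u (f ∘ ⇑σ) := by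
  intro i j hc hlt
  by_contra! hgt
  have := h (σ * Equiv.swap i j) (mul_mem hσ (swap_mem_young hc))
  rw [Equiv.Perm.coe_mul, ← Function.comp_assoc, wt_swap] at this
  have h1 : ((f ∘ ⇑σ) j : ℤ) < (f ∘ ⇑σ) i := by exact_mod_cast hgt
  nlinarith

theorem exists_max (c : Fin d → ℕ) (u : Fin d → ℤ) (f : Fin d → Fin n) :
    ∃ σ ∈ young c, ∀ τ ∈ young c, wt u (f ∘ ⇑τ) ≤ wt u (f ∘ ⇑σ) := by
  obtain ⟨σ, hσ⟩ := Finite.exists_max fun σ : young c => wt u (f ∘ ⇑σ.1)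
  exact ⟨σ.1, σ.2, fun τ hτ => hσ ⟨τ, hτ⟩⟩

/-- The rearrangement inequality within the colours. -/
theorem SortedIn.wt_comp_le (hu : ∀ i j, c i = c j → u i = u j → i = j) (hf : SortedIn c u f)
    {σ : Equiv.Perm (Fin d)} (hσ : σ ∈ young c) : wt u (f ∘ ⇑σ) ≤ wt u f := by
  obtain ⟨τ, hτ, hmax⟩ := exists_max c u f
  have h := hmax σ hσ
  rwa [hf.unique hu hτ (sortedIn_of_max f hτ hmax)] at h

/-- A rearrangement with the weight of `f` has maximal weight, hence is sorted, hence is `f` by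
uniqueness. -/
theorem SortedIn.eq_of_wt_comp_eq (hu : ∀ i j, c i = c j → u i = u j → i = j)
    (hf : SortedIn c u f) {σ : Equiv.Perm (Fin d)} (hσ : σ ∈ young c)
    (h : wt u (f ∘ ⇑σ) = wt u f) : f ∘ ⇑σ = f :=
  hf.unique hu hσ (sortedIn_of_max f hσ fun τ hτ => by rw [h]; exact hf.wt_comp_le hu hτ)

/-- The weight `v` may have ties within a colour. The weights `K * v + u` with `K ≥ 0` have none and
order each colour as `u` does. The inequality for these passes to `v` when `K` is large. -/
theorem SortedIn.wt_comp_le_of_monotone (hu : ∀ i j, c i = c j → u i = u j → i = j)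
    (hf : SortedIn c u f) {v : Fin d → ℤ} (hv : ∀ i j, c i = c j → u i ≤ u j → v i ≤ v j)
    {σ : Equiv.Perm (Fin d)} (hσ : σ ∈ young c) : wt v (f ∘ ⇑σ) ≤ wt v f := by
  have key : ∀ K : ℤ, 0 ≤ K →
      K * wt v (f ∘ ⇑σ) + wt u (f ∘ ⇑σ) ≤ K * wt v f + wt u f := by
    intro K hK
    have e : ∀ g : Fin d → Fin n, wt (fun i => K * v i + u i) g = K * wt v g + wt u g := by
      intro g
      rw [wt, wt, wt, Finset.mul_sum, ← Finset.sum_add_distrib]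
      exact Finset.sum_congr rfl fun i _ => by ring
    have mono : ∀ i j, c i = c j → u i ≤ u j → K * v i ≤ K * v j :=
      fun i j h1 h2 => mul_le_mul_of_nonneg_left (hv i j h1 h2) hK
    rw [← e, ← e]
    refine SortedIn.wt_comp_le (c := c) ?_ ?_ hσ
    · intro i j hc h
      refine hu i j hc ?_
      rcases le_total (u i) (u j) with h' | h'
      · have := mono i j hc h'; linarith
      · have := mono j i hc.symm h'; linarith
    · intro i j hc h
      refine hf i j hc ?_
      by_contra! h'
      have := mono j i hc.symm h'
      linarith
  by_contra! hlt
  -- The case `K = 0` shows that the constant chosen next is positive. With it, a gap of at least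
  -- `1` between the integer weights for `v` would outweigh the difference for `u`.
  have h0 := key 0 le_rfl
  have := key (wt u f - wt u (f ∘ ⇑σ) + 1) (by linarith)
  nlinarith

end Weights

/-! ### Exchanges of letters between two columns. -/

section Exchange

variable {d n : ℕ}

/-- The permutations that preserve `A`, and the colours of the places outside `A`. -/
def exchange (c : Fin d → ℕ) (A : Finset (Fin d)) : Subgroup (Equiv.Perm (Fin d)) :=
  young fun i => if i ∈ A then none else some (c i)

variable {c : Fin d → ℕ} {A : Finset (Fin d)} {δ : Equiv.Perm (Fin d)}

theorem exchange_mem (h : δ ∈ exchange c A) (i : Fin d) : δ i ∈ A ↔ i ∈ A := by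
  have := h i
  simp only at this
  by_cases h1 : δ i ∈ A <;> by_cases h2 : i ∈ A <;> simp [h1, h2] at this ⊢

theorem exchange_color (h : δ ∈ exchange c A) {i : Fin d} (hi : i ∉ A) : c (δ i) = c i := by
  have := h i
  simpa [hi, (exchange_mem h i).not.mpr hi] using this

/-- Exchanges between two colours of which the first has the larger letters do not decrease the
weight of a word. -/
theorem wt_exchange {f : Fin d → Fin n} {a b : ℕ} (hab : a < b)
    {x : Fin n} (hA : ∀ i ∈ A, (c i = a ∧ x ≤ f i) ∨ (c i = b ∧ f i ≤ x))
    (hδ : δ ∈ exchange c A) :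
    wt (fun i => c i) f ≤ wt (fun i => c i) (f ∘ ⇑δ) ∧
      (wt (fun i => c i) (f ∘ ⇑δ) = wt (fun i => c i) f →
        ∃ h ∈ exchange c A, h ∈ young c ∧ f ∘ ⇑δ = f ∘ ⇑h) := by
  -- The induction is on the number of places whose colour is changed by `δ`. A transposition of `i`
  -- and `j` undoes one crossing in each direction and lowers this number.
  induction hN : (Finset.univ.filter fun i => c (δ i) ≠ c i).card using Nat.strong_induction_on
    generalizing δ with
  | _ N ih =>
  subst hN
  by_cases hcross : ∀ i, c (δ i) = c i
  · have := wt_comp_of_invariant (u := fun i => (c i : ℤ)) (fun i => by rw [hcross]) f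
    exact ⟨this.ge, fun _ => ⟨δ, hδ, hcross, rfl⟩⟩
  have hin : ∀ {i}, c (δ i) ≠ c i → i ∈ A := fun {i} h => by
    by_contra hi; exact h (exchange_color hδ hi)
  have hcol : ∀ {i}, i ∈ A → c i = a ∨ c i = b := fun hi => (hA _ hi).imp And.left And.left
  have hcard : (Finset.univ.filter fun i => c (δ i) = a).card
      = (Finset.univ.filter fun i => c i = a).card :=
    Finset.card_equiv δ fun i => by simp
  -- By counting the places that `δ` sends to colour `a`, there are as many crossings from `a` to
  -- `b` as from `b` to `a`. If there were none, `δ` would preserve all colours.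
  obtain ⟨i, hi1, hi2⟩ : ∃ i, c i = a ∧ c (δ i) = b := by
    by_contra! hno
    have hsub : (Finset.univ.filter fun i => c i = a)
        ⊆ Finset.univ.filter fun i => c (δ i) = a := by
      intro i hi
      simp only [Finset.mem_filter, Finset.mem_univ, true_and] at hi ⊢
      by_contra hne
      have hiA := hin (i := i) (by rw [hi]; exact hne)
      exact (hcol ((exchange_mem hδ i).mpr hiA)).elim hne (hno i hi)
    have heq := Finset.eq_of_subset_of_card_le hsub hcard.le
    refine hcross fun i => ?_
    by_contra hne
    have hiA := hin hne
    have hm := fun P => congrArg (fun s => P ∈ s) heq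
    have := hm i
    simp only [Finset.mem_filter, Finset.mem_univ, true_and, eq_iff_iff] at this
    rcases hcol hiA with h1 | h1
    · exact hne ((this.mp h1).trans h1.symm)
    · rcases hcol ((exchange_mem hδ i).mpr hiA) with h2 | h2
      · exact hne (h2.trans (this.mpr h2).symm)
      · exact hne (h2.trans h1.symm)
  obtain ⟨j, hj1, hj2⟩ : ∃ j, c j = b ∧ c (δ j) = a := by
    by_contra! hno
    have hsub : (Finset.univ.filter fun i => c (δ i) = a)
        ⊆ Finset.univ.filter fun i => c i = a := by
      intro j hj
      simp only [Finset.mem_filter, Finset.mem_univ, true_and] at hj ⊢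
      by_contra hne
      have hjA := hin (i := j) (by rw [hj]; exact fun h => hne h.symm)
      exact (hcol hjA).elim hne fun h => hno j h hj
    have heq := Finset.eq_of_subset_of_card_le hsub hcard.ge
    have hm : i ∈ Finset.univ.filter fun i => c (δ i) = a := by
      rw [heq]; simpa using hi1
    simp only [Finset.mem_filter, Finset.mem_univ, true_and] at hm
    omega
  have hij : i ≠ j := fun h => by subst h; omega
  have hiA := hin (i := i) (by omega)
  have hjA := hin (i := j) (by omega)
  have hδ' : δ * Equiv.swap i j ∈ exchange c A :=
    mul_mem hδ (swap_mem_young (by simp [hiA, hjA]))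
  have hlt : (Finset.univ.filter fun m => c ((δ * Equiv.swap i j) m) ≠ c m).card
      < (Finset.univ.filter fun m => c (δ m) ≠ c m).card := by
    refine Finset.card_lt_card ((Finset.ssubset_iff_of_subset ?_).mpr ⟨i, ?_, ?_⟩)
    · intro m hm
      have hm' : c (δ (Equiv.swap i j m)) ≠ c m := (Finset.mem_filter.mp hm).2
      refine Finset.mem_filter.mpr ⟨Finset.mem_univ _, ?_⟩
      by_cases h1 : m = i
      · subst h1; omega
      · by_cases h2 : m = j
        · subst h2; omega
        · rwa [Equiv.swap_apply_of_ne_of_ne h1 h2] at hm'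
    · exact Finset.mem_filter.mpr ⟨Finset.mem_univ _, by omega⟩
    · intro h
      have : c (δ (Equiv.swap i j i)) ≠ c i := (Finset.mem_filter.mp h).2
      rw [Equiv.swap_apply_left] at this
      omega
  have hw : wt (fun i => (c i : ℤ)) (f ∘ ⇑(δ * Equiv.swap i j)) = _ :=
    wt_swap (fun i => (c i : ℤ)) (f ∘ ⇑δ) i j
  obtain ⟨h1, h2⟩ := ih _ hlt hδ' rfl
  have hxi : f (δ i) ≤ x := by
    rcases hA _ ((exchange_mem hδ i).mpr hiA) with h | h
    · omega
    · exact h.2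
  have hxj : x ≤ f (δ j) := by
    rcases hA _ ((exchange_mem hδ j).mpr hjA) with h | h
    · exact h.2
    · omega
  have hle : ((f ∘ ⇑δ) i : ℤ) ≤ (f ∘ ⇑δ) j := by exact_mod_cast hxi.trans hxj
  have hab' : ((a : ℕ) : ℤ) < b := by exact_mod_cast hab
  simp only [hi1, hj1] at hw
  -- As `f (δ i) ≤ x ≤ f (δ j)` and `c i = a < b = c j`, undoing the crossing changes the weight by
  -- `(f (δ j) - f (δ i)) * (a - b) ≤ 0`. If the weight of `f` is attained, this change must vanish.
  -- Then the two letters are equal, and the word is the same before and after.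
  refine ⟨by nlinarith, fun heq => ?_⟩
  have hval : (f ∘ ⇑δ) i = (f ∘ ⇑δ) j := by
    by_contra hne
    have : ((f ∘ ⇑δ) i : ℤ) < (f ∘ ⇑δ) j :=
      lt_of_le_of_ne hle fun h => hne (Fin.ext (by exact_mod_cast h))
    nlinarith
  have hsame : f ∘ ⇑(δ * Equiv.swap i j) = f ∘ ⇑δ := by
    funext m
    simp only [Function.comp_apply, Equiv.Perm.mul_apply] at hval ⊢
    by_cases h1 : m = i
    · subst h1; rw [Equiv.swap_apply_left, hval]
    · by_cases h2 : m = j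
      · subst h2; rw [Equiv.swap_apply_right, hval]
      · rw [Equiv.swap_apply_of_ne_of_ne h1 h2]
  rw [hsame] at h2
  exact h2 heq

end Exchange

end SortedWords

section Tableaux

variable {k : Type u} [Field k]

/-! ### Rows and columns of a skew diagram, and the row invariance of `θ`. -/

section Places

variable (lam mu : YoungDiagram)

/-- The row of a place of the reading by columns. -/
def rowOf (i : Fin (size lam mu)) : ℕ := (colCell lam mu i).1.1

/-- The column of a place of the reading by columns. -/
def colOf (i : Fin (size lam mu)) : ℕ := (colCell lam mu i).1.2

/-- The row group, for the reading by columns. -/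
def rowPerms : Subgroup (Equiv.Perm (Fin (size lam mu))) := young (rowOf lam mu)

variable {lam mu}

theorem place_ext {i j : Fin (size lam mu)} (h1 : rowOf lam mu i = rowOf lam mu j)
    (h2 : colOf lam mu i = colOf lam mu j) : i = j :=
  (colCell lam mu).injective (Subtype.ext (Prod.ext h1 h2))

theorem rowOf_lt_or {i j : Fin (size lam mu)} (h1 : colOf lam mu i = colOf lam mu j) (h : i ≠ j) :
    rowOf lam mu i < rowOf lam mu j ∨ rowOf lam mu j < rowOf lam mu i :=
  lt_or_gt_of_ne fun h2 => h (place_ext h2 h1)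

theorem colOf_lt_or {i j : Fin (size lam mu)} (h1 : rowOf lam mu i = rowOf lam mu j) (h : i ≠ j) :
    colOf lam mu i < colOf lam mu j ∨ colOf lam mu j < colOf lam mu i :=
  lt_or_gt_of_ne fun h2 => h (place_ext h1 h2)

theorem mem_lam (i : Fin (size lam mu)) : (rowOf lam mu i, colOf lam mu i) ∈ lam :=
  (Finset.mem_sdiff.mp (colCell lam mu i).2).1

theorem notMem_mu (i : Fin (size lam mu)) : (rowOf lam mu i, colOf lam mu i) ∉ mu :=
  (Finset.mem_sdiff.mp (colCell lam mu i).2).2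

theorem exists_place {r c : ℕ} (h : (r, c) ∈ lam) (h' : (r, c) ∉ mu) :
    ∃ i, rowOf lam mu i = r ∧ colOf lam mu i = c := by
  obtain ⟨i, hi⟩ := (colCell lam mu).surjective ⟨(r, c), Finset.mem_sdiff.mpr ⟨h, h'⟩⟩
  exact ⟨i, by rw [rowOf, hi], by rw [colOf, hi]⟩

/-- Conjugation by `colToRow` turns a row permutation of the column reading into one of the row
reading, and the coinvariants do not see the latter. -/
theorem theta_permAct [NeZero (2 : k)] (M : SVec k) {σ : Equiv.Perm (Fin (size lam mu))}
    (hσ : σ ∈ rowPerms lam mu) (t : (M.pow (size lam mu)).carrier) :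
    theta lam mu M (permAct M σ t) = theta lam mu M t := by
  have hmem : colToRow lam mu * σ * (colToRow lam mu)⁻¹ ∈ rowGroup lam mu := by
    have h0 : ∀ j, rowCell lam mu (colToRow lam mu j) = colCell lam mu j := fun j => by
      simp [colToRow]
    intro i
    obtain ⟨j, rfl⟩ := (colToRow lam mu).surjective i
    simp only [Equiv.Perm.mul_apply, Equiv.Perm.inv_def, Equiv.symm_apply_apply]
    rw [h0, h0]
    exact hσ j
  refine (Submodule.Quotient.eq _).mpr (Submodule.subset_span
    ⟨_, hmem, permAct M (colToRow lam mu) t, ?_⟩)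
  rw [← LinearMap.comp_apply, ← LinearMap.comp_apply, ← permAct_mul, ← permAct_mul,
    inv_mul_cancel_right]

/-- A linear map that is invariant under the row group factors through `theta`. -/
theorem exists_theta_factor [NeZero (2 : k)] {M : SVec k} {Y : Type*} [AddCommGroup Y] [Module k Y]
    (F : (M.pow (size lam mu)).carrier →ₗ[k] Y)
    (hF : ∀ σ ∈ rowPerms lam mu, dualHom M _ Y σ F = F) :
    ∃ F' : (symPow lam mu M).carrier →ₗ[k] Y, ∀ t, F' (theta lam mu M t) = F t := by
  refine ⟨(symKer lam mu M).liftQ (F ∘ₗ permAct M (colToRow lam mu)⁻¹) ?_, fun t => ?_⟩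
  · refine Submodule.span_le.mpr ?_
    rintro _ ⟨σ, hσ, t, rfl⟩
    have hmem : ((colToRow lam mu)⁻¹ * σ * colToRow lam mu)⁻¹ ∈ rowPerms lam mu := by
      refine inv_mem fun i => ?_
      have h0 : ∀ j, rowOf lam mu ((colToRow lam mu)⁻¹ j) = (rowCell lam mu j).1.1 := fun j => by
        obtain ⟨j, rfl⟩ := (colToRow lam mu).surjective j
        rw [Equiv.Perm.inv_def, Equiv.symm_apply_apply]
        simp [colToRow, rowOf]
      have := hσ (colToRow lam mu i)
      simp only at this
      rw [← h0, ← h0, Equiv.Perm.inv_def, Equiv.symm_apply_apply] at this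
      exact this
    have h1 := LinearMap.congr_fun (hF _ hmem) (permAct M (colToRow lam mu)⁻¹ t)
    rw [dualHom_apply, inv_inv, ← LinearMap.comp_apply (permAct M _), ← permAct_mul,
      mul_inv_cancel_right, permAct_mul] at h1
    rw [SetLike.mem_coe, LinearMap.mem_ker, map_sub, sub_eq_zero]
    exact h1
  · change F (permAct M (colToRow lam mu)⁻¹ (permAct M (colToRow lam mu) t)) = F t
    rw [← LinearMap.comp_apply (permAct M _), permAct_inv_comp, LinearMap.id_apply]

end Places

/-! ### Superstandard tableaux. -/

section Tableaux

variable {lam mu : YoungDiagram} {n : ℕ}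

/-- The words that, down the columns, are increasing in the even letters and weakly increasing in
the odd letters. -/
def ColStd (lam mu : YoungDiagram) (ε : Fin n → ZMod 2) (f : Fin (size lam mu) → Fin n) : Prop :=
  ∀ i j, colOf lam mu i = colOf lam mu j → rowOf lam mu i < rowOf lam mu j →
    f i < f j ∨ (f i = f j ∧ ε (f i) = 1)

/-- The words that, along the rows, are weakly increasing in the even letters and increasing in
the odd letters. -/
def RowStd (lam mu : YoungDiagram) (ε : Fin n → ZMod 2) (f : Fin (size lam mu) → Fin n) : Prop :=
  ∀ i j, rowOf lam mu i = rowOf lam mu j → colOf lam mu i < colOf lam mu j →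
    f i < f j ∨ (f i = f j ∧ ε (f i) = 0)

/-- The superstandard tableaux of shape `λ / μ`. -/
def Tableau (lam mu : YoungDiagram) (ε : Fin n → ZMod 2) : Type :=
  {f : Fin (size lam mu) → Fin n // ColStd lam mu ε f ∧ RowStd lam mu ε f}

instance instFiniteTableau (ε : Fin n → ZMod 2) : Finite (Tableau lam mu ε) :=
  inferInstanceAs (Finite {_f : Fin (size lam mu) → Fin n // _})

/-- The weight of a place that is given by its row. -/
def rowWt (lam mu : YoungDiagram) (i : Fin (size lam mu)) : ℤ := rowOf lam mu i

/-- The weight of a place that is given by its column. -/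
def colWt (lam mu : YoungDiagram) (i : Fin (size lam mu)) : ℤ := colOf lam mu i

theorem rowWt_inj (i j : Fin (size lam mu)) (h : colOf lam mu i = colOf lam mu j)
    (h' : rowWt lam mu i = rowWt lam mu j) : i = j :=
  place_ext (by simpa [rowWt] using h') h

theorem colWt_inj (i j : Fin (size lam mu)) (h : rowOf lam mu i = rowOf lam mu j)
    (h' : colWt lam mu i = colWt lam mu j) : i = j :=
  place_ext h (by simpa [colWt] using h')

variable {ε : Fin n → ZMod 2} {f : Fin (size lam mu) → Fin n}

theorem ColStd.sorted (h : ColStd lam mu ε f) : SortedIn (colOf lam mu) (rowWt lam mu) f :=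
  fun i j hc hr => (h i j hc (by simpa [rowWt] using hr)).elim le_of_lt fun h => h.1.le

theorem RowStd.sorted (h : RowStd lam mu ε f) : SortedIn (rowOf lam mu) (colWt lam mu) f :=
  fun i j hc hr => (h i j hc (by simpa [colWt] using hr)).elim le_of_lt fun h => h.1.le

theorem ColStd.odd (h : ColStd lam mu ε f) {i j : Fin (size lam mu)}
    (hc : colOf lam mu i = colOf lam mu j) (hij : i ≠ j) (hf : f i = f j) : ε (f i) = 1 := by
  rcases rowOf_lt_or hc hij with hr | hr
  · exact ((h i j hc hr).resolve_left hf.not_lt).2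
  · rw [hf]
    exact ((h j i hc.symm hr).resolve_left hf.symm.not_lt).2

theorem RowStd.even (h : RowStd lam mu ε f) {i j : Fin (size lam mu)}
    (hr : rowOf lam mu i = rowOf lam mu j) (hij : i ≠ j) (hf : f i = f j) : ε (f i) = 0 := by
  rcases colOf_lt_or hr hij with hc | hc
  · exact ((h i j hr hc).resolve_left hf.not_lt).2
  · rw [hf]
    exact ((h j i hr.symm hc).resolve_left hf.symm.not_lt).2

end Tableaux

/-! ### Column sums of words as a basis of `Γ_Π`. -/

section ColumnWords

variable {lam mu : YoungDiagram} {M : SVec k} {n : ℕ} (e : HomBasis M n)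

theorem HomBasis.coord_word_ne_zero {d : ℕ} {f g : Fin d → Fin n}
    (h : (e.word d).coord g (e.word d f) ≠ 0) : g = f := by
  rw [e.coord_word] at h
  by_contra hne
  exact h (if_neg (Ne.symm hne))

variable [NeZero (2 : k)]

/-- The signed sum of the orbit of a word under the column group. -/
def HomBasis.colSum (lam mu : YoungDiagram) (f : Fin (size lam mu) → Fin n) :
    (M.pow (size lam mu)).carrier :=
  orbSum (altHom M (size lam mu)) (colGroup lam mu) (e.word _ f)

theorem HomBasis.colSum_mem (f : Fin (size lam mu) → Fin n) :
    e.colSum lam mu f ∈ gammaPi lam mu M :=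
  mem_gammaPi_iff.mpr fun _ hσ => orbSum_invariant _ _ _ hσ

/-- The words that occur in an orbit sum lie in the orbit. -/
theorem HomBasis.exists_of_coord_orbSum {d : ℕ} {H : Subgroup (Equiv.Perm (Fin d))}
    {t : (M.pow d).carrier} {g : Fin d → Fin n}
    (h : (e.word d).coord g (orbSum (altHom M d) H t) ≠ 0) :
    ∃ σ ∈ H, (e.word d).coord (g ∘ ⇑σ) t ≠ 0 := by
  by_contra! hno
  refine h (map_orbSum_eq_zero _ _ _ _ fun σ hσ => ?_)
  by_contra hne
  exact e.coord_altHom_ne_zero hne (hno σ hσ)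

theorem HomBasis.exists_of_coord_orbSum_word {d : ℕ} {H : Subgroup (Equiv.Perm (Fin d))}
    {f g : Fin d → Fin n}
    (h : (e.word d).coord g (orbSum (altHom M d) H (e.word d f)) ≠ 0) :
    ∃ σ ∈ H, g = f ∘ ⇑σ := by
  obtain ⟨σ, hσ, h⟩ := e.exists_of_coord_orbSum h
  refine ⟨σ⁻¹, inv_mem hσ, ?_⟩
  rw [← e.coord_word_ne_zero h]
  funext i; simp

/-- An element of the orbit that contains the word `f` comes from a permutation of equal odd
letters. Such a permutation fixes the word in the twisted action, so the word is counted once. -/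
theorem HomBasis.coord_orbSum_word {d : ℕ} {H : Subgroup (Equiv.Perm (Fin d))} {f : Fin d → Fin n}
    (hodd : ∀ σ ∈ H, ∀ i, σ i ≠ i → f (σ i) = f i → e.parity (f i) = 1) :
    (e.word d).coord f (orbSum (altHom M d) H (e.word d f)) = 1 := by
  rw [map_orbSum_eq, e.coord_word, if_pos rfl]
  intro σ hσ h
  have hf : f ∘ ⇑σ = f := e.coord_word_ne_zero (e.coord_altHom_ne_zero h)
  exact e.altHom_word hf fun i hi => hodd σ hσ i hi (congrFun hf i)

theorem HomBasis.coord_colSum {f : Fin (size lam mu) → Fin n} (hf : ColStd lam mu e.parity f) :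
    (e.word _).coord f (e.colSum lam mu f) = 1 :=
  e.coord_orbSum_word fun _ hσ i hi h => hf.odd (hσ i).symm (Ne.symm hi) h.symm

/-- Both words are sorted down the columns, and a column orbit contains only one sorted word. -/
theorem HomBasis.eq_of_coord_colSum {f g : Fin (size lam mu) → Fin n}
    (hf : ColStd lam mu e.parity f) (hg : ColStd lam mu e.parity g)
    (h : (e.word _).coord g (e.colSum lam mu f) ≠ 0) : g = f := by
  obtain ⟨σ, hσ, rfl⟩ := e.exists_of_coord_orbSum_word h
  exact hf.sorted.unique rowWt_inj hσ hg.sorted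

/-- For an alternating tensor, a nonzero coordinate at a word gives one at its rearrangement that is
sorted down the columns. If that word is not column standard, it repeats an even letter in a column.
The transposition of the two places then shows that the coordinate equals its negative. -/
theorem HomBasis.eq_zero_of_coord {t : (M.pow (size lam mu)).carrier} (ht : t ∈ gammaPi lam mu M)
    (h : ∀ f, ColStd lam mu e.parity f → (e.word _).coord f t = 0) : t = 0 := by
  rw [mem_gammaPi_iff] at ht
  have move : ∀ σ ∈ colGroup lam mu, ∀ g, (e.word _).coord g t ≠ 0 →
      (e.word _).coord (g ∘ ⇑σ) t ≠ 0 := fun σ hσ g hg =>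
    e.coord_altHom_ne_zero (by rwa [ht σ hσ])
  refine (e.word _).ext_elem fun g => ?_
  rw [map_zero, Finsupp.zero_apply]
  by_contra hg
  obtain ⟨σ, hσ, hmax⟩ := exists_max (colOf lam mu) (rowWt lam mu) g
  have hs := sortedIn_of_max g hσ hmax
  have hσg := move σ hσ g hg
  refine hσg (h _ fun i j hc hr => ?_)
  rcases (hs i j hc (by simpa [rowWt] using hr)).lt_or_eq with hlt | heq
  · exact Or.inl hlt
  refine Or.inr ⟨heq, ?_⟩
  by_contra hpar
  have hij : i ≠ j := fun h => by subst h; exact lt_irrefl _ hr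
  have hpar0 := (zmod2_cases (e.parity ((g ∘ ⇑σ) i))).resolve_right hpar
  have hswap : (g ∘ ⇑σ) ∘ ⇑(Equiv.swap i j) = g ∘ ⇑σ := by
    funext m
    simp only [Function.comp_apply] at heq ⊢
    by_cases h1 : m = i
    · subst h1; rw [Equiv.swap_apply_left, heq]
    · by_cases h2 : m = j
      · subst h2; rw [Equiv.swap_apply_right, heq]
      · rw [Equiv.swap_apply_of_ne_of_ne h1 h2]
  have h1 := congrArg ((e.word _).coord (g ∘ ⇑σ)) (ht _ (swap_mem_young hc))
  rw [altHom_apply, map_smul, e.coord_permAct, hswap, signIn_swap hij,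
    koszul_eq_one (ε := e.parity ∘ g ∘ ⇑σ), one_mul, neg_one_smul] at h1
  · have h2 : (2 : k) * (e.word _).coord (g ∘ ⇑σ) t = 0 := by
      rw [two_mul]
      nth_rewrite 1 [← h1]
      exact neg_add_cancel _
    exact hσg ((mul_eq_zero.mp h2).resolve_left (NeZero.ne _))
  · intro m hm
    rcases eq_or_ne m i with rfl | h1
    · exact hpar0
    · rcases eq_or_ne m j with rfl | h2
      · simp only [Function.comp_apply] at heq hpar0 ⊢
        rw [← heq]; exact hpar0
      · exact absurd (Equiv.swap_apply_of_ne_of_ne h1 h2) hm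

-- The column sum of a column standard word `f` has coordinate `1` at `f` and `0` at all other
-- column standard words. So the difference of the two sides has no coordinates at column standard
-- words and vanishes by `HomBasis.eq_zero_of_coord`.
open Classical in
theorem HomBasis.gammaPi_expand {t : (M.pow (size lam mu)).carrier} (ht : t ∈ gammaPi lam mu M) :
    t = ∑ f : {f // ColStd lam mu e.parity f}, (e.word _).coord f.1 t • e.colSum lam mu f.1 := by
  rw [← sub_eq_zero]
  refine e.eq_zero_of_coord (Submodule.sub_mem _ ht (Submodule.sum_mem _ fun f _ =>
    Submodule.smul_mem _ _ (e.colSum_mem _))) fun g hg => ?_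
  rw [map_sub, map_sum, Finset.sum_eq_single ⟨g, hg⟩, map_smul, e.coord_colSum hg, smul_eq_mul,
    mul_one, sub_self]
  · intro f _ hne
    rw [map_smul, smul_eq_zero]
    right
    by_contra h0
    exact hne (Subtype.ext (e.eq_of_coord_colSum f.2 hg h0).symm)
  · simp

end ColumnWords

end Tableaux

section Straightening

variable {k : Type u} [Field k]

/-! ### Garnir relations and straightening. -/

section Garnir

variable {lam mu : YoungDiagram} {n : ℕ} {ε : Fin n → ZMod 2} {f : Fin (size lam mu) → Fin n}

/-- The places of the columns of `i` and `j` with letters `≥ f i` and `≤ f j`, respectively. -/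
def garnirSet (f : Fin (size lam mu) → Fin n) (i j : Fin (size lam mu)) :
    Finset (Fin (size lam mu)) :=
  Finset.univ.filter fun p => (colOf lam mu p = colOf lam mu i ∧ f i ≤ f p) ∨
    (colOf lam mu p = colOf lam mu j ∧ f p ≤ f j)

theorem mem_garnirSet {i j p : Fin (size lam mu)} : p ∈ garnirSet f i j ↔
    (colOf lam mu p = colOf lam mu i ∧ f i ≤ f p) ∨
      (colOf lam mu p = colOf lam mu j ∧ f p ≤ f j) := by
  simp [garnirSet]

/-- The Garnir set has more places than there are rows that meet its two columns. -/
theorem card_garnirSet (hf : ColStd lam mu ε f) {i j : Fin (size lam mu)}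
    (hr : rowOf lam mu i = rowOf lam mu j) (hc : colOf lam mu i < colOf lam mu j) :
    (Finset.Ico (mu.colLen (colOf lam mu j)) (lam.colLen (colOf lam mu i))).card
      < (garnirSet f i j).card := by
  set r := rowOf lam mu i with hrdef
  set S1 := Finset.univ.filter fun p => colOf lam mu p = colOf lam mu i ∧ r ≤ rowOf lam mu p
  set S2 := Finset.univ.filter fun p => colOf lam mu p = colOf lam mu j ∧ rowOf lam mu p ≤ r
  have hi1 := mem_lam i
  have hi2 := notMem_mu i
  have hj1 := mem_lam j
  have hj2 := notMem_mu j
  rw [← hr] at hj1 hj2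
  -- The row `r` of `i` and `j` counts for both `S1` and `S2`. Together these have at least
  -- `(lam.colLen _ - r) + (r + 1 - mu.colLen _)` places, one more than there are rows in the
  -- interval of the statement.
  have h1 : (Finset.Ico r (lam.colLen (colOf lam mu i))).card ≤ S1.card := by
    refine Finset.card_le_card_of_surjOn (rowOf lam mu) fun s hs => ?_
    simp only [Finset.coe_Ico, Set.mem_Ico] at hs
    obtain ⟨p, hp1, hp2⟩ := exists_place (YoungDiagram.mem_iff_lt_colLen.mpr hs.2)
      fun h => hi2 (mu.up_left_mem hs.1 le_rfl h)
    exact ⟨p, by simp [S1, hp1, hp2, hs.1], hp1⟩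
  have h2 : (Finset.Ico (mu.colLen (colOf lam mu j)) (r + 1)).card ≤ S2.card := by
    refine Finset.card_le_card_of_surjOn (rowOf lam mu) fun s hs => ?_
    simp only [Finset.coe_Ico, Set.mem_Ico] at hs
    obtain ⟨p, hp1, hp2⟩ := exists_place (lam.up_left_mem (Nat.lt_succ_iff.mp hs.2) le_rfl hj1)
      fun h => absurd (YoungDiagram.mem_iff_lt_colLen.mp h) hs.1.not_gt
    exact ⟨p, by simp [S2, hp1, hp2, Nat.lt_succ_iff.mp hs.2], hp1⟩
  have h3 : Disjoint S1 S2 := by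
    rw [Finset.disjoint_left]
    intro p hp hp'
    simp only [S1, S2, Finset.mem_filter] at hp hp'
    omega
  have h4 : S1 ∪ S2 ⊆ garnirSet f i j := by
    intro p hp
    rw [mem_garnirSet]
    rw [Finset.mem_union] at hp
    rcases hp with hp | hp
    · simp only [S1, Finset.mem_filter, Finset.mem_univ, true_and] at hp
      refine Or.inl ⟨hp.1, ?_⟩
      rcases hp.2.lt_or_eq with h | h
      · exact hf.sorted i p hp.1.symm (by simpa [rowWt] using h)
      · rw [place_ext h hp.1.symm]
    · simp only [S2, Finset.mem_filter, Finset.mem_univ, true_and] at hp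
      refine Or.inr ⟨hp.1, ?_⟩
      rcases hp.2.lt_or_eq with h | h
      · exact hf.sorted p j hp.1 (by simpa [rowWt, ← hr] using h)
      · rw [place_ext (h.trans hr) hp.1]
  have h5 := Finset.card_le_card h4
  rw [Finset.card_union_of_disjoint h3] at h5
  have h6 := YoungDiagram.mem_iff_lt_colLen.mp hi1
  have h7 := mt YoungDiagram.mem_iff_lt_colLen.mpr hj2
  simp only [Nat.card_Ico] at h1 h2 ⊢
  omega

/-- Every set of places with as many places in each of the two columns as the Garnir set has two
places in the same row. -/
theorem exists_same_row (hf : ColStd lam mu ε f) {i j : Fin (size lam mu)}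
    (hr : rowOf lam mu i = rowOf lam mu j) (hc : colOf lam mu i < colOf lam mu j)
    {σ : Equiv.Perm (Fin (size lam mu))} (hσ : σ ∈ colGroup lam mu) :
    ∃ p ∈ garnirSet f i j, ∃ q ∈ garnirSet f i j, p ≠ q ∧
      rowOf lam mu (σ p) = rowOf lam mu (σ q) := by
  refine Finset.exists_ne_map_eq_of_card_lt_of_maps_to (card_garnirSet hf hr hc) fun p hp => ?_
  have hcol : colOf lam mu (σ p) = colOf lam mu p := hσ p
  have h1 := YoungDiagram.mem_iff_lt_colLen.mp (mem_lam (σ p))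
  have h2 := mt YoungDiagram.mem_iff_lt_colLen.mpr (notMem_mu (σ p))
  have h3 := lam.colLen_anti _ _ hc.le
  have h4 := mu.colLen_anti _ _ hc.le
  rw [Finset.mem_coe, Finset.mem_Ico]
  rw [Finset.mem_coe, mem_garnirSet] at hp
  rw [hcol] at h1 h2
  rcases hp with hp | hp <;> rw [hp.1] at h1 h2 <;> omega

variable [NeZero (2 : k)] {M : SVec k}

/-- The transposition takes `t` to `-t`, but `θ` does not see permutations within a row. So `θ t =
-θ t`, and `2` is invertible. -/
theorem theta_eq_zero_of_swap {t : (M.pow (size lam mu)).carrier} {p q : Fin (size lam mu)}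
    (hpq : p ≠ q) (hr : rowOf lam mu p = rowOf lam mu q)
    (h : altHom M _ (Equiv.swap p q) t = t) : theta lam mu M t = 0 := by
  have h1 := theta_permAct M (swap_mem_young hr : Equiv.swap p q ∈ rowPerms lam mu) t
  rw [altHom_apply, signIn_swap hpq, neg_one_smul, neg_eq_iff_eq_neg] at h
  rw [h, map_neg] at h1
  have h2 : (2 : k) • theta lam mu M t = 0 := by
    rw [two_smul]
    nth_rewrite 1 [← h1]
    exact neg_add_cancel _
  exact (smul_eq_zero.mp h2).resolve_left (NeZero.ne _)

variable (e : HomBasis M n)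

/-- The Garnir relation of a violation of the row condition. -/
theorem HomBasis.exists_garnir (hf : ColStd lam mu e.parity f) {i j : Fin (size lam mu)}
    (hr : rowOf lam mu i = rowOf lam mu j) (hc : colOf lam mu i < colOf lam mu j)
    (hviol : ¬ (f i < f j ∨ (f i = f j ∧ e.parity (f i) = 0))) :
    ∃ g ∈ gammaPi lam mu M, theta lam mu M g = 0 ∧ (e.word _).coord f g = 1 ∧
      ∀ h, (e.word _).coord h g ≠ 0 → wt (colWt lam mu) f < wt (colWt lam mu) h ∨
        ∃ σ ∈ colGroup lam mu, h = f ∘ ⇑σ := by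
  push Not at hviol
  obtain ⟨hle, hodd⟩ := hviol
  replace hodd : f i = f j → e.parity (f i) = 1 := fun h =>
    (zmod2_cases _).resolve_left (hodd h)
  set A := garnirSet f i j with hA
  set D := exchange (colOf lam mu) A with hD
  have hA' : ∀ p ∈ A, (colOf lam mu p = colOf lam mu i ∧ f i ≤ f p) ∨
      (colOf lam mu p = colOf lam mu j ∧ f p ≤ f i) := fun p hp =>
    (mem_garnirSet.mp hp).imp_right fun h => ⟨h.1, h.2.trans hle⟩
  -- permutations in `D` of equal letters only move odd letters
  have hoddD : ∀ δ ∈ D, ∀ p, δ p ≠ p → f (δ p) = f p → e.parity (f p) = 1 := by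
    intro δ hδ p hp hfp
    by_cases hcp : colOf lam mu p = colOf lam mu (δ p)
    · exact hf.odd hcp (Ne.symm hp) hfp.symm
    · have hpA : p ∈ A := by
        by_contra h
        exact hcp (exchange_color hδ h).symm
      have h1 := mem_garnirSet.mp hpA
      have h2 := mem_garnirSet.mp ((exchange_mem hδ p).mpr hpA)
      -- A letter that occurs at `A`-places of both columns is `≥ f i` and `≤ f j`. As `f j ≤ f i`,
      -- all three are equal, and then the violation of the row condition says that the letter is
      -- odd.
      have key : f p = f i ∧ f i = f j := by
        rcases h1 with h1 | h1 <;> rcases h2 with h2 | h2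
        · exact absurd (h1.1.trans h2.1.symm) hcp
        · have := h1.2; have := h2.2; constructor <;> omega
        · have := h1.2; have := h2.2; constructor <;> omega
        · exact absurd (h1.1.trans h2.1.symm) hcp
      rw [key.1]
      exact hodd key.2
  -- the stabilizer of `f` in the column group is contained in `D`
  have hstab : ∀ σ ∈ colGroup lam mu, f ∘ ⇑σ = f → σ ∈ D := by
    intro σ hσ hfσ p
    have hcol : colOf lam mu (σ p) = colOf lam mu p := hσ p
    have hmem : σ p ∈ A ↔ p ∈ A := by
      rw [mem_garnirSet, mem_garnirSet, hcol, show f (σ p) = f p from congrFun hfσ p]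
    by_cases hp : p ∈ A
    · simp [hp, hmem.mpr hp]
    · simp [hp, mt hmem.mp hp, hcol]
  -- The tensor `z` is alternating under `D`, in particular under the permutations of `A`. Its orbit
  -- sum under the column group is the relation.
  set z := orbSum (altHom M (size lam mu)) D (e.word _ f) with hz
  have hzinv : ∀ δ ∈ D, altHom M _ δ z = z := fun δ hδ => orbSum_invariant _ _ _ hδ
  have hinv : ∀ σ ∈ colGroup lam mu, ∀ h : Fin (size lam mu) → Fin n,
      wt (colWt lam mu) (h ∘ ⇑σ) = wt (colWt lam mu) h := fun σ hσ h =>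
    wt_comp_of_invariant (fun p => congrArg Nat.cast (hσ p)) h
  refine ⟨orbSum (altHom M (size lam mu)) (colGroup lam mu) z,
    mem_gammaPi_iff.mpr fun _ hσ => orbSum_invariant _ _ _ hσ, ?_, ?_, ?_⟩
  -- Every column permutation `σ` puts two places of `A` in one row by the pigeonhole principle.
  -- Since `z` is alternating in these places, `σ z` is alternating in their images, and `θ` kills
  -- it.
  · refine orbSum_mem _ _ _ (LinearMap.ker (theta lam mu M)) fun σ hσ => ?_
    obtain ⟨p, hp, q, hq, hpq, hrow⟩ := exists_same_row hf hr hc hσ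
    refine theta_eq_zero_of_swap (σ.injective.ne hpq) hrow ?_
    have hs : Equiv.swap p q ∈ D := swap_mem_young (by rw [if_pos hp, if_pos hq])
    have hconj : Equiv.swap (σ p) (σ q) * σ = σ * Equiv.swap p q :=
      (Equiv.mul_swap_eq_swap_mul σ p q).symm
    rw [← Module.End.mul_apply, ← map_mul, hconj, map_mul, Module.End.mul_apply, hzinv _ hs]
  -- If `f` occurs in `σ z`, then `f ∘ σ = f ∘ δ` with `δ` in `D`. Column permutations keep the
  -- column weight, so by the equality case of `wt_exchange` `δ` may be replaced by a column
  -- permutation `h` in `D`. Now `σ * h⁻¹` stabilizes `f` and lies in `D`. Hence `σ` is in `D` and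
  -- `σ z = z`, so this term is counted once.
  · rw [map_orbSum_eq, e.coord_orbSum_word hoddD]
    intro σ hσ hne
    obtain ⟨δ, hδ, hfδ⟩ := e.exists_of_coord_orbSum_word (e.coord_altHom_ne_zero hne)
    obtain ⟨h, hhD, hhC, hfh⟩ := (wt_exchange hc hA' hδ).2 (by
      rw [← hfδ]; exact hinv σ hσ f)
    have hmem : σ * h⁻¹ ∈ D := by
      refine hstab _ (mul_mem hσ (inv_mem hhC)) ?_
      rw [Equiv.Perm.coe_mul, ← Function.comp_assoc, hfδ, hfh]
      funext p; simp
    have : σ ∈ D := by simpa using mul_mem hmem hhD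
    exact hzinv σ this
  -- The words of the relation are column rearrangements of exchanges of `f`. Exchanges do not lower
  -- the column weight, and when they preserve it the word stays in the column orbit of `f`.
  · intro h hne
    obtain ⟨σ, hσ, hne⟩ := e.exists_of_coord_orbSum hne
    obtain ⟨δ, hδ, hfδ⟩ := e.exists_of_coord_orbSum_word hne
    obtain ⟨hwle, hweq⟩ := wt_exchange hc hA' hδ
    have hw : wt (colWt lam mu) h = wt (fun p => (colOf lam mu p : ℤ)) (f ∘ ⇑δ) := by
      rw [← hinv σ hσ h, hfδ]; rfl
    rcases hwle.lt_or_eq with hlt | heq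
    · exact Or.inl (by rw [hw]; exact hlt)
    · obtain ⟨h', _, hhC, hfh⟩ := hweq heq.symm
      refine Or.inr ⟨h' * σ⁻¹, mul_mem hhC (inv_mem hσ), ?_⟩
      rw [Equiv.Perm.coe_mul, ← Function.comp_assoc, ← hfh, ← hfδ]
      funext p; simp

/-! ### The tableaux span the Schur space and are independent. -/

/-- The image of a tableau in the Schur superfunctor. -/
def HomBasis.tab (f : Tableau lam mu e.parity) : (symPow lam mu M).carrier :=
  theta lam mu M (e.colSum lam mu f.1)

open Classical in
/-- Straightening: the tableaux span the value of the Schur superfunctor. -/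
theorem HomBasis.theta_colSum_mem (hf : ColStd lam mu e.parity f) :
    theta lam mu M (e.colSum lam mu f)
      ∈ Submodule.span k (Set.range (e.tab (lam := lam) (mu := mu))) := by
  -- There are finitely many words, so the number of words of larger column weight is a measure that
  -- decreases under straightening.
  induction hN : (Finset.univ.filter fun h : Fin (size lam mu) → Fin n =>
    wt (colWt lam mu) f < wt (colWt lam mu) h).card using Nat.strong_induction_on
    generalizing f with
  | _ N ih =>
  subst hN
  by_cases hrow : RowStd lam mu e.parity f
  · exact Submodule.subset_span ⟨⟨f, hf, hrow⟩, rfl⟩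
  rw [RowStd] at hrow
  simp only [not_forall] at hrow
  obtain ⟨i, j, hr, hc, hviol⟩ := hrow
  obtain ⟨g, hg, hg0, hgf, hsupp⟩ := e.exists_garnir hf hr hc hviol
  -- The Garnir relation has coefficient `1` at `f`, so it expresses `θ` of the column sum of `f` by
  -- the other column standard words.
  rw [e.gammaPi_expand hg, map_sum, ← Finset.add_sum_erase _ _ (Finset.mem_univ ⟨f, hf⟩),
    map_smul, hgf, one_smul, add_eq_zero_iff_eq_neg] at hg0
  rw [hg0]
  refine Submodule.neg_mem _ (Submodule.sum_mem _ fun h hh => ?_)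
  rw [map_smul]
  by_cases h0 : (e.word _).coord h.1 g = 0
  · rw [h0, zero_smul]; exact Submodule.zero_mem _
  refine Submodule.smul_mem _ _ ?_
  rcases hsupp h.1 h0 with hlt | ⟨σ, hσ, heq⟩
  · refine ih _ (Finset.card_lt_card ((Finset.ssubset_iff_of_subset ?_).mpr
      ⟨h.1, ?_, ?_⟩)) h.2 rfl
    · intro p hp
      simp only [Finset.mem_filter, Finset.mem_univ, true_and] at hp ⊢
      exact hlt.trans hp
    · simpa using hlt
    · simp
  -- The only column standard word in the column orbit of `f` is `f` itself, and its term has been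
  -- moved to the other side.
  · refine absurd (Subtype.ext ?_) (Finset.ne_of_mem_erase hh)
    have hs := h.2.sorted
    rw [heq] at hs ⊢
    exact hf.sorted.unique rowWt_inj hσ hs

theorem HomBasis.schurSub_le_span :
    schurSub lam mu M ≤ Submodule.span k (Set.range (e.tab (lam := lam) (mu := mu))) := by
  classical
  rintro _ ⟨t, ht, rfl⟩
  rw [e.gammaPi_expand ht, map_sum]
  refine Submodule.sum_mem _ fun f _ => ?_
  rw [map_smul]
  exact Submodule.smul_mem _ _ (e.theta_colSum_mem f.2)

theorem HomBasis.finrank_schurSub_le :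
    Module.finrank k (schurSub lam mu M) ≤ Nat.card (Tableau lam mu e.parity) := by
  have := Fintype.ofFinite (Tableau lam mu e.parity)
  rw [Nat.card_eq_fintype_card]
  exact (Submodule.finrank_mono e.schurSub_le_span).trans (finrank_range_le_card _)

/-- The functional that is dual to a tableau up to tableaux of smaller weight. -/
theorem HomBasis.exists_dual_tab (f : Tableau lam mu e.parity) :
    ∃ φ : (symPow lam mu M).carrier →ₗ[k] k, φ (e.tab f) = 1 ∧
      ∀ g : Tableau lam mu e.parity, φ (e.tab g) ≠ 0 → g = f ∨
        wt (rowWt lam mu) f.1 < wt (rowWt lam mu) g.1 := by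
  -- The coordinate at `f` does not factor through `θ`, but its orbit sum under the row group does.
  -- The even letters that repeat in a row do not spoil the coefficient `1`, since permuting them
  -- costs no sign.
  set F := orbSum (dualHom M (size lam mu) k) (rowPerms lam mu) ((e.word _).coord f.1)
  have hinv : ∀ σ ∈ rowPerms lam mu, wt (rowWt lam mu) (f.1 ∘ ⇑σ) = wt (rowWt lam mu) f.1 :=
    fun σ hσ => wt_comp_of_invariant (fun p => congrArg Nat.cast (hσ p)) f.1
  have hF0 : ∀ t, F t ≠ 0 → ∃ σ ∈ rowPerms lam mu, (e.word _).coord (f.1 ∘ ⇑σ) t ≠ 0 := by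
    intro t ht
    by_contra! hno
    refine ht (map_orbSum_eq_zero _ _ _ (LinearMap.applyₗ t) fun σ hσ => ?_)
    change (e.word _).coord f.1 (permAct M σ⁻¹ t) = 0
    rw [e.coord_permAct, hno _ (inv_mem hσ), mul_zero]
  have hFw : F (e.word _ f.1) = 1 := by
    have := map_orbSum_eq (dualHom M (size lam mu) k) (rowPerms lam mu) ((e.word _).coord f.1)
      (LinearMap.applyₗ (e.word _ f.1)) fun σ hσ hne => ?_
    · refine this.trans ?_
      rw [LinearMap.applyₗ_apply_apply, e.coord_word, if_pos rfl]
    · rw [LinearMap.applyₗ_apply_apply, dualHom_apply, e.coord_permAct] at hne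
      have hf : f.1 ∘ ⇑σ⁻¹ = f.1 := e.coord_word_ne_zero (right_ne_zero_of_mul hne)
      exact e.dualHom_coord hf fun i hi =>
        f.2.2.even (inv_mem hσ i).symm (Ne.symm hi) (congrFun hf i).symm
  obtain ⟨φ, hφ⟩ := exists_theta_factor F fun σ hσ => orbSum_invariant _ _ _ hσ
  -- the words in a column orbit that lie in the row orbit of `f`
  have hcol : ∀ g : Tableau lam mu e.parity, ∀ σ ∈ colGroup lam mu,
      F (altHom M _ σ (e.word _ g.1)) ≠ 0 → (g.1 ∘ ⇑σ⁻¹ = g.1 ∧ g = f) ∨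
        wt (rowWt lam mu) f.1 < wt (rowWt lam mu) g.1 := by
    intro g σ hσ hne
    obtain ⟨ρ, hρ, hne⟩ := hF0 _ hne
    have h1 := e.coord_word_ne_zero (e.coord_altHom_ne_zero hne)
    have h2 : f.1 ∘ ⇑ρ = g.1 ∘ ⇑σ⁻¹ := by rw [← h1]; funext p; simp
    -- A row permutation keeps the row weight, and a column permutation cannot raise that of the
    -- sorted word `g`. So the weight of `f` is at most that of `g`. In case of equality the column
    -- permutation fixes `g`. Then `f` and `g` lie in one row orbit and, both being sorted along the
    -- rows, coincide.
    have h3 := g.2.1.sorted.wt_comp_le rowWt_inj (inv_mem hσ)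
    have h4 := hinv ρ hρ
    rw [h2] at h4
    rcases h3.lt_or_eq with hlt | heq
    · exact Or.inr (by omega)
    · have h5 := g.2.1.sorted.eq_of_wt_comp_eq rowWt_inj (inv_mem hσ) heq
      refine Or.inl ⟨h5, Subtype.ext ?_⟩
      rw [← h5, ← h2]
      refine f.2.2.sorted.unique colWt_inj hρ ?_
      rw [h2, h5]
      exact g.2.2.sorted
  refine ⟨φ, ?_, fun g hg => ?_⟩
  · rw [HomBasis.tab, hφ]
    refine (map_orbSum_eq _ _ _ F fun σ hσ hne => ?_).trans hFw
    rcases hcol f σ hσ hne with h | h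
    · have hfσ : f.1 ∘ ⇑σ = f.1 := by
        conv_lhs => rw [← h.1]
        funext p; simp
      exact e.altHom_word hfσ fun i hi =>
        f.2.1.odd (hσ i).symm (Ne.symm hi) (congrFun hfσ i).symm
    · exact absurd h (lt_irrefl _)
  · rw [HomBasis.tab, hφ] at hg
    by_contra! hno
    refine hg (map_orbSum_eq_zero _ _ _ F fun σ hσ => ?_)
    by_contra hne
    rcases hcol g σ hσ hne with h | h
    · exact hno.1 h.2
    · exact absurd h hno.2.not_gt

/-- In a linear relation take a tableau of maximal row weight among those with nonzero coefficients.
The functional of `HomBasis.exists_dual_tab` for it vanishes on all other terms. -/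
theorem HomBasis.linearIndependent_tab :
    LinearIndependent k (e.tab (lam := lam) (mu := mu)) := by
  have := Fintype.ofFinite (Tableau lam mu e.parity)
  rw [Fintype.linearIndependent_iff]
  intro a ha
  by_contra! hne
  classical
  obtain ⟨f, hf, hmax⟩ := (Finset.univ.filter fun f => a f ≠ 0).exists_max_image
    (fun f => wt (rowWt lam mu) f.1) (by
      obtain ⟨f, hf⟩ := hne
      exact ⟨f, by simpa using hf⟩)
  obtain ⟨φ, h1, h2⟩ := e.exists_dual_tab f
  have h3 := congrArg φ ha
  rw [map_sum, map_zero, Finset.sum_eq_single f, map_smul, h1, smul_eq_mul, mul_one] at h3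
  · exact (Finset.mem_filter.mp hf).2 h3
  · intro g _ hgf
    rw [map_smul, smul_eq_zero]
    by_contra! hg
    rcases h2 g hg.2 with h | h
    · exact hgf h
    · exact absurd h (hmax g (by simpa using hg.1)).not_gt
  · simp

/-- The upper bound `HomBasis.finrank_schurSub_le` is used for the direct sum and this lower bound
for the two summands. -/
theorem HomBasis.card_tableau_le :
    Nat.card (Tableau lam mu e.parity) ≤ Module.finrank k (schurSub lam mu M) := by
  have := Fintype.ofFinite (Tableau lam mu e.parity)
  rw [Nat.card_eq_fintype_card]
  have hli : LinearIndependent k fun f : Tableau lam mu e.parity =>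
      (⟨e.tab f, _, e.colSum_mem f.1, rfl⟩ : schurSub lam mu M) :=
    LinearIndependent.of_comp (schurSub lam mu M).subtype e.linearIndependent_tab
  exact hli.fintype_card_le_finrank

end Garnir

end Straightening

section Cutting

variable {k : Type u} [Field k]

/-! ### The places of `λ / μ` divided by an intermediate partition. -/

section Split

variable {lam nu mu : YoungDiagram} (h : mu ≤ nu) (h' : nu ≤ lam)

/-- The places of `λ / μ` as those of `ν / μ` and those of `λ / ν`. -/
def splitPlaces : Fin (size nu mu) ⊕ Fin (size lam nu) ≃ Fin (size lam mu) :=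
  (places (size_add h h')).trans (shuffle h h')

theorem colCell_splitPlaces_inl (i : Fin (size nu mu)) :
    (colCell lam mu (splitPlaces h h' (.inl i))).1 = (colCell nu mu i).1 := by
  simp [splitPlaces, shuffle]

theorem colCell_splitPlaces_inr (i : Fin (size lam nu)) :
    (colCell lam mu (splitPlaces h h' (.inr i))).1 = (colCell lam nu i).1 := by
  simp [splitPlaces, shuffle]

theorem rowOf_inl (i : Fin (size nu mu)) :
    rowOf lam mu (splitPlaces h h' (.inl i)) = rowOf nu mu i :=
  congrArg Prod.fst (colCell_splitPlaces_inl h h' i)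

theorem rowOf_inr (i : Fin (size lam nu)) :
    rowOf lam mu (splitPlaces h h' (.inr i)) = rowOf lam nu i :=
  congrArg Prod.fst (colCell_splitPlaces_inr h h' i)

theorem colOf_inl (i : Fin (size nu mu)) :
    colOf lam mu (splitPlaces h h' (.inl i)) = colOf nu mu i :=
  congrArg Prod.snd (colCell_splitPlaces_inl h h' i)

theorem colOf_inr (i : Fin (size lam nu)) :
    colOf lam mu (splitPlaces h h' (.inr i)) = colOf lam nu i :=
  congrArg Prod.snd (colCell_splitPlaces_inr h h' i)

/-- The places of `λ / μ` that lie in `ν`. -/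
def inside (lam nu mu : YoungDiagram) (i : Fin (size lam mu)) : Bool :=
  decide ((colCell lam mu i).1 ∈ nu)

theorem inside_inl (i : Fin (size nu mu)) :
    inside lam nu mu (splitPlaces h h' (.inl i)) = true := by
  rw [inside, colCell_splitPlaces_inl, decide_eq_true_eq]
  exact (Finset.mem_sdiff.mp (colCell nu mu i).2).1

theorem inside_inr (i : Fin (size lam nu)) :
    inside lam nu mu (splitPlaces h h' (.inr i)) = false := by
  rw [inside, colCell_splitPlaces_inr, decide_eq_false_iff_not]
  exact (Finset.mem_sdiff.mp (colCell lam nu i).2).2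

end Split

/-! ### Cutting tableaux in the letters of a direct sum. -/

section Count

variable {lam mu : YoungDiagram} {n m : ℕ} {ε : Fin n → ZMod 2} {ε' : Fin m → ZMod 2}

/-- The cells of `μ` and those with one of the first `n` letters. -/
def cut (f : Tableau lam mu (Sum.elim ε ε' ∘ (finSumFinEquiv (m := n) (n := m)).symm)) :
    YoungDiagram where
  cells := mu.cells ∪ (Finset.univ.filter fun p => (f.1 p).val < n).map
    ((colCell lam mu).toEmbedding.trans (Function.Embedding.subtype _))
  isLowerSet := by
    rintro ⟨r, c⟩ ⟨r', c'⟩ hle hmem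
    simp only [Finset.coe_union, Set.mem_union, Finset.mem_coe, Finset.mem_map,
      Finset.mem_filter, Finset.mem_univ, true_and, YoungDiagram.mem_cells] at hmem ⊢
    rcases hmem with hmem | ⟨p, hp, hpc⟩
    · exact Or.inl (mu.isLowerSet hle hmem)
    by_cases hmu : (r', c') ∈ mu
    · exact Or.inl hmu
    right
    have hpr : rowOf lam mu p = r := congrArg Prod.fst hpc
    have hpc' : colOf lam mu p = c := congrArg Prod.snd hpc
    have hlam := mem_lam p
    rw [hpr, hpc'] at hlam
    -- The letters weakly increase from `s` at `(r', c')` down to `q` at `(r, c')`, and from there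
    -- along the row to `p`. The cell of `q` is not in `μ` because the cell of `s` above it is not.
    obtain ⟨q, hq1, hq2⟩ := exists_place (lam.up_left_mem le_rfl hle.2 hlam)
      fun h => hmu (mu.up_left_mem hle.1 le_rfl h)
    obtain ⟨s, hs1, hs2⟩ := exists_place (lam.up_left_mem hle.1 hle.2 hlam) hmu
    have h1 : f.1 q ≤ f.1 p := by
      rcases (show c' ≤ c from hle.2).lt_or_eq with hlt | heq
      · exact f.2.2.sorted q p (by omega) (by simp [colWt]; omega)
      · rw [place_ext (i := q) (j := p) (by omega) (by omega)]
    have h2 : f.1 s ≤ f.1 q := by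
      rcases (show r' ≤ r from hle.1).lt_or_eq with hlt | heq
      · exact f.2.1.sorted s q (by omega) (by simp [rowWt]; omega)
      · rw [place_ext (i := s) (j := q) (by omega) (by omega)]
    exact ⟨s, (Fin.val_fin_le.mpr (h2.trans h1)).trans_lt hp, Prod.ext hs1 hs2⟩

theorem mem_cut_iff
    (f : Tableau lam mu (Sum.elim ε ε' ∘ (finSumFinEquiv (m := n) (n := m)).symm))
    (p : Fin (size lam mu)) : (colCell lam mu p).1 ∈ cut f ↔ (f.1 p).val < n := by
  rw [← YoungDiagram.mem_cells, cut]
  simp only [Finset.mem_union, Finset.mem_map, Finset.mem_filter, Finset.mem_univ, true_and,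
    YoungDiagram.mem_cells]
  constructor
  · rintro (h | ⟨q, hq, hqp⟩)
    · exact absurd h (notMem_mu p)
    · rwa [(colCell lam mu).injective (Subtype.ext hqp)] at hq
  · exact fun h => Or.inr ⟨p, h, rfl⟩

/-- A tableau in the letters of a direct sum is a tableau in the letters of the first summand and
one in the letters of the second summand. -/
theorem exists_split_tableau (hmu : mu ≤ lam)
    (f : Tableau lam mu (Sum.elim ε ε' ∘ (finSumFinEquiv (m := n) (n := m)).symm)) :
    ∃ (xi : Between lam mu) (a : Tableau xi.1 mu ε) (b : Tableau lam xi.1 ε'),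
      f.1 = (finSumFinEquiv ∘ Sum.map a.1 b.1) ∘ (splitPlaces xi.2.1 xi.2.2).symm := by
  have h1 : mu ≤ cut f := Finset.subset_union_left
  have h2 : cut f ≤ lam := by
    refine Finset.union_subset hmu fun c hc => ?_
    obtain ⟨p, _, rfl⟩ := Finset.mem_map.mp hc
    exact mem_lam p
  have ha : ∀ i : Fin (size (cut f) mu), ∃ x : Fin n,
      f.1 (splitPlaces h1 h2 (.inl i)) = finSumFinEquiv (.inl x) := by
    intro i
    have := (mem_cut_iff f (splitPlaces h1 h2 (.inl i))).mp
      (of_decide_eq_true (inside_inl h1 h2 i))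
    exact ⟨⟨_, this⟩, Fin.ext (by simp)⟩
  have hb : ∀ i : Fin (size lam (cut f)), ∃ x : Fin m,
      f.1 (splitPlaces h1 h2 (.inr i)) = finSumFinEquiv (.inr x) := by
    intro i
    have := mt (mem_cut_iff f (splitPlaces h1 h2 (.inr i))).mpr
      (of_decide_eq_false (inside_inr h1 h2 i))
    refine ⟨⟨(f.1 (splitPlaces h1 h2 (.inr i))).val - n, ?_⟩, Fin.ext ?_⟩
    · have := (f.1 (splitPlaces h1 h2 (.inr i))).2
      omega
    · simp; omega
  choose a ha using ha
  choose b hb using hb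
  -- The embedding of the letters of each summand preserves order, so the row and column conditions
  -- restrict to the two halves.
  have ltl : ∀ x y : Fin n, finSumFinEquiv (.inl x : Fin n ⊕ Fin m) < finSumFinEquiv (.inl y)
      ↔ x < y := fun x y => Fin.lt_def.trans (by simp)
  have ltr : ∀ x y : Fin m, finSumFinEquiv (.inr x : Fin n ⊕ Fin m) < finSumFinEquiv (.inr y)
      ↔ x < y := fun x y => Fin.lt_def.trans (by simp)
  refine ⟨⟨cut f, h1, h2⟩, ⟨a, fun i j hc hr => ?_, fun i j hr hc => ?_⟩,
    ⟨b, fun i j hc hr => ?_, fun i j hr hc => ?_⟩, ?_⟩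
  · have := f.2.1 (splitPlaces h1 h2 (.inl i)) (splitPlaces h1 h2 (.inl j))
      (by rwa [colOf_inl, colOf_inl]) (by rwa [rowOf_inl, rowOf_inl])
    rw [ha, ha, ltl, finSumFinEquiv.injective.eq_iff, Sum.inl.injEq, Function.comp_apply,
      Equiv.symm_apply_apply] at this
    exact this
  · have := f.2.2 (splitPlaces h1 h2 (.inl i)) (splitPlaces h1 h2 (.inl j))
      (by rwa [rowOf_inl, rowOf_inl]) (by rwa [colOf_inl, colOf_inl])
    rw [ha, ha, ltl, finSumFinEquiv.injective.eq_iff, Sum.inl.injEq, Function.comp_apply,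
      Equiv.symm_apply_apply] at this
    exact this
  · have := f.2.1 (splitPlaces h1 h2 (.inr i)) (splitPlaces h1 h2 (.inr j))
      (by rwa [colOf_inr, colOf_inr]) (by rwa [rowOf_inr, rowOf_inr])
    rw [hb, hb, ltr, finSumFinEquiv.injective.eq_iff, Sum.inr.injEq, Function.comp_apply,
      Equiv.symm_apply_apply] at this
    exact this
  · have := f.2.2 (splitPlaces h1 h2 (.inr i)) (splitPlaces h1 h2 (.inr j))
      (by rwa [rowOf_inr, rowOf_inr]) (by rwa [colOf_inr, colOf_inr])
    rw [hb, hb, ltr, finSumFinEquiv.injective.eq_iff, Sum.inr.injEq, Function.comp_apply,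
      Equiv.symm_apply_apply] at this
    exact this
  · funext p
    obtain ⟨q, rfl⟩ := (splitPlaces h1 h2).surjective p
    rw [Function.comp_apply, Equiv.symm_apply_apply]
    rcases q with q | q
    · exact ha q
    · exact hb q

/-- The partition and the two halves determine the tableau, so cutting is injective. Only this
inequality is needed. -/
theorem card_tableau_sum_le (hmu : mu ≤ lam) [Fintype (Between lam mu)] :
    Nat.card (Tableau lam mu (Sum.elim ε ε' ∘ (finSumFinEquiv (m := n) (n := m)).symm))
      ≤ ∑ xi : Between lam mu,
        Nat.card (Tableau xi.1 mu ε) * Nat.card (Tableau lam xi.1 ε') := by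
  have key := fun f : Tableau lam mu (Sum.elim ε ε' ∘ (finSumFinEquiv (m := n) (n := m)).symm) =>
    exists_split_tableau hmu f
  choose xi a b hab using key
  have hinj : Function.Injective fun f : Tableau lam mu (Sum.elim ε ε' ∘ finSumFinEquiv.symm) =>
      (⟨xi f, a f, b f⟩ : Σ xi : Between lam mu, Tableau xi.1 mu ε × Tableau lam xi.1 ε') := by
    refine Function.Injective.of_comp (f := fun x :
      Σ xi : Between lam mu, Tableau xi.1 mu ε × Tableau lam xi.1 ε' =>
        (finSumFinEquiv ∘ Sum.map x.2.1.1 x.2.2.1) ∘ (splitPlaces x.1.2.1 x.1.2.2).symm) ?_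
    intro f g hfg
    refine Subtype.ext ((hab f).trans (Eq.trans ?_ (hab g).symm))
    exact hfg
  refine (Nat.card_le_card_of_injective _ hinj).trans ?_
  rw [Nat.card_sigma]
  exact Finset.sum_le_sum fun x _ => (Nat.card_prod _ _).le

end Count

/-- The values of the Schur superfunctors on a direct sum are not larger than the sum of the
products of their values on the summands. -/
theorem finrank_schurSub_sum_le [NeZero (2 : k)] {lam mu : YoungDiagram} (hmu : mu ≤ lam)
    (M N : SVec k) [Fintype (Between lam mu)] :
    Module.finrank k (schurSub lam mu (M.sum N)) ≤ ∑ xi : Between lam mu,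
      Module.finrank k (schurSub xi.1 mu M) * Module.finrank k (schurSub lam xi.1 N) := by
  obtain ⟨n, ⟨e⟩⟩ := exists_homBasis M
  obtain ⟨m, ⟨e'⟩⟩ := exists_homBasis N
  -- Straightening bounds the left side by a number of tableaux, and independence bounds the factors
  -- on the right side from below.
  refine (e.sum e').finrank_schurSub_le.trans ((card_tableau_sum_le hmu).trans ?_)
  exact Finset.sum_le_sum fun xi _ => Nat.mul_le_mul e.card_tableau_le e'.card_tableau_le

end Cutting

/-! ### The products `x ∗ y` as alternating tensors. -/

section Products

variable {k : Type u} [Field k]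

theorem tensorMap_comp {U U' U'' W W' W'' : SVec k} (f' : U'.carrier →ₗ[k] U''.carrier)
    (g' : W'.carrier →ₗ[k] W''.carrier) (f : U.carrier →ₗ[k] U'.carrier)
    (g : W.carrier →ₗ[k] W'.carrier) :
    tensorMap f' g' ∘ₗ tensorMap f g = tensorMap (f' ∘ₗ f) (g' ∘ₗ g) :=
  (TensorProduct.map_comp f' g' f g).symm

theorem powMap_inl_fst {d : ℕ} (M N : SVec k) : (powMap fun _ : Fin d => inl M N ∘ₗ fst M N) ∘ₗ
    (powMap fun _ => inl M N) = powMap fun _ => inl M N := powMap_comp _ _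

theorem powMap_inr_snd {d : ℕ} (M N : SVec k) : (powMap fun _ : Fin d => inr M N ∘ₗ snd M N) ∘ₗ
    (powMap fun _ => inr M N) = powMap fun _ => inr M N := powMap_comp _ _

theorem powMap_id {d : ℕ} (M : SVec k) :
    (powMap fun _ : Fin d => (LinearMap.id : M.carrier →ₗ[k] M.carrier)) = LinearMap.id :=
  pow_ext fun v => powMap_pure _ v

theorem powMap_fst_inl {d : ℕ} (M N : SVec k) :
    (powMap fun _ : Fin d => fst M N) ∘ₗ (powMap fun _ => inl M N) = LinearMap.id :=
  (powMap_comp _ _).trans (powMap_id M)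

theorem powMap_snd_inr {d : ℕ} (M N : SVec k) :
    (powMap fun _ : Fin d => snd M N) ∘ₗ (powMap fun _ => inr M N) = LinearMap.id :=
  (powMap_comp _ _).trans (powMap_id N)

/-- This lets a `mask` be inserted for free, which then annihilates all terms whose places do not
match. -/
theorem mask_join (M N : SVec k) {e f d : ℕ} (hd : e + f = d) : mask M N (isFirst e d) ∘ₗ
    (join hd (M.sum N)).toLinearMap ∘ₗ
      tensorMap (powMap fun _ => inl M N) (powMap fun _ => inr M N)
    = (join hd (M.sum N)).toLinearMap ∘ₗ
      tensorMap (powMap fun _ => inl M N) (powMap fun _ => inr M N) := by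
  rw [← LinearMap.comp_assoc, ← join_tensorMap, LinearMap.comp_assoc, tensorMap_comp,
    powMap_inl_fst, powMap_inr_snd]

variable [NeZero (2 : k)]

theorem superTensor_eq_tensorMap {U U' W W' : SVec k} (f : U.carrier →ₗ[k] U'.carrier)
    {g : W.carrier →ₗ[k] W'.carrier} (hg : HasParity 0 g) :
    superTensor f g = tensorMap f g := by
  refine tensor_ext_hom fun p x y hx => ?_
  rw [superTensor_tmul _ _ hx, twist_even p hg]
  rfl

section Base

variable {lam nu mu : YoungDiagram} (h : mu ≤ nu) (h' : nu ≤ lam) (M N : SVec k)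

/-- The tensor with factors in `M` at the cells of `ν / μ` and factors in `N` at the cells of
`λ / ν`. -/
def base : ((M.pow (size nu mu)).tensor (N.pow (size lam nu))).carrier →ₗ[k]
    ((M.sum N).pow (size lam mu)).carrier :=
  permAct (M.sum N) (shuffle h h') ∘ₗ (join (size_add h h') (M.sum N)).toLinearMap ∘ₗ
    tensorMap (powMap fun _ => inl M N) (powMap fun _ => inr M N)

/-- The product `x ∗ y` as a linear map. -/
def astMap : ((M.pow (size nu mu)).tensor (N.pow (size lam nu))).carrier →ₗ[k]
    ((M.sum N).pow (size lam mu)).carrier :=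
  ∑ q : colGroup lam mu ⧸ splitGroup lam nu mu,
    (altHom (M.sum N) (size lam mu) q.out.1 : _ →ₗ[k] _) ∘ₗ base h h' M N

theorem ast_eq (x : (M.pow (size nu mu)).carrier) (y : (N.pow (size lam nu)).carrier) :
    ast h h' x y = astMap h h' M N (tmul x y) := by
  rw [astMap, LinearMap.sum_apply]
  rfl

theorem inside_comp_shuffle :
    inside lam nu mu ∘ ⇑(shuffle h h') = isFirst (size nu mu) (size lam mu) := by
  funext i
  obtain ⟨j, rfl⟩ := (places (size_add h h')).surjective i
  rcases j with j | j
  · exact (inside_inl h h' j).trans (by simp [isFirst, places_inl])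
  · exact (inside_inr h h' j).trans (by simp [isFirst, places_inr])

theorem inside_eq :
    inside lam nu mu = isFirst (size nu mu) (size lam mu) ∘ ⇑(shuffle h h')⁻¹ := by
  rw [← inside_comp_shuffle h h']
  funext i; simp

theorem mask_base : mask M N (inside lam nu mu) ∘ₗ base h h' M N = base h h' M N := by
  rw [base, inside_eq h h', ← LinearMap.comp_assoc, ← permAct_mask, LinearMap.comp_assoc,
    mask_join]

variable {h h'} in
/-- The permutations that preserve the cells of `ν`. -/
theorem exists_of_mem_inside {σ : Equiv.Perm (Fin (size lam mu))}
    (hσ : σ ∈ young (inside lam nu mu)) :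
    ∃ (α : Equiv.Perm (Fin (size nu mu))) (β : Equiv.Perm (Fin (size lam nu))),
      σ = shuffle h h' * (places (size_add h h')).permCongr (Equiv.Perm.sumCongr α β) *
        (shuffle h h')⁻¹ ∧
      (∀ i, σ (splitPlaces h h' (.inl i)) = splitPlaces h h' (.inl (α i))) ∧
      ∀ i, σ (splitPlaces h h' (.inr i)) = splitPlaces h h' (.inr (β i)) := by
  have h1 : (shuffle h h')⁻¹ * σ * shuffle h h' ∈ young (isFirst (size nu mu) (size lam mu)) := by
    intro i
    rw [← inside_comp_shuffle h h']
    simpa using hσ (shuffle h h' i)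
  obtain ⟨α, β, hαβ⟩ := exists_of_mem_young (size_add h h') h1
  have h2 : σ = shuffle h h' * (places (size_add h h')).permCongr (Equiv.Perm.sumCongr α β) *
      (shuffle h h')⁻¹ := by
    rw [← hαβ]; group
  refine ⟨α, β, h2, fun i => ?_, fun i => ?_⟩
  · rw [h2]; simp [splitPlaces]
  · rw [h2]; simp [splitPlaces]

theorem join_permAct_inclusions {e f d : ℕ} (hd : e + f = d) (α : Equiv.Perm (Fin e))
    (β : Equiv.Perm (Fin f)) :
    permAct (M.sum N) ((places hd).permCongr (Equiv.Perm.sumCongr α β)) ∘ₗ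
      (join hd (M.sum N)).toLinearMap ∘ₗ
        tensorMap (powMap fun _ => inl M N) (powMap fun _ => inr M N)
    = ((join hd (M.sum N)).toLinearMap ∘ₗ
        tensorMap (powMap fun _ => inl M N) (powMap fun _ => inr M N)) ∘ₗ
      tensorMap (permAct M α) (permAct N β) := by
  rw [← LinearMap.comp_assoc, ← join_permAct, LinearMap.comp_assoc, LinearMap.comp_assoc,
    superTensor_eq_tensorMap _ (permAct_even _ β), tensorMap_comp, tensorMap_comp,
    permAct_powMap α _ fun _ => inl_even M N, permAct_powMap β _ fun _ => inr_even M N]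

/-- The shuffle in `base` cancels against the conjugation in `σ` and leaves a block permutation,
which acts on the two tensor factors separately. -/
theorem permAct_base {σ : Equiv.Perm (Fin (size lam mu))} {α : Equiv.Perm (Fin (size nu mu))}
    {β : Equiv.Perm (Fin (size lam nu))}
    (hσ : σ = shuffle h h' * (places (size_add h h')).permCongr (Equiv.Perm.sumCongr α β) *
      (shuffle h h')⁻¹) :
    permAct (M.sum N) σ ∘ₗ base h h' M N
      = base h h' M N ∘ₗ tensorMap (permAct M α) (permAct N β) := by
  have h1 := congrArg (fun F => permAct (M.sum N) (shuffle h h') ∘ₗ F)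
    (join_permAct_inclusions M N (size_add h h') α β)
  rw [base, hσ, permAct_mul, permAct_mul, LinearMap.comp_assoc, LinearMap.comp_assoc,
    ← LinearMap.comp_assoc _ (permAct _ (shuffle h h')) (permAct _ (shuffle h h')⁻¹),
    permAct_inv_comp, LinearMap.id_comp, h1]
  rfl

variable {M N} in
/-- The products of elements of `Γ_Π` are alternating under the column permutations that preserve
the cells of `ν`. -/
theorem altHom_base {x : (M.pow (size nu mu)).carrier} {y : (N.pow (size lam nu)).carrier}
    (hx : x ∈ gammaPi nu mu M) (hy : y ∈ gammaPi lam nu N) {σ : Equiv.Perm (Fin (size lam mu))}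
    (hσ : σ ∈ colGroup lam mu) (hσ' : σ ∈ young (inside lam nu mu)) :
    altHom (M.sum N) _ σ (base h h' M N (tmul x y)) = base h h' M N (tmul x y) := by
  obtain ⟨α, β, hσe, hα, hβ⟩ := exists_of_mem_inside (h := h) (h' := h') hσ'
  have hα' : α ∈ colGroup nu mu := fun i => by
    have := hσ (splitPlaces h h' (.inl i))
    rw [hα] at this
    exact (colOf_inl h h' _).symm.trans (this.trans (colOf_inl h h' _))
  have hβ' : β ∈ colGroup lam nu := fun i => by
    have := hσ (splitPlaces h h' (.inr i))
    rw [hβ] at this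
    exact (colOf_inr h h' _).symm.trans (this.trans (colOf_inr h h' _))
  -- Conjugation by the shuffle does not change the sign, and the sign of a block permutation is the
  -- product of the signs of its blocks.
  have hsign : signIn k σ = signIn k α * signIn k β := by
    have : Equiv.Perm.sign σ = Equiv.Perm.sign α * Equiv.Perm.sign β := by
      rw [hσe, map_mul, map_mul, Equiv.Perm.sign_inv, mul_comm, ← mul_assoc, Int.units_mul_self,
        one_mul, Equiv.Perm.sign_permCongr, Equiv.Perm.sign_sumCongr]
    simp [signIn, this]
  have h1 := LinearMap.congr_fun (permAct_base h h' M N hσe) (tmul x y)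
  have h2 : tensorMap (permAct M α) (permAct N β) (tmul x y)
      = (signIn k α * signIn k β) • tmul x y := by
    change tmul (permAct M α x) (permAct N β y) = _
    rw [hx α hα', hy β hβ', tmul_smul_left, tmul_smul_right, smul_smul]
  rw [LinearMap.comp_apply, LinearMap.comp_apply, h2, map_smul] at h1
  rw [altHom_apply, h1, ← hsign, smul_smul, signIn_mul_self, one_smul]

variable {M N} in
-- By `altHom_base` the summand of a coset does not depend on its representative. So a column
-- permutation only permutes the summands.
theorem ast_mem_gammaPi {x : (M.pow (size nu mu)).carrier} {y : (N.pow (size lam nu)).carrier}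
    (hx : x ∈ gammaPi nu mu M) (hy : y ∈ gammaPi lam nu N) :
    ast h h' x y ∈ gammaPi lam mu (M.sum N) := by
  rw [mem_gammaPi_iff]
  intro σ hσ
  have key : ∀ τ : colGroup lam mu,
      altHom (M.sum N) _ (QuotientGroup.mk (s := splitGroup lam nu mu) τ).out.1
        (base h h' M N (tmul x y)) = altHom (M.sum N) _ τ.1 (base h h' M N (tmul x y)) := by
    intro τ
    obtain ⟨η, hη⟩ := QuotientGroup.mk_out_eq_mul (splitGroup lam nu mu) τ
    rw [hη, Subgroup.coe_mul, map_mul, Module.End.mul_apply,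
      altHom_base h h' hx hy η.1.2 (Subgroup.mem_subgroupOf.mp η.2)]
  rw [ast_eq, astMap, LinearMap.sum_apply, map_sum]
  refine Fintype.sum_equiv (MulAction.toPerm (⟨σ, hσ⟩ : colGroup lam mu)) _ _ fun q => ?_
  have hq : (⟨σ, hσ⟩ : colGroup lam mu) • q
      = QuotientGroup.mk (s := splitGroup lam nu mu) (⟨σ, hσ⟩ * q.out) := by
    conv_lhs => rw [← QuotientGroup.out_eq' q]
    rfl
  rw [MulAction.toPerm_apply, hq, LinearMap.comp_apply, LinearMap.comp_apply]
  refine Eq.trans ?_ (key _).symm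
  rw [Subgroup.coe_mul, map_mul, Module.End.mul_apply]

end Base

/-! ### Naturality of the products. -/

section Star

variable {lam nu mu : YoungDiagram} (h : mu ≤ nu) (h' : nu ≤ lam) {M M' N N' : SVec k}

/-- The map `core hd φ ψ` sees only the tensors with factors in `M` exactly at the first `e` places,
while the tensors that reach it have them at the image under `τ` of the first `e'` places. -/
theorem core_permAct_mask {e f e' d : ℕ} (hd : e + f = d)
    (φ : (M.pow e).carrier →ₗ[k] (M'.pow e).carrier)
    (ψ : (N.pow f).carrier →ₗ[k] (N'.pow f).carrier) {τ : Equiv.Perm (Fin d)}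
    (hτ : isFirst e d ≠ isFirst e' d ∘ ⇑τ⁻¹) :
    core hd φ ψ ∘ₗ permAct (M.sum N) τ ∘ₗ mask M N (isFirst e' d) = 0 := by
  rw [← core_mask hd, permAct_mask, LinearMap.comp_assoc, ← LinearMap.comp_assoc _ _ (mask M N _),
    mask_comp_ne M N hτ, LinearMap.zero_comp, LinearMap.comp_zero]

/-- The action of `φ ⋆ ψ` on tensors of the form `x ⊗ y` with `x` in `M ^ ⊗ e` and `y` in
`N ^ ⊗ f`. -/
theorem star_join {e f d : ℕ} (hd : e + f = d)
    {φ : (M.pow e).carrier →ₗ[k] (M'.pow e).carrier}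
    {ψ : (N.pow f).carrier →ₗ[k] (N'.pow f).carrier}
    (hφ : ∀ σ, permAct M' σ ∘ₗ φ = φ ∘ₗ permAct M σ)
    (hψ : ∀ σ, permAct N' σ ∘ₗ ψ = ψ ∘ₗ permAct N σ) :
    star hd φ ψ ∘ₗ (join hd (M.sum N)).toLinearMap ∘ₗ
      tensorMap (powMap fun _ => inl M N) (powMap fun _ => inr M N)
    = ((join hd (M'.sum N')).toLinearMap ∘ₗ
      tensorMap (powMap fun _ => inl M' N') (powMap fun _ => inr M' N')) ∘ₗ superTensor φ ψ := by
  have hcore : core hd φ ψ ∘ₗ (join hd (M.sum N)).toLinearMap ∘ₗ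
      tensorMap (powMap fun _ => inl M N) (powMap fun _ => inr M N)
      = ((join hd (M'.sum N')).toLinearMap ∘ₗ
        tensorMap (powMap fun _ => inl M' N') (powMap fun _ => inr M' N')) ∘ₗ
          superTensor φ ψ := by
    have e1 : extL N N' φ ∘ₗ (powMap fun _ => inl M N) = (powMap fun _ => inl M' N') ∘ₗ φ := by
      change ((powMap fun _ => inl M' N') ∘ₗ φ ∘ₗ (powMap fun _ => fst M N)) ∘ₗ _ = _
      rw [LinearMap.comp_assoc, LinearMap.comp_assoc, powMap_fst_inl, LinearMap.comp_id]
    have e2 : extR M M' ψ ∘ₗ (powMap fun _ => inr M N) = (powMap fun _ => inr M' N') ∘ₗ ψ := by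
      change ((powMap fun _ => inr M' N') ∘ₗ ψ ∘ₗ (powMap fun _ => snd M N)) ∘ₗ _ = _
      rw [LinearMap.comp_assoc, LinearMap.comp_assoc, powMap_snd_inr, LinearMap.comp_id]
    have e3 := superTensor_tensorMap (extL N N' φ) (extR M M' ψ)
      (powMap_even fun _ => inl_even M N) (powMap_even fun _ => inr_even M N)
    rw [e1, e2, ← tensorMap_superTensor _ _ _ (powMap_even fun _ => inr_even M' N')] at e3
    rw [core_apply, LinearMap.comp_assoc, LinearMap.comp_assoc, LinearMap.comp_assoc, ← e3]
    refine LinearMap.ext fun z => ?_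
    simp
  -- Only the trivial coset keeps the factors in `M` at the first `e` places. Its representative
  -- lies in the Young subgroup, commutes with `core` and cancels.
  rw [star_apply, finsum_comp, Finset.sum_eq_single (QuotientGroup.mk 1)]
  · have hmem : (QuotientGroup.mk (s := young (isFirst e d)) 1).out ∈ young (isFirst e d) := by
      obtain ⟨η, hη⟩ := QuotientGroup.mk_out_eq_mul (young (isFirst e d)) 1
      rw [hη, one_mul]
      exact η.2
    rw [← LinearMap.comp_assoc _ (core hd φ ψ), core_permAct hd hφ hψ hmem, LinearMap.comp_assoc,
      LinearMap.comp_assoc, ← LinearMap.comp_assoc _ (permAct _ _⁻¹) (permAct _ _),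
      permAct_comp_inv, LinearMap.id_comp, hcore]
  · intro q _ hq
    rw [← mask_join, LinearMap.comp_assoc]
    have h0 : core hd φ ψ ∘ₗ permAct (M.sum N) q.out⁻¹ ∘ₗ mask M N (isFirst e d) = 0 := by
      refine core_permAct_mask hd φ ψ fun heq => hq ?_
      rw [← QuotientGroup.out_eq' q]
      refine isFirst_inj (e := e) ?_
      rw [inv_inv] at heq
      funext i
      simpa using congrFun heq (q.out⁻¹ i)
    have h1 := congrArg (fun F => permAct (M'.sum N') q.out ∘ₗ F ∘ₗ
      ((join hd (M.sum N)).toLinearMap ∘ₗ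
        tensorMap (powMap fun _ => inl M N) (powMap fun _ => inr M N))) h0
    simp only [LinearMap.zero_comp, LinearMap.comp_zero] at h1
    exact h1
  · simp

/-- No permutation takes the first `e'` places to the first `e` places when `e ≠ e'`, so every coset
contributes zero. -/
theorem star_join_zero {e f e' f' d : ℕ} (hd : e + f = d) (hd' : e' + f' = d) (hne : e ≠ e')
    (φ : (M.pow e).carrier →ₗ[k] (M'.pow e).carrier)
    (ψ : (N.pow f).carrier →ₗ[k] (N'.pow f).carrier) :
    star hd φ ψ ∘ₗ (join hd' (M.sum N)).toLinearMap ∘ₗ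
      tensorMap (powMap fun _ => inl M N) (powMap fun _ => inr M N) = 0 := by
  rw [star_apply, finsum_comp]
  refine Finset.sum_eq_zero fun q _ => ?_
  rw [← mask_join, LinearMap.comp_assoc]
  have h0 := core_permAct_mask hd φ ψ (e' := e') (τ := q.out⁻¹)
    (isFirst_ne hd' hd (Ne.symm hne) _)
  have h1 := congrArg (fun F => permAct (M'.sum N') q.out ∘ₗ F ∘ₗ
    ((join hd' (M.sum N)).toLinearMap ∘ₗ
      tensorMap (powMap fun _ => inl M N) (powMap fun _ => inr M N))) h0
  simp only [LinearMap.zero_comp, LinearMap.comp_zero] at h1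
  exact h1

/-- The map `Φ` is moved past all place permutations, until it meets the tensor `x ⊗ y` in standard
position, where `star_join` and `star_join_zero` evaluate it. -/
theorem comp_astMap (Φ : ((M.sum N).pow (size lam mu)).carrier →ₗ[k]
      ((M'.sum N').pow (size lam mu)).carrier)
    (hΦ : ∀ σ, permAct (M'.sum N') σ ∘ₗ Φ = Φ ∘ₗ permAct (M.sum N) σ) :
    Φ ∘ₗ astMap h h' M N = ∑ q : colGroup lam mu ⧸ splitGroup lam nu mu,
      (altHom (M'.sum N') (size lam mu) q.out.1 : _ →ₗ[k] _) ∘ₗ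
        permAct (M'.sum N') (shuffle h h') ∘ₗ Φ ∘ₗ (join (size_add h h') (M.sum N)).toLinearMap ∘ₗ
          tensorMap (powMap fun _ => inl M N) (powMap fun _ => inr M N) := by
  rw [astMap, comp_finsum]
  refine Finset.sum_congr rfl fun q _ => LinearMap.ext fun z => ?_
  have h1 := fun σ t => LinearMap.congr_fun (hΦ σ) t
  simp only [LinearMap.comp_apply] at h1
  simp only [LinearMap.comp_apply, base, altHom_apply, map_smul, h1]

/-- The products `x ∗ y` are natural. -/
theorem star_astMap {φ : (M.pow (size nu mu)).carrier →ₗ[k] (M'.pow (size nu mu)).carrier}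
    {ψ : (N.pow (size lam nu)).carrier →ₗ[k] (N'.pow (size lam nu)).carrier}
    (hφ : ∀ σ, permAct M' σ ∘ₗ φ = φ ∘ₗ permAct M σ)
    (hψ : ∀ σ, permAct N' σ ∘ₗ ψ = ψ ∘ₗ permAct N σ) :
    star (size_add h h') φ ψ ∘ₗ astMap h h' M N = astMap h h' M' N' ∘ₗ superTensor φ ψ := by
  rw [comp_astMap h h' _ (star_permAct _ hφ hψ), star_join _ hφ hψ, astMap, finsum_comp]
  rfl

theorem star_astMap_zero {e f : ℕ} (hd : e + f = size lam mu) (hne : e ≠ size nu mu)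
    {φ : (M.pow e).carrier →ₗ[k] (M'.pow e).carrier}
    {ψ : (N.pow f).carrier →ₗ[k] (N'.pow f).carrier}
    (hφ : ∀ σ, permAct M' σ ∘ₗ φ = φ ∘ₗ permAct M σ)
    (hψ : ∀ σ, permAct N' σ ∘ₗ ψ = ψ ∘ₗ permAct N σ) :
    star hd φ ψ ∘ₗ astMap h h' M N = 0 := by
  rw [comp_astMap h h' _ (star_permAct hd hφ hψ), star_join_zero hd (size_add h h') hne]
  simp

end Star

end Products

section LeadingTerms

variable {k : Type u} [Field k]

/-! ### A dimension criterion for graded pieces. -/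

section Triangular

/-- A filtration whose graded pieces are at least as large as some spaces of the right total
dimension has these spaces as its graded pieces. -/
theorem graded_of_finrank_le {ι α : Type*} [Fintype ι] [LinearOrder α] {κ : ι → α}
    (hκ : Function.Injective κ) {V : Type*} [AddCommGroup V] [Module k V] [Module.Finite k V]
    (L : ι → Submodule k V) {W X : ι → Type*} [∀ i, AddCommGroup (W i)] [∀ i, Module k (W i)]
    [∀ i, Module.Finite k (W i)] [∀ i, AddCommGroup (X i)] [∀ i, Module k (X i)]
    (incl : ∀ i, W i →ₗ[k] X i) (hincl : ∀ i, Function.Injective (incl i))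
    (p : ∀ i, V →ₗ[k] X i) (hsurj : ∀ i w, ∃ l ∈ L i, p i l = incl i w)
    (hzero : ∀ i j, κ j < κ i → ∀ l ∈ L j, p i l = 0)
    (hdim : Module.finrank k V ≤ ∑ i, Module.finrank k (W i)) :
    ⨆ i, L i = ⊤ ∧ ∀ i, ∀ l ∈ L i, p i l = 0 → l ∈ ⨆ j : {j // κ j < κ i}, L j := by
  classical
  -- Lifting a basis of `W i` gives a linear section with values in `L i`.
  have hsec : ∀ i, ∃ s : W i →ₗ[k] V, ∀ w, s w ∈ L i ∧ p i (s w) = incl i w := by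
    intro i
    let b := Module.Free.chooseBasis k (W i)
    choose l hl1 hl2 using fun j => hsurj i (b j)
    refine ⟨b.constr k l, fun w => ⟨?_, ?_⟩⟩
    · rw [b.constr_apply]
      exact Submodule.sum_mem _ fun j _ => Submodule.smul_mem _ _ (hl1 j)
    · refine LinearMap.congr_fun (f := p i ∘ₗ b.constr k l) (b.ext fun j => ?_) w
      rw [LinearMap.comp_apply, b.constr_basis, hl2]
  choose s hsL hsp using hsec
  let S : (∀ i, W i) →ₗ[k] V := ∑ i, s i ∘ₗ LinearMap.proj i
  have hS : ∀ w, S w = ∑ i, s i (w i) := fun w => by simp [S]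
  -- If `w` has no components above `i`, then `p i` reads off the component at `i`, because it kills
  -- everything from lower indices. This triangularity makes `S` injective.
  have hlead : ∀ w i, (∀ j, κ i < κ j → w j = 0) → p i (S w) = incl i (w i) := by
    intro w i h
    rw [hS, map_sum, Finset.sum_eq_single i, hsp]
    · intro j _ hj
      rcases lt_or_gt_of_ne (hκ.ne hj) with hlt | hlt
      · exact hzero i j hlt _ (hsL j _)
      · rw [h j hlt, map_zero, map_zero]
    · simp
  have hmax : ∀ (w : ∀ i, W i) i, w i ≠ 0 →
      ∃ j, κ i ≤ κ j ∧ w j ≠ 0 ∧ p j (S w) = incl j (w j) := by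
    intro w i hi
    obtain ⟨j, hj, hjmax⟩ := (Finset.univ.filter fun j => w j ≠ 0).exists_max_image κ
      ⟨i, by simpa using hi⟩
    refine ⟨j, hjmax i (by simpa using hi), (Finset.mem_filter.mp hj).2, hlead w j fun m hm => ?_⟩
    by_contra hne
    exact absurd (hjmax m (by simpa using hne)) hm.not_ge
  have hinj : Function.Injective S := by
    rw [injective_iff_map_eq_zero]
    intro w hw
    by_contra hne
    obtain ⟨i, hi⟩ := Function.ne_iff.mp hne
    obtain ⟨j, _, hj, hpj⟩ := hmax w i hi
    rw [hw, map_zero] at hpj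
    exact hj (hincl j (by rw [← hpj, map_zero]))
  -- The dimension hypothesis enters only here: the injection `S` leaves no room in `V`.
  have hsurjS : Function.Surjective S := by
    refine (LinearMap.injective_iff_surjective_of_finrank_eq_finrank ?_).mp hinj
    exact le_antisymm (LinearMap.finrank_le_finrank_of_injective hinj)
      (hdim.trans (Module.finrank_pi_fintype k).ge)
  constructor
  · rw [eq_top_iff]
    intro v _
    obtain ⟨w, rfl⟩ := hsurjS v
    rw [hS]
    exact Submodule.sum_mem _ fun i _ => Submodule.mem_iSup_of_mem i (hsL i _)
  · intro i l hl hpl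
    obtain ⟨w, rfl⟩ := hsurjS l
    -- Otherwise let `m` be the largest index with a nonzero component, so that `m` is at or above
    -- `i`. Then `p m` detects that component. But `p m` kills `L i` if `m` is above `i`, and kills
    -- this element by assumption if `m = i`.
    have hw : ∀ j, κ i ≤ κ j → w j = 0 := by
      intro j hij
      by_contra hne
      obtain ⟨m, hjm, hm, hpm⟩ := hmax w j hne
      refine hm (hincl m ?_)
      rw [← hpm, map_zero]
      rcases (hij.trans hjm).lt_or_eq with hlt | heq
      · exact hzero m i hlt _ hl
      · obtain rfl := hκ heq
        exact hpl
    rw [hS]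
    refine Submodule.sum_mem _ fun j _ => ?_
    by_cases hj : κ j < κ i
    · exact Submodule.mem_iSup_of_mem ⟨j, hj⟩ (hsL j _)
    · rw [hw j (not_lt.mp hj), map_zero]
      exact Submodule.zero_mem _

end Triangular

/-! ### The lexicographic order on partitions. -/

section LexOrder

theorem lexLT_iff {nu xi : YoungDiagram} :
    LexLT nu xi ↔ toLex nu.rowLen < toLex xi.rowLen := Iff.rfl

theorem rowLen_injective : Function.Injective fun nu : YoungDiagram => toLex nu.rowLen := by
  intro nu xi h
  have h' : nu.rowLen = xi.rowLen := h
  refine YoungDiagram.ext (Finset.ext fun c => ?_)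
  rw [YoungDiagram.mem_cells, YoungDiagram.mem_cells]
  obtain ⟨i, j⟩ := c
  rw [YoungDiagram.mem_iff_lt_rowLen, YoungDiagram.mem_iff_lt_rowLen, h']

theorem lexLE_iff {nu xi : YoungDiagram} :
    LexLE nu xi ↔ toLex nu.rowLen ≤ toLex xi.rowLen := by
  rw [LexLE, lexLT_iff, le_iff_lt_or_eq, or_comm]
  exact or_congr_right rowLen_injective.eq_iff.symm

/-- This makes `λ` the largest of the indices, so that `L_λ` contains every `L_ξ`. -/
theorem lexLE_of_le {nu xi : YoungDiagram} (h : nu ≤ xi) : LexLE nu xi := by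
  refine lexLE_iff.mpr (Pi.toLex_monotone fun i => ?_)
  by_contra! hlt
  exact lt_irrefl _ (YoungDiagram.mem_iff_lt_rowLen.mp
    (h (YoungDiagram.mem_iff_lt_rowLen.mpr hlt)))

end LexOrder

/-! ### Leading terms with respect to the cells occupied by `M`. -/

section Leading

variable {lam nu xi mu : YoungDiagram}

/-- The word with letter `0` at the places in `ν` and letter `1` at the other places. -/
def indicator (lam nu mu : YoungDiagram) (i : Fin (size lam mu)) : Fin 2 :=
  if inside lam nu mu i then 0 else 1

/-- As `ν` is a Young diagram, its cells are on top in each column of `λ / μ`. -/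
theorem indicator_sorted : SortedIn (colOf lam mu) (rowWt lam mu) (indicator lam nu mu) := by
  intro i j hc hr
  by_cases hj : inside lam nu mu j = true
  · have hi : inside lam nu mu i = true := by
      have hr' : rowOf lam mu i < rowOf lam mu j := by simpa [rowWt] using hr
      rw [inside, decide_eq_true_eq] at hj ⊢
      exact nu.up_left_mem hr'.le hc.le hj
    simp [indicator, hi, hj]
  · simp only [indicator, hj, if_false, Bool.false_eq_true]
    split_ifs <;> simp

theorem indicator_comp {τ : Equiv.Perm (Fin (size lam mu))}
    (h : inside lam xi mu = inside lam nu mu ∘ ⇑τ) :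
    indicator lam xi mu = indicator lam nu mu ∘ ⇑τ := by
  funext i
  rw [indicator, h]
  rfl

/-- The row permutation does not affect the row weight of the indicator word, so the column
permutation preserves it as well. By the equality case of the rearrangement inequality the column
permutation fixes the indicator word, and then so does the row permutation. -/
theorem mem_young_of_inside_eq {ρ σ : Equiv.Perm (Fin (size lam mu))} (hρ : ρ ∈ rowPerms lam mu)
    (hσ : σ ∈ colGroup lam mu) (h : inside lam nu mu = inside lam nu mu ∘ ⇑(ρ * σ)⁻¹) :
    σ ∈ young (inside lam nu mu) ∧ ρ ∈ young (inside lam nu mu) := by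
  have h1 := indicator_comp h
  rw [mul_inv_rev, Equiv.Perm.coe_mul, ← Function.comp_assoc] at h1
  have h2 := congrArg (wt (rowWt lam mu)) h1
  rw [wt_comp_of_invariant fun i => congrArg Nat.cast (inv_mem hρ i)] at h2
  have h3 := indicator_sorted.eq_of_wt_comp_eq rowWt_inj (inv_mem hσ) h2.symm
  have h4 : ∀ i, inside lam nu mu (σ⁻¹ i) = inside lam nu mu i := by
    intro i
    have := congrFun h3 i
    simp only [Function.comp_apply, indicator] at this
    cases h5 : inside lam nu mu (σ⁻¹ i) <;> cases h6 : inside lam nu mu i <;>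
      rw [h5, h6] at this <;> first | rfl | exact absurd this (by decide)
  have hσ' : σ ∈ young (inside lam nu mu) := by
    have : σ⁻¹ ∈ young (inside lam nu mu) := h4
    simpa using inv_mem this
  refine ⟨hσ', ?_⟩
  have h5 : (ρ * σ)⁻¹ ∈ young (inside lam nu mu) := fun i => (congrFun h i).symm
  simpa using mul_mem (inv_mem h5) (inv_mem hσ')

/-- Consider the rows up to the first in which `ν` and `ξ` differ. A column permutation cannot
increase the number of places there that are occupied by cells of `ν`, since these are already on
top. A row permutation keeps this number, and `ξ` needs a larger one. -/
theorem inside_ne_of_lexLT (hxi' : xi ≤ lam) (hmu : mu ≤ nu) (hlex : LexLT nu xi)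
    {ρ σ : Equiv.Perm (Fin (size lam mu))} (hρ : ρ ∈ rowPerms lam mu)
    (hσ : σ ∈ colGroup lam mu) : inside lam xi mu ≠ inside lam nu mu ∘ ⇑(ρ * σ)⁻¹ := by
  intro h
  obtain ⟨r, heq, hlt⟩ := hlex
  have h1 := indicator_comp h
  rw [mul_inv_rev, Equiv.Perm.coe_mul, ← Function.comp_assoc] at h1
  -- With this weight the indicator word of a partition has minus the number of places outside it in
  -- the rows up to `r`. The weight is monotone down the columns but not injective, which is why
  -- `SortedIn.wt_comp_le_of_monotone` is needed.
  let v : Fin (size lam mu) → ℤ := fun i => if rowOf lam mu i ≤ r then -1 else 0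
  have h2 : wt v (indicator lam xi mu) = wt v (indicator lam nu mu ∘ ⇑σ⁻¹) := by
    rw [h1, wt_comp_of_invariant fun i => ?_]
    have : rowOf lam mu (ρ⁻¹ i) = rowOf lam mu i := inv_mem hρ i
    simp only [v, this]
  have h3 : wt v (indicator lam nu mu ∘ ⇑σ⁻¹) ≤ wt v (indicator lam nu mu) := by
    refine indicator_sorted.wt_comp_le_of_monotone rowWt_inj (fun i j _ hr => ?_) (inv_mem hσ)
    have : rowOf lam mu i ≤ rowOf lam mu j := by simpa [rowWt] using hr
    simp only [v]
    split_ifs <;> omega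
  have hle : ∀ s ≤ r, nu.rowLen s ≤ xi.rowLen s := fun s hs => by
    rcases hs.lt_or_eq with hs | rfl
    · exact (heq s hs).le
    · exact hlt.le
  -- The first cell after `ν` in row `r` belongs to `ξ`. It makes the comparison of the two weights
  -- strict.
  obtain ⟨i, hi1, hi2⟩ := exists_place (lam := lam) (mu := mu) (r := r) (c := nu.rowLen r)
    (hxi' (YoungDiagram.mem_iff_lt_rowLen.mpr hlt))
    fun hm => lt_irrefl _ (YoungDiagram.mem_iff_lt_rowLen.mp (hmu hm))
  have h4 : wt v (indicator lam nu mu) < wt v (indicator lam xi mu) := by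
    have hcell : ∀ j, (colCell lam mu j).1 = (rowOf lam mu j, colOf lam mu j) := fun j => rfl
    refine Finset.sum_lt_sum (fun j _ => ?_) ⟨i, Finset.mem_univ _, ?_⟩
    · by_cases hj : rowOf lam mu j ≤ r
      · have himp : inside lam nu mu j = true → inside lam xi mu j = true := by
          rw [inside, inside, decide_eq_true_eq, decide_eq_true_eq, hcell,
            YoungDiagram.mem_iff_lt_rowLen, YoungDiagram.mem_iff_lt_rowLen]
          exact fun hh => hh.trans_le (hle _ hj)
        simp only [v, if_pos hj, indicator]
        cases h5 : inside lam nu mu j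
        · cases inside lam xi mu j <;> simp
        · simp [himp h5]
      · simp [v, hj]
    · have h5 : inside lam nu mu i = false := by
        rw [inside, decide_eq_false_iff_not, hcell, hi1, hi2, YoungDiagram.mem_iff_lt_rowLen]
        exact lt_irrefl _
      have h6 : inside lam xi mu i = true := by
        rw [inside, decide_eq_true_eq, hcell, hi1, hi2, YoungDiagram.mem_iff_lt_rowLen]
        exact hlt
      simp [v, hi1, indicator, h5, h6]
  omega

variable [NeZero (2 : k)] (h : mu ≤ xi) (h' : xi ≤ lam) (M N : SVec k)

/-- The component of a tensor with factors in `M` at the cells of `ξ / μ` and factors in `N` at the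
cells of `λ / ξ`, mapped to the symmetric powers. -/
def component : ((M.sum N).pow (size lam mu)).carrier →ₗ[k]
    ((symPow xi mu M).tensor (symPow lam xi N)).carrier :=
  tensorMap (theta xi mu M) (theta lam xi N) ∘ₗ
    tensorMap (powMap fun _ => fst M N) (powMap fun _ => snd M N) ∘ₗ
      (join (size_add h h') (M.sum N)).symm.toLinearMap ∘ₗ permAct (M.sum N) (shuffle h h')⁻¹

theorem component_base :
    component h h' M N ∘ₗ base h h' M N = tensorMap (theta xi mu M) (theta lam xi N) := by
  refine LinearMap.ext fun z => ?_
  have h1 := LinearMap.congr_fun (permAct_inv_comp (M.sum N) (shuffle h h'))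
    (join (size_add h h') (M.sum N)
      (tensorMap (powMap fun _ => inl M N) (powMap fun _ => inr M N) z))
  have h2 := LinearMap.congr_fun (tensorMap_comp (powMap fun _ => fst M N)
    (powMap fun _ => snd M N) (powMap fun _ => inl M N) (powMap fun _ => inr M N)) z
  rw [powMap_fst_inl, powMap_snd_inr] at h2
  simp only [LinearMap.comp_apply, LinearMap.id_apply] at h1 h2
  simp only [component, base, LinearMap.comp_apply, LinearEquiv.coe_coe, h1,
    LinearEquiv.symm_apply_apply, h2]
  exact congrArg _ (LinearMap.congr_fun TensorProduct.map_id z)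

/-- The projections `fst` and `snd` in `component` already annihilate every tensor whose factors in
`M` are not exactly at the cells of `ξ / μ`. -/
theorem component_mask :
    component h h' M N ∘ₗ mask M N (inside lam xi mu) = component h h' M N := by
  have h1 : inside lam xi mu ∘ ⇑(shuffle h h')⁻¹⁻¹ = isFirst (size xi mu) (size lam mu) := by
    rw [inv_inv, inside_comp_shuffle]
  have h2 : (powMap fun _ : Fin (size xi mu) => fst M N) ∘ₗ (powMap fun _ => inl M N ∘ₗ fst M N)
      = powMap fun _ => fst M N := powMap_comp _ _
  have h3 : (powMap fun _ : Fin (size lam xi) => snd M N) ∘ₗ (powMap fun _ => inr M N ∘ₗ snd M N)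
      = powMap fun _ => snd M N := powMap_comp _ _
  have h6 := tensorMap_comp (powMap fun _ : Fin (size xi mu) => fst M N)
    (powMap fun _ : Fin (size lam xi) => snd M N) (powMap fun _ => inl M N ∘ₗ fst M N)
    (powMap fun _ => inr M N ∘ₗ snd M N)
  rw [h2, h3] at h6
  have h4 : (join (size_add h h') (M.sum N)).symm.toLinearMap ∘ₗ
      mask M N (isFirst (size xi mu) (size lam mu))
      = tensorMap (powMap fun _ => inl M N ∘ₗ fst M N) (powMap fun _ => inr M N ∘ₗ snd M N) ∘ₗ
        (join (size_add h h') (M.sum N)).symm.toLinearMap := by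
    refine LinearMap.ext fun z => ?_
    obtain ⟨y, rfl⟩ := (join (size_add h h') (M.sum N)).surjective z
    have := LinearMap.congr_fun (join_tensorMap (size_add h h') M N) y
    simp only [LinearMap.comp_apply, LinearEquiv.coe_coe, LinearEquiv.symm_apply_apply] at this ⊢
    rw [← this, LinearEquiv.symm_apply_apply]
  rw [component, LinearMap.comp_assoc, LinearMap.comp_assoc, LinearMap.comp_assoc, permAct_mask,
    h1, ← LinearMap.comp_assoc _ (mask M N _), h4, LinearMap.comp_assoc,
    ← LinearMap.comp_assoc _ (tensorMap (powMap fun _ => inl M N ∘ₗ fst M N) _), h6]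

/-- Such a permutation is a pair of row permutations of `ξ / μ` and `λ / ξ`, and these are absorbed
by the two maps `θ`. -/
theorem component_permAct {σ : Equiv.Perm (Fin (size lam mu))} (hσ : σ ∈ rowPerms lam mu)
    (hσ' : σ ∈ young (inside lam xi mu)) :
    component h h' M N ∘ₗ permAct (M.sum N) σ = component h h' M N := by
  obtain ⟨α, β, hσe, hα, hβ⟩ := exists_of_mem_inside (h := h) (h' := h') hσ'
  have hα' : α ∈ rowPerms xi mu := fun i => by
    have := hσ (splitPlaces h h' (.inl i))
    rw [hα] at this
    exact (rowOf_inl h h' _).symm.trans (this.trans (rowOf_inl h h' _))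
  have hβ' : β ∈ rowPerms lam xi := fun i => by
    have := hσ (splitPlaces h h' (.inr i))
    rw [hβ] at this
    exact (rowOf_inr h h' _).symm.trans (this.trans (rowOf_inr h h' _))
  have h1 : theta xi mu M ∘ₗ (powMap fun _ => fst M N) ∘ₗ permAct (M.sum N) α
      = theta xi mu M ∘ₗ powMap fun _ => fst M N := by
    rw [← permAct_powMap α (fun _ => fst M N) fun _ => fst_even M N]
    exact LinearMap.ext fun t => theta_permAct M hα' _
  have h2 : theta lam xi N ∘ₗ (powMap fun _ => snd M N) ∘ₗ permAct (M.sum N) β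
      = theta lam xi N ∘ₗ powMap fun _ => snd M N := by
    rw [← permAct_powMap β (fun _ => snd M N) fun _ => snd_even M N]
    exact LinearMap.ext fun t => theta_permAct N hβ' _
  have h4 : (join (size_add h h') (M.sum N)).symm.toLinearMap ∘ₗ permAct (M.sum N)
      ((places (size_add h h')).permCongr (Equiv.Perm.sumCongr α β))
      = tensorMap (permAct (M.sum N) α) (permAct (M.sum N) β) ∘ₗ
        (join (size_add h h') (M.sum N)).symm.toLinearMap := by
    refine LinearMap.ext fun z => ?_
    obtain ⟨y, rfl⟩ := (join (size_add h h') (M.sum N)).surjective z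
    have := LinearMap.congr_fun (join_permAct (size_add h h') (M.sum N) α β) y
    rw [superTensor_eq_tensorMap _ (permAct_even _ β)] at this
    simp only [LinearMap.comp_apply, LinearEquiv.coe_coe, LinearEquiv.symm_apply_apply] at this ⊢
    rw [← this, LinearEquiv.symm_apply_apply]
  have h5 : (shuffle h h')⁻¹ * σ = (places (size_add h h')).permCongr (Equiv.Perm.sumCongr α β) *
      (shuffle h h')⁻¹ := by
    rw [hσe]; group
  rw [component, LinearMap.comp_assoc, LinearMap.comp_assoc, LinearMap.comp_assoc, ← permAct_mul,
    h5, permAct_mul, ← LinearMap.comp_assoc _ (permAct _ _) (LinearEquiv.toLinearMap _), h4,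
    LinearMap.comp_assoc, ← LinearMap.comp_assoc, tensorMap_comp, ← LinearMap.comp_assoc,
    tensorMap_comp, LinearMap.comp_assoc, h1, LinearMap.comp_assoc, h2, ← tensorMap_comp]
  simp only [LinearMap.comp_assoc]

variable {M N} in
/-- The component at `ξ` of a permuted product at `ν` vanishes if the places do not match. -/
theorem inside_eq_of_component_ne_zero (hnu : mu ≤ nu) (hnu' : nu ≤ lam)
    {τ : Equiv.Perm (Fin (size lam mu))}
    {z : ((M.pow (size nu mu)).tensor (N.pow (size lam nu))).carrier}
    (hz : component h h' M N (permAct (M.sum N) τ (base hnu hnu' M N z)) ≠ 0) :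
    inside lam xi mu = inside lam nu mu ∘ ⇑τ⁻¹ := by
  by_contra hne
  refine hz ?_
  have h1 := LinearMap.congr_fun (mask_base hnu hnu' M N) z
  have h2 := LinearMap.congr_fun (permAct_mask M N (inside lam nu mu) τ) (base hnu hnu' M N z)
  have h3 := LinearMap.congr_fun (mask_comp_ne M N hne)
    (permAct (M.sum N) τ (base hnu hnu' M N z))
  simp only [LinearMap.comp_apply] at h1 h2 h3
  rw [← component_mask, LinearMap.comp_apply, ← h1, h2, h3, LinearMap.zero_apply, map_zero]

/-- The span of the tensors `x ⊗ y` with `x` in `Γ_Π^{ν' / μ'} (M)` and `y` in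
`Γ_Π^{λ' / ν'} (N)`. -/
def gammaTensor (lam nu mu : YoungDiagram) (M N : SVec k) :
    Submodule k ((M.pow (size nu mu)).tensor (N.pow (size lam nu))).carrier :=
  Submodule.span k {t | ∃ x ∈ gammaPi nu mu M, ∃ y ∈ gammaPi lam nu N, t = tmul x y}

/-- The leading term of elements of `S^{λ / μ} (M ⊕ N)` at `ξ`. -/
theorem exists_leading :
    ∃ P : (symPow lam mu (M.sum N)).carrier →ₗ[k]
        ((symPow xi mu M).tensor (symPow lam xi N)).carrier,
      (∀ z ∈ gammaTensor lam xi mu M N, P (theta lam mu (M.sum N) (astMap h h' M N z))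
        = tensorMap (theta xi mu M) (theta lam xi N) z) ∧
      ∀ (nu : YoungDiagram) (hnu : mu ≤ nu) (hnu' : nu ≤ lam), LexLT nu xi →
        ∀ z, P (theta lam mu (M.sum N) (astMap hnu hnu' M N z)) = 0 := by
  -- Row invariance makes `F` factor through `θ`. The factor is the leading term `P`.
  set F := orbSum (dualHom (M.sum N) (size lam mu) _) (rowPerms lam mu) (component h h' M N)
    with hFdef
  obtain ⟨P, hP⟩ := exists_theta_factor F fun σ hσ => orbSum_invariant _ _ _ hσ
  have hF0 : ∀ t, F t ≠ 0 → ∃ ρ ∈ rowPerms lam mu,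
      component h h' M N (permAct (M.sum N) ρ t) ≠ 0 := by
    intro t ht
    by_contra! hno
    refine ht (map_orbSum_eq_zero _ _ _ (LinearMap.applyₗ t) fun σ hσ => ?_)
    exact hno _ (inv_mem hσ)
  have hF1 : ∀ (nu : YoungDiagram) (hnu : mu ≤ nu) (hnu' : nu ≤ lam) (σ) (_ : σ ∈ colGroup lam mu)
      (z), F (altHom (M.sum N) _ σ (base hnu hnu' M N z)) ≠ 0 →
        ∃ ρ ∈ rowPerms lam mu, inside lam xi mu = inside lam nu mu ∘ ⇑(ρ * σ)⁻¹ := by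
    intro nu hnu hnu' σ hσ z hne
    obtain ⟨ρ, hρ, hne⟩ := hF0 _ hne
    rw [altHom_apply, map_smul, map_smul, ← LinearMap.comp_apply (permAct _ ρ),
      ← permAct_mul] at hne
    exact ⟨ρ, hρ, inside_eq_of_component_ne_zero h h' hnu hnu' (right_ne_zero_of_smul hne)⟩
  refine ⟨P, fun z hz => ?_, fun nu hnu hnu' hlex z => ?_⟩
  · suffices hsuff : gammaTensor lam xi mu M N ≤ LinearMap.eqLocus
        (P ∘ₗ theta lam mu (M.sum N) ∘ₗ astMap h h' M N)
        (tensorMap (theta xi mu M) (theta lam xi N)) from hsuff hz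
    refine Submodule.span_le.mpr ?_
    rintro _ ⟨x, hx, y, hy, rfl⟩
    change P (theta lam mu (M.sum N) (astMap h h' M N (tmul x y))) = _
    have hmem : (QuotientGroup.mk (s := splitGroup lam xi mu) 1).out
        ∈ splitGroup lam xi mu := by
      obtain ⟨η, hη⟩ := QuotientGroup.mk_out_eq_mul (splitGroup lam xi mu) 1
      rw [hη, one_mul]
      exact η.2
    -- A coset contributes only if its column permutation, followed by some row permutation,
    -- preserves the cells of `ξ`. By `mem_young_of_inside_eq` it is then the trivial coset, whose
    -- representative fixes the tensor.
    rw [hP, astMap, LinearMap.sum_apply, map_sum, Finset.sum_eq_single (QuotientGroup.mk 1)]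
    · rw [LinearMap.comp_apply, altHom_base h h' hx hy (Subtype.property _)
        (Subgroup.mem_subgroupOf.mp hmem)]
      -- In the row orbit of `component`, a term that does not vanish on this tensor comes from a
      -- row permutation that preserves the cells of `ξ`. By `component_permAct` the term is
      -- `component` itself, counted once.
      refine (map_orbSum_eq (dualHom (M.sum N) (size lam mu) _) (rowPerms lam mu)
        (component h h' M N) (LinearMap.applyₗ (base h h' M N (tmul x y)))
        fun σ hσ hne => ?_).trans (LinearMap.congr_fun (component_base h h' M N) _)
      have h1 := inside_eq_of_component_ne_zero h h' h h' hne
      rw [← mul_one σ⁻¹] at h1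
      exact component_permAct h h' M N (inv_mem hσ)
        (mem_young_of_inside_eq (inv_mem hσ) (one_mem _) h1).2
    · intro q _ hq
      by_contra hne
      obtain ⟨ρ, hρ, hin⟩ := hF1 xi h h' _ q.out.2 _ hne
      refine hq ?_
      rw [← QuotientGroup.out_eq' q, QuotientGroup.eq, mul_one]
      exact inv_mem (Subgroup.mem_subgroupOf.mpr (mem_young_of_inside_eq hρ q.out.2 hin).1)
    · simp
  · rw [hP, astMap, LinearMap.sum_apply, map_sum]
    refine Finset.sum_eq_zero fun q _ => ?_
    by_contra hne
    obtain ⟨ρ, hρ, hin⟩ := hF1 nu hnu hnu' _ q.out.2 _ hne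
    exact inside_ne_of_lexLT h' hnu hlex hρ q.out.2 hin

end Leading

end LeadingTerms

section Images

variable {k : Type u} [Field k]

/-! ### Tensors of alternating tensors and their images. -/

section GammaTensor

variable {lam nu xi mu : YoungDiagram} {M N M' N' : SVec k}

theorem superTensor_tmul_eq_sum {U U' W W' : SVec k} (f : U.carrier →ₗ[k] U'.carrier)
    (g : W.carrier →ₗ[k] W'.carrier) (x : U.carrier) (y : W.carrier) :
    superTensor f g (tmul x y) = ∑ p, tmul (f (U.proj p x)) (twist p g y) := by
  change (∑ p : ZMod 2, TensorProduct.map (f ∘ₗ U.proj p) (twist p g)) (x ⊗ₜ[k] y) = _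
  rw [LinearMap.sum_apply]
  rfl

theorem map_mem_gammaPi {φ : (M.pow (size lam mu)).carrier →ₗ[k] (M'.pow (size lam mu)).carrier}
    (hφ : ∀ σ, permAct M' σ ∘ₗ φ = φ ∘ₗ permAct M σ) {x : (M.pow (size lam mu)).carrier}
    (hx : x ∈ gammaPi lam mu M) : φ x ∈ gammaPi lam mu M' := fun σ hσ => by
  rw [← LinearMap.comp_apply, hφ, LinearMap.comp_apply, hx σ hσ, map_smul]

theorem tmul_mem_gammaTensor {x : (M.pow (size nu mu)).carrier} {y : (N.pow (size lam nu)).carrier}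
    (hx : x ∈ gammaPi nu mu M) (hy : y ∈ gammaPi lam nu N) :
    tmul x y ∈ gammaTensor lam nu mu M N :=
  Submodule.subset_span ⟨x, hx, y, hy, rfl⟩

variable [NeZero (2 : k)]

theorem gammaTensor_γ : ∀ z ∈ gammaTensor lam nu mu M N,
    ((M.pow (size nu mu)).tensor (N.pow (size lam nu))).γ z ∈ gammaTensor lam nu mu M N := by
  suffices h : gammaTensor lam nu mu M N ≤ (gammaTensor lam nu mu M N).comap
      ((M.pow (size nu mu)).tensor (N.pow (size lam nu))).γ from h
  refine Submodule.span_le.mpr ?_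
  rintro _ ⟨x, hx, y, hy, rfl⟩
  exact tmul_mem_gammaTensor (gammaPi_γ _ _ _ _ hx) (gammaPi_γ _ _ _ _ hy)

theorem superTensor_mem_gammaTensor
    {φ : (M.pow (size nu mu)).carrier →ₗ[k] (M'.pow (size nu mu)).carrier}
    {ψ : (N.pow (size lam nu)).carrier →ₗ[k] (N'.pow (size lam nu)).carrier}
    (hφ : ∀ σ, permAct M' σ ∘ₗ φ = φ ∘ₗ permAct M σ)
    (hψ : ∀ σ, permAct N' σ ∘ₗ ψ = ψ ∘ₗ permAct N σ) :
    ∀ z ∈ gammaTensor lam nu mu M N, superTensor φ ψ z ∈ gammaTensor lam nu mu M' N' := by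
  suffices h : gammaTensor lam nu mu M N ≤ (gammaTensor lam nu mu M' N').comap
      (superTensor φ ψ) from h
  refine Submodule.span_le.mpr ?_
  rintro _ ⟨x, hx, y, hy, rfl⟩
  change superTensor φ ψ (tmul x y) ∈ gammaTensor lam nu mu M' N'
  rw [superTensor_tmul_eq_sum]
  refine Submodule.sum_mem _ fun p _ => tmul_mem_gammaTensor (map_mem_gammaPi hφ ?_) ?_
  -- The homogeneous projection of `x` is a combination of `x` and `γ x`, and the twist of `ψ` is a
  -- conjugate by `γ`. So both stay within the alternating tensors.
  · exact Submodule.smul_mem _ _ (Submodule.add_mem _ hx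
      (Submodule.smul_mem _ _ (gammaPi_γ _ _ _ _ hx)))
  · rcases zmod2_cases p with rfl | rfl
    · exact map_mem_gammaPi hψ hy
    · exact gammaPi_γ _ _ _ _ (map_mem_gammaPi hψ (gammaPi_γ _ _ _ _ hy))

/-- The inclusion of `Ŝ_{ξ / μ} (M) ⊗ Ŝ_{λ / ξ} (N)` in `S^{ξ / μ} (M) ⊗ S^{λ / ξ} (N)`. -/
def boxIncl (lam xi mu : YoungDiagram) (M N : SVec k) :
    ((schurSpace xi mu M).tensor (schurSpace lam xi N)).carrier →ₗ[k]
      ((symPow xi mu M).tensor (symPow lam xi N)).carrier :=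
  tensorMap (schurIncl xi mu M) (schurIncl lam xi N)

theorem boxIncl_injective : Function.Injective (boxIncl lam xi mu M N) :=
  TensorProduct.map_injective_of_flat_flat _ _ (Submodule.subtype_injective _)
    (Submodule.subtype_injective _)

/-- Both sides are spanned by the tensors `θ x ⊗ θ y`. So the leading terms of the products at `ξ`
fill exactly the tensor product of the two Schur spaces. -/
theorem gammaTensor_map : (gammaTensor lam xi mu M N).map
    (tensorMap (theta xi mu M) (theta lam xi N)) = LinearMap.range (boxIncl lam xi mu M N) := by
  apply le_antisymm
  · rw [Submodule.map_le_iff_le_comap]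
    refine Submodule.span_le.mpr ?_
    rintro _ ⟨x, hx, y, hy, rfl⟩
    let a : (schurSpace xi mu M).carrier := ⟨theta xi mu M x, x, hx, rfl⟩
    let b : (schurSpace lam xi N).carrier := ⟨theta lam xi N y, y, hy, rfl⟩
    exact ⟨tmul a b, rfl⟩
  · rintro _ ⟨w, rfl⟩
    refine TensorProduct.induction_on (R := k) (M := (schurSpace xi mu M).carrier)
      (N := (schurSpace lam xi N).carrier) (motive := fun w => boxIncl lam xi mu M N w ∈ _) w
      ?_ ?_ ?_
    · exact Eq.substr (map_zero (boxIncl lam xi mu M N)) (Submodule.zero_mem _)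
    · rintro ⟨_, x, hx, rfl⟩ ⟨_, y, hy, rfl⟩
      exact ⟨tmul x y, tmul_mem_gammaTensor hx hy, rfl⟩
    · intro v w hv hw
      exact Eq.substr (map_add (boxIncl lam xi mu M N) v w) (Submodule.add_mem _ hv hw)

end GammaTensor

/-! ### Stability of the products under `γ` and under morphisms. -/

section Product

variable [NeZero (2 : k)] {lam nu mu : YoungDiagram} (h : mu ≤ nu) (h' : nu ≤ lam)
  {M N M' N' : SVec k}

theorem astMap_γ (z : ((M.pow (size nu mu)).tensor (N.pow (size lam nu))).carrier) :
    ((M.sum N).pow (size lam mu)).γ (astMap h h' M N z) = astMap h h' M N (SVec.γ _ z) := by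
  have h1 : HasParity (V := M.pow (size nu mu)) (W := (M.sum N).pow (size nu mu)) 0
    (powMap fun _ => inl M N) := powMap_even fun _ => inl_even M N
  have h2 : HasParity (V := N.pow (size lam nu)) (W := (M.sum N).pow (size lam nu)) 0
    (powMap fun _ => inr M N) := powMap_even fun _ => inr_even M N
  have h3 : tensorMap (powMap fun _ => inl M N) (powMap fun _ => inr M N) (SVec.γ _ z)
      = SVec.γ _ (tensorMap (powMap fun _ => inl M N) (powMap fun _ => inr M N) z) := by
    rw [← superTensor_eq_tensorMap _ h2]
    exact (parity_zero_iff.mp (by simpa using superTensor_parity h1 h2) z).symm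
  simp only [astMap, base, LinearMap.sum_apply, LinearMap.comp_apply, map_sum, altHom_apply,
    map_smul, parity_zero_iff.mp (permAct_even _ _), h3, LinearEquiv.coe_coe, join_γ]

theorem Kimage_eq : Kimage h h' M N = (gammaTensor lam nu mu M N).map (astMap h h' M N) := by
  rw [Kimage, gammaTensor, Submodule.map_span]
  congr 1
  ext t
  constructor
  · rintro ⟨x, hx, y, hy, rfl⟩
    exact ⟨_, ⟨x, hx, y, hy, rfl⟩, (ast_eq h h' M N x y).symm⟩
  · rintro ⟨_, ⟨x, hx, y, hy, rfl⟩, rfl⟩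
    exact ⟨x, hx, y, hy, (ast_eq h h' M N x y).symm⟩

/-- Either the bidegree of the morphism is that of the product and `star_astMap` applies, or the
morphism kills the product. In both cases the partition `ν` is unchanged, which is why the `L_ξ` are
subfunctors. -/
theorem exists_star_astMap {e f : ℕ} (hd : e + f = size lam mu)
    {φ : (M.pow e).carrier →ₗ[k] (M'.pow e).carrier}
    {ψ : (N.pow f).carrier →ₗ[k] (N'.pow f).carrier}
    (hφ : ∀ σ, permAct M' σ ∘ₗ φ = φ ∘ₗ permAct M σ)
    (hψ : ∀ σ, permAct N' σ ∘ₗ ψ = ψ ∘ₗ permAct N σ)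
    {z : ((M.pow (size nu mu)).tensor (N.pow (size lam nu))).carrier}
    (hz : z ∈ gammaTensor lam nu mu M N) : ∃ z' ∈ gammaTensor lam nu mu M' N',
      star hd φ ψ (astMap h h' M N z) = astMap h h' M' N' z' := by
  by_cases he : e = size nu mu
  · subst he
    obtain rfl : f = size lam nu := by have := size_add h h'; omega
    exact ⟨_, superTensor_mem_gammaTensor hφ hψ z hz,
      LinearMap.congr_fun (star_astMap h h' hφ hψ) z⟩
  · refine ⟨0, Submodule.zero_mem _, ?_⟩
    rw [map_zero]
    exact LinearMap.congr_fun (star_astMap_zero h h' hd he hφ hψ) z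

end Product

/-! ### The subspaces `L_ξ`. -/

section Lspace

variable [NeZero (2 : k)] {lam xi nu mu : YoungDiagram} {M N M' N' : SVec k}

/-- The properties of `L_ξ` that follow define subspaces, so this reduces them to images of
products. -/
theorem Lspace_le_iff {S : Submodule k (symPow lam mu (M.sum N)).carrier} :
    Lspace lam mu xi M N ≤ S ↔ ∀ (nu : YoungDiagram) (h : mu ≤ nu) (h' : nu ≤ lam), LexLE nu xi →
      ∀ z ∈ gammaTensor lam nu mu M N, theta lam mu (M.sum N) (astMap h h' M N z) ∈ S := by
  simp only [Lspace, Kspace, Submodule.map_le_iff_le_comap, iSup_le_iff, Kimage_eq]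
  rfl

theorem theta_astMap_mem_Lspace (h : mu ≤ nu) (h' : nu ≤ lam) (hle : LexLE nu xi)
    {z : ((M.pow (size nu mu)).tensor (N.pow (size lam nu))).carrier}
    (hz : z ∈ gammaTensor lam nu mu M N) :
    theta lam mu (M.sum N) (astMap h h' M N z) ∈ Lspace lam mu xi M N :=
  Lspace_le_iff.mp le_rfl nu h h' hle z hz

theorem Lspace_mono (hle : LexLE nu xi) : Lspace lam mu nu M N ≤ Lspace lam mu xi M N :=
  Lspace_le_iff.mpr fun _ h h' hr _ hz => theta_astMap_mem_Lspace h h'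
    (lexLE_iff.mpr ((lexLE_iff.mp hr).trans (lexLE_iff.mp hle))) hz

theorem Lspace_le_schurSub : Lspace lam mu xi M N ≤ schurSub lam mu (M.sum N) := by
  refine Lspace_le_iff.mpr fun nu h h' _ z hz => Submodule.mem_map_of_mem ?_
  suffices hs : gammaTensor lam nu mu M N ≤ (gammaPi lam mu (M.sum N)).comap (astMap h h' M N)
    from hs hz
  refine Submodule.span_le.mpr ?_
  rintro _ ⟨x, hx, y, hy, rfl⟩
  change astMap h h' M N (tmul x y) ∈ gammaPi lam mu (M.sum N)
  rw [← ast_eq]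
  exact ast_mem_gammaPi h h' hx hy

theorem Lspace_γ : ∀ x ∈ Lspace lam mu xi M N,
    (symPow lam mu (M.sum N)).γ x ∈ Lspace lam mu xi M N := by
  suffices hs : Lspace lam mu xi M N ≤ (Lspace lam mu xi M N).comap
      (symPow lam mu (M.sum N)).γ from hs
  refine Lspace_le_iff.mpr fun nu h h' hle z hz => ?_
  rw [Submodule.mem_comap, theta_γ, astMap_γ]
  exact theta_astMap_mem_Lspace h h' hle (gammaTensor_γ z hz)

theorem map_mem_Lspace {e f : ℕ} (hd : e + f = size lam mu)
    {φ : (M.pow e).carrier →ₗ[k] (M'.pow e).carrier}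
    {ψ : (N.pow f).carrier →ₗ[k] (N'.pow f).carrier}
    (hφ : ∀ σ, permAct M' σ ∘ₗ φ = φ ∘ₗ permAct M σ)
    (hψ : ∀ σ, permAct N' σ ∘ₗ ψ = ψ ∘ₗ permAct N σ)
    {F : (symPow lam mu (M.sum N)).carrier →ₗ[k] (symPow lam mu (M'.sum N')).carrier}
    (hF : ∀ t, F (theta lam mu (M.sum N) t) = theta lam mu (M'.sum N') (star hd φ ψ t)) :
    ∀ x ∈ Lspace lam mu xi M N, F x ∈ Lspace lam mu xi M' N' := by
  suffices hs : Lspace lam mu xi M N ≤ (Lspace lam mu xi M' N').comap F from hs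
  refine Lspace_le_iff.mpr fun nu h h' hle z hz => ?_
  obtain ⟨z', hz', heq⟩ := exists_star_astMap h h' hd hφ hψ hz
  rw [Submodule.mem_comap, hF, heq]
  exact theta_astMap_mem_Lspace h h' hle hz'

end Lspace

end Images

section Grading

variable {k : Type u} [Field k]

/-- This is the first isomorphism theorem with the image identified through `i`. As `i` is
injective, the equation determines the equivalence, so its evenness and naturality can be checked on
`f`. -/
theorem exists_quotient_equiv {A X W : Type*} [AddCommGroup A] [Module k A] [AddCommGroup X]
    [Module k X] [AddCommGroup W] [Module k W] (f : A →ₗ[k] X) {i : W →ₗ[k] X}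
    (hi : Function.Injective i) (hrange : LinearMap.range f = LinearMap.range i)
    {p : Submodule k A} (hp : p = LinearMap.ker f) :
    ∃ e : (A ⧸ p) ≃ₗ[k] W, ∀ a, i (e (p.mkQ a)) = f a := by
  subst hp
  refine ⟨f.quotKerEquivRange ≪≫ₗ LinearEquiv.ofEq _ _ hrange ≪≫ₗ
    (LinearEquiv.ofInjective i hi).symm, fun a => ?_⟩
  have := congrArg Subtype.val ((LinearEquiv.ofInjective i hi).apply_symm_apply
    (LinearEquiv.ofEq _ _ hrange (f.quotKerEquivRange (Submodule.Quotient.mk a))))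
  exact this

variable [NeZero (2 : k)]

/-! ### Leading terms on the filtration: range, parity and naturality. -/

section LeadingTerm

variable {lam nu xi mu : YoungDiagram} (h : mu ≤ xi) (h' : xi ≤ lam) {M N M' N' : SVec k}

variable (M N) in
/-- The leading term of elements of `S^{λ / μ} (M ⊕ N)` at `ξ`. -/
def leadMap : (symPow lam mu (M.sum N)).carrier →ₗ[k]
    ((symPow xi mu M).tensor (symPow lam xi N)).carrier :=
  (exists_leading h h' M N).choose

theorem leadMap_self {z : ((M.pow (size xi mu)).tensor (N.pow (size lam xi))).carrier}
    (hz : z ∈ gammaTensor lam xi mu M N) :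
    leadMap h h' M N (theta lam mu (M.sum N) (astMap h h' M N z))
      = tensorMap (theta xi mu M) (theta lam xi N) z :=
  (exists_leading h h' M N).choose_spec.1 z hz

theorem leadMap_of_lexLT (hnu : mu ≤ nu) (hnu' : nu ≤ lam) (hlt : LexLT nu xi)
    (z : ((M.pow (size nu mu)).tensor (N.pow (size lam nu))).carrier) :
    leadMap h h' M N (theta lam mu (M.sum N) (astMap hnu hnu' M N z)) = 0 :=
  (exists_leading h h' M N).choose_spec.2 nu hnu hnu' hlt z

theorem leadMap_Lspace_of_lexLT (hlt : LexLT nu xi) :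
    ∀ x ∈ Lspace lam mu nu M N, leadMap h h' M N x = 0 := by
  suffices hs : Lspace lam mu nu M N ≤ LinearMap.ker (leadMap h h' M N) from hs
  exact Lspace_le_iff.mpr fun r hr hr' hle z _ => leadMap_of_lexLT h h' hr hr'
    (lexLT_iff.mpr ((lexLE_iff.mp hle).trans_lt (lexLT_iff.mp hlt))) z

/-- Products at `ξ` have leading term `θ x ⊗ θ y`, and products at `ν ≺ ξ` have leading term zero.
-/
theorem leadMap_Lspace_mem_range :
    ∀ x ∈ Lspace lam mu xi M N, leadMap h h' M N x ∈ LinearMap.range (boxIncl lam xi mu M N) := by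
  suffices hs : Lspace lam mu xi M N ≤
      (LinearMap.range (boxIncl lam xi mu M N)).comap (leadMap h h' M N) from hs
  refine Lspace_le_iff.mpr ?_
  rintro r hr hr' (rfl | hlt) z hz
  · rw [Submodule.mem_comap, leadMap_self hr hr' hz, ← gammaTensor_map]
    exact Submodule.mem_map_of_mem hz
  · rw [Submodule.mem_comap, leadMap_of_lexLT h h' hr hr' hlt]
    exact Submodule.zero_mem _

theorem exists_leadMap_eq (w : ((schurSpace xi mu M).tensor (schurSpace lam xi N)).carrier) :
    ∃ x ∈ Lspace lam mu xi M N, leadMap h h' M N x = boxIncl lam xi mu M N w := by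
  obtain ⟨z, hz, hzw⟩ := gammaTensor_map.ge (LinearMap.mem_range_self (boxIncl lam xi mu M N) w)
  exact ⟨_, theta_astMap_mem_Lspace h h' (Or.inl rfl) hz, (leadMap_self h h' hz).trans hzw⟩

theorem tensorMap_theta_γ (z : ((M.pow (size xi mu)).tensor (N.pow (size lam xi))).carrier) :
    tensorMap (theta xi mu M) (theta lam xi N) (SVec.γ _ z)
      = SVec.γ _ (tensorMap (theta xi mu M) (theta lam xi N) z) := by
  have h1 : HasParity (V := M.pow (size xi mu)) 0 (theta xi mu M) :=
    parity_zero_iff.mpr (theta_γ xi mu M)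
  have h2 : HasParity (V := N.pow (size lam xi)) 0 (theta lam xi N) :=
    parity_zero_iff.mpr (theta_γ lam xi N)
  rw [← superTensor_eq_tensorMap _ h2]
  exact (parity_zero_iff.mp (by simpa using superTensor_parity h1 h2) z).symm

/-- The leading term map is known only through its values on products at partitions `ν ⪯ ξ`. These
span `L_ξ`, so compatibilities can be checked on `L_ξ`, and there they follow from those of `astMap`
and `θ`. -/
theorem leadMap_γ : ∀ x ∈ Lspace lam mu xi M N,
    leadMap h h' M N ((symPow lam mu (M.sum N)).γ x) = SVec.γ _ (leadMap h h' M N x) := by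
  suffices hs : Lspace lam mu xi M N ≤ LinearMap.eqLocus
      (leadMap h h' M N ∘ₗ (symPow lam mu (M.sum N)).γ) (SVec.γ _ ∘ₗ leadMap h h' M N) from hs
  refine Lspace_le_iff.mpr ?_
  rintro r hr hr' (rfl | hlt) z hz
  · rw [LinearMap.mem_eqLocus, LinearMap.comp_apply, LinearMap.comp_apply, theta_γ, astMap_γ,
      leadMap_self hr hr' hz, leadMap_self hr hr' (gammaTensor_γ z hz), tensorMap_theta_γ]
  · rw [LinearMap.mem_eqLocus, LinearMap.comp_apply, LinearMap.comp_apply, theta_γ, astMap_γ,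
      leadMap_of_lexLT h h' hr hr' hlt, leadMap_of_lexLT h h' hr hr' hlt, map_zero]

/-- Leading terms are natural. -/
theorem leadMap_map {φ : (M.pow (size xi mu)).carrier →ₗ[k] (M'.pow (size xi mu)).carrier}
    {ψ : (N.pow (size lam xi)).carrier →ₗ[k] (N'.pow (size lam xi)).carrier}
    (hφ : ∀ σ, permAct M' σ ∘ₗ φ = φ ∘ₗ permAct M σ)
    (hψ : ∀ σ, permAct N' σ ∘ₗ ψ = ψ ∘ₗ permAct N σ)
    {F : (symPow lam mu (M.sum N)).carrier →ₗ[k] (symPow lam mu (M'.sum N')).carrier}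
    (hF : ∀ t, F (theta lam mu (M.sum N) t)
      = theta lam mu (M'.sum N') (star (size_add h h') φ ψ t))
    {A : (symPow xi mu M).carrier →ₗ[k] (symPow xi mu M').carrier}
    (hA : ∀ t, A (theta xi mu M t) = theta xi mu M' (φ t))
    {B : (symPow lam xi N).carrier →ₗ[k] (symPow lam xi N').carrier}
    (hB : ∀ t, B (theta lam xi N t) = theta lam xi N' (ψ t)) :
    ∀ x ∈ Lspace lam mu xi M N,
      leadMap h h' M' N' (F x) = superTensor A B (leadMap h h' M N x) := by
  suffices hs : Lspace lam mu xi M N ≤ LinearMap.eqLocus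
      (leadMap h h' M' N' ∘ₗ F) (superTensor A B ∘ₗ leadMap h h' M N) from hs
  refine Lspace_le_iff.mpr ?_
  rintro r hr hr' (rfl | hlt) z hz
  · have h1 := LinearMap.congr_fun (star_astMap hr hr' hφ hψ) z
    have h2 : tensorMap (theta r mu M') (theta lam r N') ∘ₗ superTensor φ ψ
        = superTensor A B ∘ₗ tensorMap (theta r mu M) (theta lam r N) := by
      rw [tensorMap_superTensor _ _ _ (parity_zero_iff.mpr (theta_γ lam r N')),
        superTensor_tensorMap _ _ (parity_zero_iff.mpr (theta_γ r mu M))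
          (parity_zero_iff.mpr (theta_γ lam r N)),
        show A ∘ₗ theta r mu M = theta r mu M' ∘ₗ φ from LinearMap.ext hA,
        show B ∘ₗ theta lam r N = theta lam r N' ∘ₗ ψ from LinearMap.ext hB]
    rw [LinearMap.mem_eqLocus, LinearMap.comp_apply, LinearMap.comp_apply, hF,
      ← LinearMap.comp_apply (star _ _ _), h1, LinearMap.comp_apply,
      leadMap_self hr hr' (superTensor_mem_gammaTensor hφ hψ z hz), leadMap_self hr hr' hz]
    exact LinearMap.congr_fun h2 z
  -- A product at a lower partition goes to a product at the same partition, so both sides are zero.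
  · obtain ⟨z', -, heq⟩ := exists_star_astMap hr hr' (size_add h h') hφ hψ hz
    rw [LinearMap.mem_eqLocus, LinearMap.comp_apply, LinearMap.comp_apply, hF, heq,
      leadMap_of_lexLT h h' hr hr' hlt, leadMap_of_lexLT h h' hr hr' hlt, map_zero]

theorem leadMap_map_zero {e f : ℕ} (hd : e + f = size lam mu) (hne : e ≠ size xi mu)
    {φ : (M.pow e).carrier →ₗ[k] (M'.pow e).carrier}
    {ψ : (N.pow f).carrier →ₗ[k] (N'.pow f).carrier}
    (hφ : ∀ σ, permAct M' σ ∘ₗ φ = φ ∘ₗ permAct M σ)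
    (hψ : ∀ σ, permAct N' σ ∘ₗ ψ = ψ ∘ₗ permAct N σ)
    {F : (symPow lam mu (M.sum N)).carrier →ₗ[k] (symPow lam mu (M'.sum N')).carrier}
    (hF : ∀ t, F (theta lam mu (M.sum N) t) = theta lam mu (M'.sum N') (star hd φ ψ t)) :
    ∀ x ∈ Lspace lam mu xi M N, leadMap h h' M' N' (F x) = 0 := by
  suffices hs : Lspace lam mu xi M N ≤ LinearMap.ker (leadMap h h' M' N' ∘ₗ F) from hs
  refine Lspace_le_iff.mpr ?_
  rintro r hr hr' (rfl | hlt) z hz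
  · have h1 := LinearMap.congr_fun (star_astMap_zero hr hr' hd hne hφ hψ) z
    rw [LinearMap.mem_ker, LinearMap.comp_apply, hF, ← LinearMap.comp_apply (star _ _ _), h1,
      LinearMap.zero_apply, map_zero, map_zero]
  · obtain ⟨z', -, heq⟩ := exists_star_astMap hr hr' hd hφ hψ hz
    rw [LinearMap.mem_ker, LinearMap.comp_apply, hF, heq, leadMap_of_lexLT h h' hr hr' hlt]

end LeadingTerm

/-! ### The graded pieces of the filtration. -/

section Filtration

variable {lam mu : YoungDiagram} (M N : SVec k)

/-- The subspace `L_ξ (M, N)` of `Ŝ_{λ / μ} (M ⊕ N)`. -/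
def filtration (lam mu xi : YoungDiagram) (M N : SVec k) :
    Submodule k (schurSpace lam mu (M.sum N)).carrier :=
  (Lspace lam mu xi M N).comap (schurIncl lam mu (M.sum N))

/-- Leading terms supply the surjections onto the tensor products of Schur spaces, tableaux supply
the bound on the total dimension, and `graded_of_finrank_le` combines the two. -/
theorem filtration_graded (hmu : mu ≤ lam) :
    ⨆ xi : Between lam mu, filtration lam mu xi.1 M N = ⊤ ∧
    ∀ xi : Between lam mu, ∀ l ∈ filtration lam mu xi.1 M N,
      leadMap xi.2.1 xi.2.2 M N (schurIncl lam mu (M.sum N) l) = 0 →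
        l ∈ ⨆ nu : {nu : Between lam mu // LexLT nu.1 xi.1}, filtration lam mu nu.1.1 M N := by
  have : Fintype (Between lam mu) := Fintype.ofFinite _
  refine graded_of_finrank_le (κ := fun xi : Between lam mu => toLex xi.1.rowLen)
    (rowLen_injective.comp Subtype.val_injective) (fun xi => filtration lam mu xi.1 M N)
    (fun xi => boxIncl lam xi.1 mu M N) (fun xi => boxIncl_injective)
    (fun xi => leadMap xi.2.1 xi.2.2 M N ∘ₗ schurIncl lam mu (M.sum N)) (fun xi w => ?_)
    (fun xi nu hlt l hl => leadMap_Lspace_of_lexLT _ _ hlt _ hl) ?_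
  · obtain ⟨x, hx, hxw⟩ := exists_leadMap_eq xi.2.1 xi.2.2 w
    exact ⟨⟨x, Lspace_le_schurSub hx⟩, hx, hxw⟩
  · refine (finrank_schurSub_sum_le hmu M N).trans (Finset.sum_le_sum fun xi _ => ?_)
    exact (Module.finrank_tensorProduct (R := k) (S := k)
      (M := (schurSpace xi.1 mu M).carrier) (M' := (schurSpace lam xi.1 N).carrier)).ge

/-- That the leading term at `ξ` kills the lower pieces is built into it. That nothing else in `L_ξ`
is killed is the second part of `filtration_graded`. -/
theorem exists_gradedEquiv (hmu : mu ≤ lam) (xi : Between lam mu) :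
    ∃ e : (filtration lam mu xi.1 M N ⧸
        (⨆ nu : {nu : Between lam mu // LexLT nu.1 xi.1}, filtration lam mu nu.1.1 M N).comap
          (filtration lam mu xi.1 M N).subtype) ≃ₗ[k]
        ((schurSpace xi.1 mu M).tensor (schurSpace lam xi.1 N)).carrier,
      ∀ l, boxIncl lam xi.1 mu M N (e (Submodule.mkQ _ l))
        = leadMap xi.2.1 xi.2.2 M N (schurIncl lam mu (M.sum N) l.1) := by
  refine exists_quotient_equiv (leadMap xi.2.1 xi.2.2 M N ∘ₗ schurIncl lam mu (M.sum N) ∘ₗ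
    (filtration lam mu xi.1 M N).subtype) boxIncl_injective ?_ ?_
  · apply le_antisymm
    · rintro _ ⟨l, rfl⟩
      exact leadMap_Lspace_mem_range _ _ _ l.2
    · rintro _ ⟨w, rfl⟩
      obtain ⟨x, hx, hxw⟩ := exists_leadMap_eq xi.2.1 xi.2.2 w
      exact ⟨⟨⟨x, Lspace_le_schurSub hx⟩, hx⟩, hxw⟩
  · apply le_antisymm
    · have hker : ⨆ nu : {nu : Between lam mu // LexLT nu.1 xi.1},
          filtration lam mu nu.1.1 M N ≤
          LinearMap.ker (leadMap xi.2.1 xi.2.2 M N ∘ₗ schurIncl lam mu (M.sum N)) :=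
        iSup_le fun nu l hl => leadMap_Lspace_of_lexLT _ _ nu.2 _ hl
      exact fun l hl => hker hl
    · exact fun l hl => (filtration_graded M N hmu).2 xi l.1 l.2 hl

end Filtration

end Grading

section Subfunctors

variable {k : Type u} [Field k] [NeZero (2 : k)]

/-! ### The filtration by subfunctors and the isomorphisms of type II. -/

section Subfunctors

variable {lam mu : YoungDiagram} {M N M' N' : SVec k}

theorem filtration_γ (xi : YoungDiagram) : ∀ x ∈ filtration lam mu xi M N,
    (schurSpace lam mu (M.sum N)).γ x ∈ filtration lam mu xi M N :=
  fun x hx => Lspace_γ (schurIncl lam mu (M.sum N) x) hx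

variable (lam mu) in
/-- The subfunctor `L_ξ` of `(Ŝ_{λ / μ})^bi`. -/
def filtrationSub (k : Type u) [Field k] [NeZero (2 : k)] (xi : YoungDiagram) :
    SubBi (schur (k := k) lam mu).bi where
  carrier V W := filtration lam mu xi V.toSVec W.toSVec
  γ_mem _ _ := filtration_γ xi
  map_mem hd _ _ _ _ φ ψ x hx := map_mem_Lspace hd φ.2.1 ψ.2.1
    (symMap_theta lam mu (homStar hd φ ψ)) (schurIncl lam mu _ x) hx

variable (lam mu) in
/-- The restriction of `L_ξ` to type II. -/
def filtrationSubRes (k : Type u) [Field k] [NeZero (2 : k)] (xi : YoungDiagram) :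
    SubBi ((schur (k := k) lam mu).res 1).bi where
  carrier V W := filtration lam mu xi V.toSVec W.toSVec
  γ_mem _ _ := filtration_γ xi
  -- Only the compatibility of `φ` and `ψ` with place permutations is used, not that with the
  -- Clifford action. So the argument is that of type I.
  map_mem hd _ _ _ _ φ ψ x hx := map_mem_Lspace hd φ.2.1 ψ.2.1
    (symMap_theta lam mu (homForget (homStar hd φ ψ))) (schurIncl lam mu _ x) hx

theorem schurIncl_even (M : SVec k) :
    HasParity (V := schurSpace lam mu M) (W := symPow lam mu M) 0 (schurIncl lam mu M) :=
  parity_zero_iff.mpr fun _ => rfl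

theorem boxIncl_γ {xi : YoungDiagram}
    (w : ((schurSpace xi mu M).tensor (schurSpace lam xi N)).carrier) :
    boxIncl lam xi mu M N (SVec.γ _ w) = SVec.γ _ (boxIncl lam xi mu M N w) := by
  rw [boxIncl, ← superTensor_eq_tensorMap _ (schurIncl_even N)]
  exact (parity_zero_iff.mp (by
    simpa using superTensor_parity (schurIncl_even M) (schurIncl_even N)) w).symm

theorem boxIncl_superTensor {xi : YoungDiagram}
    {A : (symPow xi mu M).carrier →ₗ[k] (symPow xi mu M').carrier}
    {B : (symPow lam xi N).carrier →ₗ[k] (symPow lam xi N').carrier}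
    {A' : (schurSpace xi mu M).carrier →ₗ[k] (schurSpace xi mu M').carrier}
    {B' : (schurSpace lam xi N).carrier →ₗ[k] (schurSpace lam xi N').carrier}
    (hA : schurIncl xi mu M' ∘ₗ A' = A ∘ₗ schurIncl xi mu M)
    (hB : schurIncl lam xi N' ∘ₗ B' = B ∘ₗ schurIncl lam xi N) :
    boxIncl lam xi mu M' N' ∘ₗ superTensor A' B' = superTensor A B ∘ₗ boxIncl lam xi mu M N := by
  rw [boxIncl, boxIncl, tensorMap_superTensor _ _ _ (schurIncl_even N'),
    superTensor_tensorMap _ _ (schurIncl_even M) (schurIncl_even N), hA, hB]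

theorem schurBox_map (xi : Between lam mu) {V V' W W' : SMod k 1}
    (φ : hom (size xi.1 mu) V V') (ψ : hom (size lam xi.1) W W') :
    (schurBox k xi).map (size_add xi.2.1 xi.2.2) φ ψ
      = superTensor (((schur xi.1 mu).res 1).map φ) (((schur lam xi.1).res 1).map ψ) := by
  simp only [schurBox, PolFunctor.box, dite_true]
  rfl

theorem schurBox_map_of_ne (xi : Between lam mu) {e f : ℕ} (hd : e + f = size lam mu)
    (hne : e ≠ size xi.1 mu) {V V' W W' : SMod k 1} (φ : hom e V V') (ψ : hom f W W') :
    (schurBox k xi).map hd φ ψ = 0 := by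
  simp only [schurBox, PolFunctor.box, dif_neg hne]
  rfl

/-- Evenness and naturality are tested after the injective map `boxIncl`, where they become the
corresponding properties of leading terms. -/
theorem nonempty_gradedIso (hmu : mu ≤ lam) (xi : Between lam mu) :
    Nonempty (BiIso (grPiece (fun nu : Between lam mu => filtrationSubRes lam mu k nu.1) xi)
      (schurBox k xi)) := by
  choose E hE using fun M N : SVec k => exists_gradedEquiv M N hmu xi
  refine ⟨⟨fun V W => E V.toSVec W.toSVec, fun V W x => ?_, fun {e f} hd {V V' W W'} φ ψ x => ?_⟩⟩
  · obtain ⟨l, rfl⟩ := Submodule.mkQ_surjective _ x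
    apply boxIncl_injective
    have h1 := hE V.toSVec W.toSVec
    have h2 := leadMap_γ xi.2.1 xi.2.2 (schurIncl lam mu _ l.1) l.2
    refine (boxIncl_γ _).trans ?_
    refine (congrArg _ (h1 l)).trans (h2.symm.trans ?_)
    exact (h1 ⟨(schurSpace lam mu (V.toSVec.sum W.toSVec)).γ l.1, filtration_γ _ _ l.2⟩).symm
  · obtain ⟨l, rfl⟩ := Submodule.mkQ_surjective _ x
    apply boxIncl_injective
    have hF := symMap_theta lam mu (homForget (homStar hd φ ψ))
    have h1 := hE V'.toSVec W'.toSVec ((filtrationSubRes lam mu k xi.1).toBi.map hd φ ψ l)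
    refine h1.trans ?_
    by_cases he : e = size xi.1 mu
    · subst he
      obtain rfl : f = size lam xi.1 := by have := size_add xi.2.1 xi.2.2; omega
      have h2 := leadMap_map xi.2.1 xi.2.2 φ.2.1 ψ.2.1 hF (symMap_theta xi.1 mu (homForget φ))
        (symMap_theta lam xi.1 (homForget ψ)) (schurIncl lam mu _ l.1) l.2
      have h3 := boxIncl_superTensor (lam := lam) (mu := mu) (xi := xi.1)
        (A := symMap xi.1 mu (homForget φ)) (A' := ((schur xi.1 mu).res 1).map φ)
        (B := symMap lam xi.1 (homForget ψ)) (B' := ((schur lam xi.1).res 1).map ψ) rfl rfl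
      rw [schurBox_map]
      refine h2.trans ?_
      refine Eq.trans ?_ (LinearMap.congr_fun h3 _).symm
      exact congrArg _ (hE V.toSVec W.toSVec l).symm
    -- Morphisms of other bidegrees act by zero on both sides.
    · have h2 := leadMap_map_zero xi.2.1 xi.2.2 hd he φ.2.1 ψ.2.1 hF (schurIncl lam mu _ l.1) l.2
      rw [schurBox_map_of_ne xi hd he]
      exact h2.trans (map_zero (boxIncl lam xi.1 mu V'.toSVec W'.toSVec)).symm

end Subfunctors

/-- The direct sum of isomorphisms. -/
def BiIso.directSum {n d : ℕ} {ι : Type} [Finite ι] {S T : ι → BiFunctor k n d}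
    (F : ∀ i, BiIso (S i) (T i)) : BiIso (directSum S) (directSum T) where
  equiv V W := LinearEquiv.piCongrRight fun i => (F i).equiv V W
  even V W x := funext fun i => (F i).even V W (x i)
  natural h _ _ _ _ φ ψ x := funext fun i => (F i).natural h φ ψ (x i)

end Subfunctors

end SuperSchur

end

/-! ### Assembly of the result. -/

theorem mainTheorem8 {k : Type u} [Field k] [NeZero (2 : k)] (lam mu : YoungDiagram)
    (h : mu ≤ lam) :
    ∃ (L : Between lam mu → SubBi (schur (k := k) lam mu).bi)
      (LII : Between lam mu → SubBi ((schur (k := k) lam mu).res 1).bi),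
      -- `L_ξ (M, N)` is the subspace `θ_{λ / μ} (K^ξ (M, N))` of `Ŝ_{λ / μ} (M ⊕ N)`
      (∀ xi M N, ((L xi).carrier M N).map (schurIncl lam mu (M.sum N).toSVec)
        = Lspace lam mu xi.1 M.toSVec N.toSVec) ∧
      -- `L^II_ξ` is the restriction of `L_ξ`
      (∀ xi V W, (LII xi).carrier V W = (L xi).carrier V.forget W.forget) ∧
      -- the `L^II_ξ` form a filtration
      (∀ nu xi, LexLE nu.1 xi.1 → ∀ V W, (LII nu).carrier V W ≤ (LII xi).carrier V W) ∧
      (∀ V W, (LII ⟨lam, h, le_refl lam⟩).carrier V W = ⊤) ∧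
      -- the associated graded object, piece by piece and as a whole
      (∀ xi, Nonempty (BiIso (grPiece LII xi) (schurBox k xi))) ∧
      Nonempty (BiIso (directSum fun xi => grPiece LII xi)
        (directSum fun xi : Between lam mu => schurBox k xi)) := by
  refine ⟨fun xi => filtrationSub lam mu k xi.1, fun xi => filtrationSubRes lam mu k xi.1,
    fun xi M N => ?_, fun _ _ _ => rfl, fun nu xi hle V W => ?_, fun V W => ?_,
    nonempty_gradedIso h, ⟨BiIso.directSum fun xi => (nonempty_gradedIso h xi).some⟩⟩
  -- The subspace was defined by intersecting `L_ξ` with the Schur space. Nothing is lost, because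
  -- products of alternating tensors are alternating.
  · refine (Submodule.map_comap_subtype _ _).trans ?_
    exact inf_eq_right.mpr Lspace_le_schurSub
  · exact Submodule.comap_mono (Lspace_mono hle)
  -- The sum of all `L_ξ` is the whole space, and each of them lies in `L_λ`.
  · refine top_le_iff.mp ((filtration_graded V.toSVec W.toSVec h).1.ge.trans ?_)
    exact iSup_le fun xi => Submodule.comap_mono (Lspace_mono (lexLE_of_le xi.2.2))
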